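/- **Setting.** Let $(x_i,y_i)_{i=1}^n$ with $x_i\in\mathbb R^d$, $y_i\in\{1,\dots,k\}$, $k\ge 2$, every class occurring, be linearly separable: some $W\in\mathbb R^{k\times d}$ has $(e_{y_i}-e_c)^\top Wx_i>0$ for all $i$ and all $c\ne y_i$. Assume $\|x_i\|_1\le R$ for all $i$, where $R>0$. Let $\|\cdot\|$ be an entry-wise or Schatten $p$-norm on $\mathbb R^{k\times d}$, $1\le p\le\infty$. Put $\mathrm{mar}(W)=\min_{i,\,c\ne y_i}(e_{y_i}-e_c)^\top Wx_i$ and $\gamma=\max_{\|W\|\le 1}\mathrm{mar}(W)$. Let $\ell_i(W)=-\log\mathbb S_{y_i}(Wx_i)$ be the cross-entropy loss of sample $i$ ($\mathbb S$ the softmax map) and $\mathcal L=\frac1n\sum_i\ell_i$. **Algorithm.** Let $n=mb$ with integers $m,b$, let $\beta_1\in(0,1)$, and let $\eta_t=c\,t^{-a}$ for $t\ge1$ and $0\le\eta_0\le c$, where $c>0$ and $a\in(0,1]$. In every epoch $e$ the index set $\{1,\dots,n\}$ is (randomly) partitioned into batches $\mathcal B_{em},\dots,\mathcal B_{em+m-1}$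 of size $b$. From a given $W_0$, with $M_{-1}=0$, for $t\ge 0$ $$M_t=\beta_1M_{t-1}+\frac{1-\beta_1}{b}\sum_{i\in\mathcal B_t}\nabla\ell_i(W_t),\qquad \Delta_t\in\arg\max_{\|\Delta\|\le1}\langle M_t,\Delta\rangle,\qquad W_{t+1}=W_t-\eta_t\Delta_t,$$ where $\langle A,B\rangle=\mathrm{tr}(A^\top B)$ and any maximizer may be chosen. Put $\xi=\dfrac{m}{1-\beta_1}$ and $\rho=\gamma-2(1-\beta_1)m(m^2-1)R$. **Claim.** For all $a\in(0,1]$, $c,R,\rho_0>0$, all reals $B_0,\Lambda_0$ and every $\xi_0>1$ there is a constant $C>0$, depending on these numbers only (on $\xi_0$ only if $a=1$), such that for all $n,m,b,\beta_1$ as above there is an $N$, depending only on $n,m,b,\beta_1$ and the numbers just listed, with the following property. For all $k,d$, every such norm, all data, step sizes and $W_0$ as above with $\rho\ge\rho_0$, $\|W_0\|\le B_0$ and $\mathcal L(W_0)\le\Lambda_0$, every realization of the partitions, every choice of the maximizers, and all $t\ge N$, we have $W_t\ne0$ and $$\rho-\frac{\min_{i,\,c\ne y_i}(e_{y_i}-e_c)^\top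 W_tx_i}{\|W_t\|}\;\le\; C\cdot\begin{cases}\dfrac{n\,\xi^{1/a-1}+\xi\,t^{1-2a}}{t^{1-a}}, & a<\tfrac12,\\[2mm] \dfrac{\xi\,(n+\log t)}{t^{1/2}}, & a=\tfrac12,\\[2mm] \dfrac{n\,\xi^{1/a-1}+\xi}{t^{1-a}}, & \tfrac12<a<1,\\[2mm] \dfrac{n\log\xi+\xi}{\log t}, & a=1\ \text{and}\ \xi\ge\xi_0.\end{cases}$$ In particular $C$ does not depend on the dimension $d$, nor on $n$, $m$, $b$, $\beta_1$. -/

import Mathlib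

open scoped ENNReal Matrix

noncomputable section

namespace MaxMargin

variable {n k d : ℕ}

/-- The two families of matrix norms: entry-wise `p`-norms and Schatten `p`-norms. -/
inductive NormKind where
  | entrywise
  | schatten

/-- The singular values of a `k × d` matrix in decreasing order; all but the first `rank A` of
these `d` numbers are zero. -/
def singVals (A : Matrix (Fin k) (Fin d) ℝ) : Fin d → ℝ :=
  fun i => (Matrix.toEuclideanLin A).singularValues (i : ℕ)

/-- The entry-wise `p`-norm, i.e. the `ℓ^p` norm of the family of entries, or the Schatten `p`-norm,
i.e. the `ℓ^p` norm of the family of singular values (`p = ∞` gives the maximum). Used for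
`1 ≤ p ≤ ∞`. -/
def matNorm (κ : NormKind) (p : ℝ≥0∞) (A : Matrix (Fin k) (Fin d) ℝ) : ℝ :=
  match κ with
  | .entrywise => ‖WithLp.toLp p (fun q : Fin k × Fin d => A q.1 q.2)‖
  | .schatten => ‖WithLp.toLp p (singVals A)‖

/-- The standard inner product `⟨A, B⟩ = tr (Aᵀ B)`. -/
def matInner (A B : Matrix (Fin k) (Fin d) ℝ) : ℝ := (Aᵀ * B).trace

/-- The softmax map. -/
def softmax (v : Fin k → ℝ) (c : Fin k) : ℝ := Real.exp (v c) / ∑ j, Real.exp (v j)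

/-- The cross-entropy loss `-log 𝕊_{y_i}(W x_i)` of the `i`-th sample. -/
def sampleLoss (X : Fin n → Fin d → ℝ) (y : Fin n → Fin k) (i : Fin n)
    (W : Matrix (Fin k) (Fin d) ℝ) : ℝ :=
  -Real.log (softmax (W *ᵥ X i) (y i))

/-- The empirical loss, the average of the sample losses. -/
def loss (X : Fin n → Fin d → ℝ) (y : Fin n → Fin k) (W : Matrix (Fin k) (Fin d) ℝ) : ℝ :=
  (1 / (n : ℝ)) * ∑ i, sampleLoss X y i W

/-- The gradient with respect to `W` of the loss of the `i`-th sample: the matrix of its partial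
derivatives with respect to the entries of `W`. -/
def sampleGrad (X : Fin n → Fin d → ℝ) (y : Fin n → Fin k) (i : Fin n)
    (W : Matrix (Fin k) (Fin d) ℝ) : Matrix (Fin k) (Fin d) ℝ :=
  Matrix.of fun c j => deriv (fun s : ℝ => sampleLoss X y i (W + s • Matrix.single c j (1 : ℝ))) 0

/-- The stochastic gradient on the mini-batch `S`: the average over `S` of the sample gradients. -/
def batchGrad (X : Fin n → Fin d → ℝ) (y : Fin n → Fin k) (S : Finset (Fin n))
    (W : Matrix (Fin k) (Fin d) ℝ) : Matrix (Fin k) (Fin d) ℝ :=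
  (1 / (S.card : ℝ)) • ∑ i ∈ S, sampleGrad X y i W

/-- The unnormalized margin `min_{i, c ≠ y_i} (e_{y_i} - e_c)ᵀ W x_i` (a minimum over a finite set,
nonempty as soon as there are a sample and two classes). -/
def margin (X : Fin n → Fin d → ℝ) (y : Fin n → Fin k) (W : Matrix (Fin k) (Fin d) ℝ) : ℝ :=
  ⨅ q : {q : Fin n × Fin k // q.2 ≠ y q.1}, ((W *ᵥ X q.1.1) (y q.1.1) - (W *ᵥ X q.1.1) q.1.2)

/-- The maximum margin `γ`: the supremum of the margin over the unit ball of the norm. -/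
def maxMargin (κ : NormKind) (p : ℝ≥0∞) (X : Fin n → Fin d → ℝ) (y : Fin n → Fin k) : ℝ :=
  sSup (margin X y '' {W : Matrix (Fin k) (Fin d) ℝ | matNorm κ p W ≤ 1})

/-- The effective margin `ρ = γ - 2 (1 - β₁) m (m² - 1) R`. -/
def effMargin (κ : NormKind) (p : ℝ≥0∞) (X : Fin n → Fin d → ℝ) (y : Fin n → Fin k)
    (m : ℕ) (β₁ R : ℝ) : ℝ :=
  maxMargin κ p X y - 2 * (1 - β₁) * (m : ℝ) * ((m : ℝ) ^ 2 - 1) * R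

/-- Linear separability of the training data. -/
def Separable (X : Fin n → Fin d → ℝ) (y : Fin n → Fin k) : Prop :=
  ∃ W : Matrix (Fin k) (Fin d) ℝ, ∀ i, ∀ c, c ≠ y i → 0 < (W *ᵥ X i) (y i) - (W *ᵥ X i) c

/-- The step sizes `η_t = c t^{-a}` for `t ≥ 1`, with an initial step size `0 ≤ η_0 ≤ c`. -/
structure IsPolySchedule (c a : ℝ) (η : ℕ → ℝ) : Prop where
  zero_nonneg : 0 ≤ η 0
  zero_le : η 0 ≤ c
  eq_rpow : ∀ t : ℕ, 1 ≤ t → η t = c * (t : ℝ) ^ (-a)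

/-- A realization of sampling without replacement: the batches `S (e * m), …, S (e * m + (m - 1))`
of every epoch `e` partition the sample indices into `m` sets of size `b`. -/
structure IsReshuffling (m b : ℕ) (S : ℕ → Finset (Fin n)) : Prop where
  card_eq : ∀ t, (S t).card = b
  disjoint : ∀ e : ℕ, ∀ j < m, ∀ j' < m, j ≠ j' → Disjoint (S (e * m + j)) (S (e * m + j'))
  cover : ∀ e : ℕ, ∀ i : Fin n, ∃ j < m, i ∈ S (e * m + j)

/-- `W` is a sequence of iterates of stochastic steepest descent with momentum, with momentum
buffers `M` (started from `M_{-1} = 0`) and update directions `Δ`. The direction `Δ t` is any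
maximizer of `⟨M t, ·⟩` over the unit ball of the norm. -/
structure IsMomentumRun (κ : NormKind) (p : ℝ≥0∞) (X : Fin n → Fin d → ℝ) (y : Fin n → Fin k)
    (β₁ : ℝ) (η : ℕ → ℝ) (S : ℕ → Finset (Fin n))
    (W M Δ : ℕ → Matrix (Fin k) (Fin d) ℝ) : Prop where
  buffer_zero : M 0 = (1 - β₁) • batchGrad X y (S 0) (W 0)
  buffer_succ : ∀ t, M (t + 1) = β₁ • M t + (1 - β₁) • batchGrad X y (S (t + 1)) (W (t + 1))
  dir_mem : ∀ t, matNorm κ p (Δ t) ≤ 1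
  dir_max : ∀ t, ∀ D : Matrix (Fin k) (Fin d) ℝ, matNorm κ p D ≤ 1 →
    matInner (M t) D ≤ matInner (M t) (Δ t)
  step : ∀ t, W (t + 1) = W t - η t • Δ t

/-- The normalized margin gap `ρ - margin(W) / ‖W‖`. -/
def marginGap (κ : NormKind) (p : ℝ≥0∞) (X : Fin n → Fin d → ℝ) (y : Fin n → Fin k)
    (m : ℕ) (β₁ R : ℝ) (W : Matrix (Fin k) (Fin d) ℝ) : ℝ :=
  effMargin κ p X y m β₁ R - margin X y W / matNorm κ p W

/-- The scaling factor `ξ = m / (1 - β₁)`. -/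
def momScale (m : ℕ) (β₁ : ℝ) : ℝ := (m : ℝ) / (1 - β₁)

end MaxMargin

end

open MaxMargin

namespace MaxMargin

/-! Write L for the loss, G for `avgMissProb`, ξ for `momScale`, S_t for the sum of the step sizes
before time t and Q_t for the sum of their squares. The norm estimates rest on subadditivity,
homogeneity and |A i j| ≤ ‖A‖. Together with ‖x_i‖₁ ≤ R, the last property makes a move of norm δ
change logit differences by at most 2Rδ, so no constant depends on k or d.

The wrong classes of a sample carry probability mass `missProb`; hence the slope of the loss, its
second-order remainder and the variation of its gradient are all bounded by multiples of G. A
competitor U in the unit ball has slope at most -mar(U) G. Uniformly over the unit ball, the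
momentum buffer differs from the full gradient by a multiple of G with three sources: the uneven
visits within an epoch, the missing mass β^(t+1) of the zero start, and the staleness of old
gradients. The first does not vanish in time and turns γ into ρ; the other two are O(ξ η_t) after a
burn-in time t₀. Thus L_{t+1} ≤ L_t - η_t (ρ - K η_t) G_t with K = O(ξ)
(`IsMomentumRun.loss_succ_le`, `IsPolySchedule.perturbation_le`).

While G > 1/(4n), the loss falls by order 1/n per unit of step size; since it is positive, a time
with G ≤ 1/(4n) is reached within a step budget of order n times the loss at t₀ (`exists_small`).
Afterwards L - nL²/2 ≤ G ≤ L yields exponential decay, 2nL_t ≤ exp(-ρ S + 1 + K Q_t), where S counts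
the steps since that time (`le_neg_log_of_decay`). The quadratic correction costs only the summand
1, so the rate is exactly ρ. As mar ≥ -log(2nL) when nL ≤ 1, the margin is at least ρ S_t - O(n(1 +
S_{t₀})) - K Q_t (`IsAdmissibleRun.le_margin`), whereas ‖W_t‖ ≤ B₀ + S_t. The gap is therefore
O((n(1 + S_{t₀}) + ξ Q_t) / S_t).

For a < 1 the burn-in needs t₀ of order ξ^(1/a), so S_{t₀} is of order ξ^(1/a-1); for a = 1 a
polynomial t₀ gives order log ξ. Inserting the growth of Q_t and S_t produces the four regimes
(`exists_rate`). -/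

/-- The properties of a matrix norm used in the analysis: subadditivity, homogeneity, and
domination of the entries. -/
structure IsEntryDominatingNorm {k d : ℕ} (N : Matrix (Fin k) (Fin d) ℝ → ℝ) : Prop where
  add_le : ∀ A B, N (A + B) ≤ N A + N B
  smul_le : ∀ (s : ℝ) A, N (s • A) ≤ |s| * N A
  entry_le : ∀ A i j, |A i j| ≤ N A

/-! ### Bessel families, singular values and the Schatten norms -/

/-- A finite family satisfying Bessel's inequality. -/
def IsBesselFamily {ι E : Type*} [Fintype ι] [NormedAddCommGroup E] [InnerProductSpace ℝ E]
    (u : ι → E) : Prop :=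
  ∀ x, ∑ i, inner ℝ (u i) x ^ 2 ≤ ‖x‖ ^ 2

section Bessel

variable {ι E F : Type*} [Fintype ι] [NormedAddCommGroup E] [InnerProductSpace ℝ E]
  [NormedAddCommGroup F] [InnerProductSpace ℝ F]

lemma IsBesselFamily.norm_le_one {u : ι → E} (hu : IsBesselFamily u) (i : ι) : ‖u i‖ ≤ 1 := by
  have h := (Finset.single_le_sum (f := fun j => inner ℝ (u j) (u i) ^ 2)
    (fun j _ => sq_nonneg _) (Finset.mem_univ i)).trans (hu (u i))
  simp only [real_inner_self_eq_norm_sq] at h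
  by_contra! hc
  have h1 : 1 < ‖u i‖ ^ 2 := by nlinarith
  nlinarith

/-- Expanding 0 ≤ ‖x - ∑ ⟨u i, x⟩ u i‖² gives the inequality. Unit length is not required, because
the left singular vectors attached to zero singular values are taken to be 0 below. -/
lemma isBesselFamily_of_orthogonal {u : ι → E} (h1 : ∀ i, ‖u i‖ ≤ 1)
    (h2 : ∀ i j, i ≠ j → inner ℝ (u i) (u j) = 0) : IsBesselFamily u := by
  classical
  intro x
  have key : ∀ s : Finset ι, ‖∑ i ∈ s, inner ℝ (u i) x • u i‖ ^ 2 ≤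
      ∑ i ∈ s, inner ℝ (u i) x ^ 2 := by
    intro s
    rw [← real_inner_self_eq_norm_sq, sum_inner]
    refine Finset.sum_le_sum fun i hi => ?_
    rw [inner_sum, Finset.sum_eq_single i]
    · rw [real_inner_smul_left, real_inner_smul_right, real_inner_self_eq_norm_sq]
      have : ‖u i‖ ^ 2 ≤ 1 := pow_le_one₀ (norm_nonneg _) (h1 i)
      nlinarith [sq_nonneg (inner ℝ (u i) x)]
    · intro j _ hj
      rw [real_inner_smul_left, real_inner_smul_right, h2 i j hj.symm]
      simp
    · exact fun h => absurd hi h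
  have h := key Finset.univ
  have h0 := sq_nonneg ‖x - ∑ i, inner ℝ (u i) x • u i‖
  rw [norm_sub_sq_real, inner_sum] at h0
  simp only [real_inner_smul_right, real_inner_comm x] at h0
  have h3 : ∑ i, inner ℝ (u i) x * inner ℝ (u i) x = ∑ i, inner ℝ (u i) x ^ 2 :=
    Finset.sum_congr rfl fun i _ => (sq _).symm
  simp only [real_inner_comm] at h0 h3 h ⊢
  linarith

/-- A pair of such families has a single matrix entry as its only nonzero coefficient; this shows
that the Schatten norms dominate the entries. -/
lemma isBesselFamily_single [DecidableEq ι] (i₀ : ι) {e : E} (he : ‖e‖ ≤ 1) :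
    IsBesselFamily (fun i => if i = i₀ then e else 0) := by
  refine isBesselFamily_of_orthogonal (fun i => ?_) fun i j hij => ?_
  · split_ifs <;> simp [he]
  · split_ifs <;> simp_all

end Bessel

/-- A linear map between Euclidean spaces has a singular value decomposition. -/
lemma exists_singular_decomposition {E F : Type*} [NormedAddCommGroup E] [InnerProductSpace ℝ E]
    [FiniteDimensional ℝ E] [NormedAddCommGroup F] [InnerProductSpace ℝ F]
    [FiniteDimensional ℝ F] {d : ℕ} (hd : Module.finrank ℝ E = d) (T : E →ₗ[ℝ] F) :
    ∃ (u : Fin d → F) (v : OrthonormalBasis (Fin d) ℝ E), IsBesselFamily u ∧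
      (∀ i, T (v i) = T.singularValues i • u i) ∧
      ∀ i, inner ℝ (u i) (T (v i)) = T.singularValues i := by
  set v := T.isSymmetric_adjoint_comp_self.eigenvectorBasis hd with hv
  have hin : ∀ i j, inner ℝ (T (v i)) (T (v j)) =
      if i = j then T.singularValues i ^ 2 else 0 := by
    intro i j
    rw [← LinearMap.adjoint_inner_left, ← LinearMap.comp_apply, hv,
      T.isSymmetric_adjoint_comp_self.apply_eigenvectorBasis hd i, real_inner_smul_left,
      orthonormal_iff_ite.mp (OrthonormalBasis.orthonormal _) i j, T.sq_singularValues_fin hd i]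
    simp
  have hz : ∀ i : Fin d, T.singularValues i = 0 → T (v i) = 0 := by
    intro i hi
    have := hin i i
    rw [if_pos rfl, hi] at this
    simpa using this
  -- The convention 0⁻¹ = 0 makes the left vector vanish where the singular value does, which keeps
  -- the family orthogonal with norms at most 1.
  refine ⟨fun i => (T.singularValues i)⁻¹ • T (v i), v, ?_, ?_, ?_⟩
  · refine isBesselFamily_of_orthogonal (fun i => ?_) fun i j hij => ?_
    · by_cases hi : T.singularValues i = 0
      · simp [hi]
      · have h1 : ‖(T.singularValues i)⁻¹ • T (v i)‖ ^ 2 = 1 := by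
          rw [← real_inner_self_eq_norm_sq, real_inner_smul_left, real_inner_smul_right, hin,
            if_pos rfl]
          field_simp
        nlinarith [norm_nonneg ((T.singularValues i)⁻¹ • T (v i))]
    · rw [real_inner_smul_left, real_inner_smul_right, hin, if_neg hij]
      simp
  · intro i
    by_cases hi : T.singularValues i = 0
    · simp [hi, hz i hi]
    · rw [smul_smul, mul_inv_cancel₀ hi, one_smul]
  · intro i
    rw [real_inner_smul_left, hin, if_pos rfl]
    by_cases hi : T.singularValues i = 0
    · simp [hi]
    · field_simp

section Substochastic

variable {ι : Type*} [Fintype ι]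

/-- Jensen's inequality after placing the missing mass on one extra point, `none`, where the value
is 0. -/
lemma rpow_sum_le_of_substochastic {q : ℝ} (hq : 1 ≤ q) (w s : ι → ℝ) (hw : ∀ j, 0 ≤ w j)
    (hs : ∀ j, 0 ≤ s j) (hw1 : ∑ j, w j ≤ 1) :
    (∑ j, w j * s j) ^ q ≤ ∑ j, w j * s j ^ q := by
  have h := Real.rpow_arith_mean_le_arith_mean_rpow (Finset.univ : Finset (Option ι))
    (fun o => o.elim (1 - ∑ j, w j) w) (fun o => o.elim 0 s)
    (by rintro (_ | j) _ <;> simp [hw, hw1]) (by simp [Fintype.sum_option])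
    (by rintro (_ | j) _ <;> simp [hs]) hq
  simpa [Fintype.sum_option, Real.zero_rpow (by linarith : q ≠ 0)] using h

/-- Doubly substochastic averaging does not increase `ℓ^p` norms. -/
lemma norm_toLp_le_of_substochastic {p : ℝ≥0∞} (hp : 1 ≤ p) (D : ι → ι → ℝ) (f s : ι → ℝ)
    (hD : ∀ i j, 0 ≤ D i j) (hs : ∀ j, 0 ≤ s j) (hrow : ∀ i, ∑ j, D i j ≤ 1)
    (hcol : ∀ j, ∑ i, D i j ≤ 1) (hf : ∀ i, |f i| ≤ ∑ j, D i j * s j) :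
    ‖WithLp.toLp p f‖ ≤ ‖WithLp.toLp p s‖ := by
  have : Fact (1 ≤ p) := ⟨hp⟩
  rcases eq_or_ne p ⊤ with rfl | hptop
  · rw [PiLp.norm_eq_ciSup]
    refine Real.iSup_le (fun i => ?_) (norm_nonneg _)
    calc ‖f i‖ ≤ ∑ j, D i j * s j := hf i
      _ ≤ ∑ j, D i j * ‖WithLp.toLp ⊤ s‖ := by
          refine Finset.sum_le_sum fun j _ => mul_le_mul_of_nonneg_left ?_ (hD i j)
          exact (le_abs_self _).trans (PiLp.norm_apply_le (WithLp.toLp ⊤ s) j)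
      _ = (∑ j, D i j) * ‖WithLp.toLp ⊤ s‖ := by rw [Finset.sum_mul]
      _ ≤ 1 * ‖WithLp.toLp ⊤ s‖ := by gcongr; exact hrow i
      _ = _ := one_mul _
  · have hq : 1 ≤ p.toReal := by
      have := ENNReal.toReal_mono hptop hp
      simpa using this
    have hq0 : 0 < p.toReal := by linarith
    rw [PiLp.norm_eq_sum hq0, PiLp.norm_eq_sum hq0]
    refine Real.rpow_le_rpow (Finset.sum_nonneg fun i _ => by positivity) ?_ (by positivity)
    calc ∑ i, ‖f i‖ ^ p.toReal ≤ ∑ i, ∑ j, D i j * s j ^ p.toReal := by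
          refine Finset.sum_le_sum fun i _ => ?_
          exact (Real.rpow_le_rpow (norm_nonneg _) (hf i) hq0.le).trans
            (rpow_sum_le_of_substochastic hq (D i) s (hD i) hs (hrow i))
      _ = ∑ j, (∑ i, D i j) * s j ^ p.toReal := by
          rw [Finset.sum_comm]; simp_rw [Finset.sum_mul]
      _ ≤ ∑ j, ‖s j‖ ^ p.toReal := by
          refine Finset.sum_le_sum fun j _ => ?_
          rw [Real.norm_of_nonneg (hs j)]
          exact mul_le_of_le_one_left (Real.rpow_nonneg (hs j) _) (hcol j)

end Substochastic

/-- The Schatten norm dominates the `ℓ^p` norm of the coefficients of `T` in Bessel families. -/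
lemma norm_inner_bessel_le {E F : Type*} [NormedAddCommGroup E] [InnerProductSpace ℝ E]
    [FiniteDimensional ℝ E] [NormedAddCommGroup F] [InnerProductSpace ℝ F]
    [FiniteDimensional ℝ F] {d : ℕ} (hd : Module.finrank ℝ E = d) (T : E →ₗ[ℝ] F) {p : ℝ≥0∞}
    (hp : 1 ≤ p) {a : Fin d → F} {b : Fin d → E} (ha : IsBesselFamily a)
    (hb : IsBesselFamily b) :
    ‖WithLp.toLp p (fun i => (inner ℝ (a i) (T (b i)) : ℝ))‖ ≤
      ‖WithLp.toLp p (fun i : Fin d => T.singularValues i)‖ := by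
  obtain ⟨u, v, hu, hTv, -⟩ := exists_singular_decomposition hd T
  have hsq : ∀ z : ℝ, z ≤ 1 → 0 ≤ z → z ^ 2 ≤ 1 := fun z h1 h0 => pow_le_one₀ h0 h1
  have hv : ∀ x : E, ∑ j, inner ℝ (v j) x ^ 2 ≤ ‖x‖ ^ 2 := fun x =>
    (v.sum_sq_inner_right x).le
  -- Expanding b i in the right singular basis gives products of two coefficients; |x y| ≤ (x² +
  -- y²)/2 turns them into the weights below. Bessel's inequality for all four families bounds the
  -- row and column sums by 1.
  refine norm_toLp_le_of_substochastic hp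
    (fun i j => (inner ℝ (v j) (b i) ^ 2 + inner ℝ (u j) (a i) ^ 2) / 2) _ _
    (fun i j => by positivity) (fun j => T.singularValues_nonneg j) (fun i => ?_) (fun j => ?_)
    fun i => ?_
  · rw [← Finset.sum_div, Finset.sum_add_distrib]
    have h1 := (hv (b i)).trans (hsq _ (hb.norm_le_one i) (norm_nonneg _))
    have h2 := (hu (a i)).trans (hsq _ (ha.norm_le_one i) (norm_nonneg _))
    linarith
  · rw [← Finset.sum_div, Finset.sum_add_distrib]
    have h1 := (hb (v j)).trans (hsq _ (v.norm_eq_one j).le (norm_nonneg _))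
    have h2 := (ha (u j)).trans (hsq _ (hu.norm_le_one j) (norm_nonneg _))
    simp only [real_inner_comm] at h1 h2 ⊢
    linarith
  · have hexp : (inner ℝ (a i) (T (b i)) : ℝ) =
        ∑ j, inner ℝ (v j) (b i) * (T.singularValues j * inner ℝ (u j) (a i)) := by
      conv_lhs => rw [← v.sum_repr' (b i)]
      rw [map_sum, inner_sum]
      refine Finset.sum_congr rfl fun j _ => ?_
      rw [map_smul, hTv, real_inner_smul_right, real_inner_smul_right, real_inner_comm (u j)]
    rw [hexp]
    refine (Finset.abs_sum_le_sum_abs _ _).trans (Finset.sum_le_sum fun j _ => ?_)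
    have h0 := T.singularValues_nonneg j
    rw [abs_mul, abs_mul, abs_of_nonneg h0]
    have h1 := two_mul_le_add_sq |inner ℝ (v j) (b i)| |inner ℝ (u j) (a i)|
    rw [sq_abs, sq_abs] at h1
    nlinarith

lemma inner_toEuclideanLin_single {k d : ℕ} (A : Matrix (Fin k) (Fin d) ℝ) (i : Fin k)
    (j : Fin d) : inner ℝ (EuclideanSpace.single i (1 : ℝ))
      (Matrix.toEuclideanLin A (EuclideanSpace.single j 1)) = A i j := by
  rw [EuclideanSpace.inner_single_left]
  simp [Matrix.toLpLin_apply]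

/-- For the Schatten triangle inequality, the singular values of A + B are its coefficients in its
own singular families. The coefficients of A and of B in these families are dominated by their own
singular values, and the ℓ^p triangle inequality does the rest. -/
theorem matNorm_isEntryDominatingNorm {k d : ℕ} (κ : NormKind) {p : ℝ≥0∞} (hp : 1 ≤ p) :
    IsEntryDominatingNorm (matNorm κ p : Matrix (Fin k) (Fin d) ℝ → ℝ) := by
  have : Fact (1 ≤ p) := ⟨hp⟩
  cases κ with
  | entrywise =>
    refine ⟨fun A B => ?_, fun s A => ?_, fun A i j => ?_⟩
    · exact norm_add_le (WithLp.toLp p fun q : Fin k × Fin d => A q.1 q.2)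
        (WithLp.toLp p fun q : Fin k × Fin d => B q.1 q.2)
    · exact (norm_smul s (WithLp.toLp p fun q : Fin k × Fin d => A q.1 q.2)).le
    · exact PiLp.norm_apply_le (WithLp.toLp p fun q : Fin k × Fin d => A q.1 q.2) (i, j)
  | schatten =>
    have hd : Module.finrank ℝ (EuclideanSpace ℝ (Fin d)) = d := finrank_euclideanSpace_fin
    refine ⟨fun A B => ?_, fun s A => ?_, fun A i j => ?_⟩
    · obtain ⟨u, v, hu, -, hσ⟩ := exists_singular_decomposition hd (Matrix.toEuclideanLin (A + B))
      have hv : IsBesselFamily v := fun x => (v.sum_sq_inner_right x).le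
      have h := norm_add_le
        (WithLp.toLp p fun i => (inner ℝ (u i) (Matrix.toEuclideanLin A (v i)) : ℝ))
        (WithLp.toLp p fun i => (inner ℝ (u i) (Matrix.toEuclideanLin B (v i)) : ℝ))
      have h1 := norm_inner_bessel_le hd (Matrix.toEuclideanLin A) hp hu hv
      have h2 := norm_inner_bessel_le hd (Matrix.toEuclideanLin B) hp hu hv
      have h3 : singVals (A + B) = (fun i => (inner ℝ (u i) (Matrix.toEuclideanLin A (v i)) : ℝ))
          + fun i => (inner ℝ (u i) (Matrix.toEuclideanLin B (v i)) : ℝ) := by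
        funext i
        rw [singVals, ← hσ i, map_add, LinearMap.add_apply, inner_add_right, Pi.add_apply]
      calc ‖WithLp.toLp p (singVals (A + B))‖ ≤ _ := by rw [h3]; exact h
        _ ≤ _ := add_le_add h1 h2
    · obtain ⟨u, v, hu, -, hσ⟩ := exists_singular_decomposition hd (Matrix.toEuclideanLin (s • A))
      have hv : IsBesselFamily v := fun x => (v.sum_sq_inner_right x).le
      have h := norm_smul s
        (WithLp.toLp p fun i => (inner ℝ (u i) (Matrix.toEuclideanLin A (v i)) : ℝ))
      have h1 := norm_inner_bessel_le hd (Matrix.toEuclideanLin A) hp hu hv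
      have h3 : singVals (s • A) =
          s • (fun i => (inner ℝ (u i) (Matrix.toEuclideanLin A (v i)) : ℝ)) := by
        funext i
        rw [singVals, ← hσ i, map_smul, LinearMap.smul_apply, real_inner_smul_right,
          Pi.smul_apply, smul_eq_mul]
      calc ‖WithLp.toLp p (singVals (s • A))‖ ≤ _ := by rw [h3]; exact h.le
        _ ≤ ‖s‖ * ‖WithLp.toLp p (singVals A)‖ := mul_le_mul_of_nonneg_left h1 (norm_nonneg _)
        _ = _ := rfl
    · have h1 := norm_inner_bessel_le hd (Matrix.toEuclideanLin A) hp
        (isBesselFamily_single j (e := EuclideanSpace.single i (1 : ℝ)) (by simp))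
        (isBesselFamily_single j (e := EuclideanSpace.single j (1 : ℝ)) (by simp))
      refine le_trans ?_ h1
      have h2 := PiLp.norm_apply_le (p := p) (WithLp.toLp p fun l : Fin d =>
        (inner ℝ ((fun i' => if i' = j then EuclideanSpace.single i (1 : ℝ) else 0) l)
          (Matrix.toEuclideanLin A
            ((fun i' => if i' = j then EuclideanSpace.single j (1 : ℝ) else 0) l)) : ℝ)) j
      simpa [inner_toEuclideanLin_single] using h2

/-! ### Softmax and its perturbations -/

section SoftmaxVec

variable {k : ℕ}

lemma sum_exp_pos (v : Fin k → ℝ) (y : Fin k) : 0 < ∑ j, Real.exp (v j) :=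
  Finset.sum_pos (fun _ _ => Real.exp_pos _) ⟨y, Finset.mem_univ y⟩

lemma softmax_pos (v : Fin k → ℝ) (c : Fin k) : 0 < softmax v c :=
  div_pos (Real.exp_pos _) (sum_exp_pos v c)

lemma sum_softmax (v : Fin k → ℝ) (y : Fin k) : ∑ c, softmax v c = 1 := by
  simp only [softmax]
  rw [← Finset.sum_div, div_self (sum_exp_pos v y).ne']

lemma one_sub_softmax (v : Fin k → ℝ) (y : Fin k) :
    1 - softmax v y = ∑ c ∈ Finset.univ.erase y, softmax v c := by
  rw [← sum_softmax v y, ← Finset.add_sum_erase _ _ (Finset.mem_univ y)]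
  ring

/-- The true class contributes nothing and the other classes have total mass 1 - softmax v y. This
is how the factor `missProb` enters all error terms. -/
lemma sum_softmax_mul_le (v : Fin k → ℝ) (y : Fin k) {f : Fin k → ℝ} {K : ℝ} (hy : f y = 0)
    (hf : ∀ c, c ≠ y → f c ≤ K) : ∑ c, softmax v c * f c ≤ K * (1 - softmax v y) := by
  rw [one_sub_softmax, ← Finset.add_sum_erase _ _ (Finset.mem_univ y), hy, mul_zero, zero_add,
    Finset.mul_sum]
  refine Finset.sum_le_sum fun c hc => ?_
  rw [mul_comm]
  exact mul_le_mul_of_nonneg_right (hf c (Finset.ne_of_mem_erase hc)) (softmax_pos v c).le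

lemma softmax_le_one (v : Fin k → ℝ) (y : Fin k) : softmax v y ≤ 1 := by
  have h := one_sub_softmax v y
  have : 0 ≤ ∑ c ∈ Finset.univ.erase y, softmax v c :=
    Finset.sum_nonneg fun c _ => (softmax_pos v c).le
  linarith

lemma softmax_lt_one (v : Fin k → ℝ) (hk : 2 ≤ k) (y : Fin k) : softmax v y < 1 := by
  have h := one_sub_softmax v y
  have : 0 < ∑ c ∈ Finset.univ.erase y, softmax v c := by
    refine Finset.sum_pos (fun c _ => softmax_pos v c) ?_
    rw [← Finset.card_pos, Finset.card_erase_of_mem (Finset.mem_univ y)]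
    simp; omega
  linarith

/-- A shift of the logits reweights the probabilities, and the normalizer is a softmax average of
exp(u j - u c); thus only differences of u matter. -/
lemma softmax_add (v u : Fin k → ℝ) (c : Fin k) :
    softmax (v + u) c = softmax v c / ∑ j, softmax v j * Real.exp (u j - u c) := by
  have h0 := (sum_exp_pos v c).ne'
  have h1 : ∑ j, softmax v j * Real.exp (u j - u c) =
      (∑ j, Real.exp ((v + u) j)) / ((∑ j, Real.exp (v j)) * Real.exp (u c)) := by
    rw [Finset.sum_div]
    refine Finset.sum_congr rfl fun j _ => ?_
    rw [softmax, Pi.add_apply, Real.exp_sub, Real.exp_add]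
    field_simp
  have h2 := (sum_exp_pos (v + u) c).ne'
  rw [h1, softmax, softmax, Pi.add_apply, Real.exp_add]
  field_simp

lemma sum_softmax_mul_exp_mem {v w : Fin k → ℝ} (y : Fin k) {ε : ℝ} (hw : ∀ c, |w c| ≤ ε) :
    Real.exp (-ε) ≤ ∑ j, softmax v j * Real.exp (w j) ∧
      ∑ j, softmax v j * Real.exp (w j) ≤ Real.exp ε := by
  constructor
  · calc Real.exp (-ε) = ∑ j, softmax v j * Real.exp (-ε) := by
          rw [← Finset.sum_mul, sum_softmax v y, one_mul]
      _ ≤ _ := Finset.sum_le_sum fun j _ => mul_le_mul_of_nonneg_left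
          (Real.exp_le_exp.mpr (neg_le_of_abs_le (hw j))) (softmax_pos v j).le
  · calc _ ≤ ∑ j, softmax v j * Real.exp ε :=
          Finset.sum_le_sum fun j _ => mul_le_mul_of_nonneg_left
            (Real.exp_le_exp.mpr (le_of_abs_le (hw j))) (softmax_pos v j).le
      _ = _ := by rw [← Finset.sum_mul, sum_softmax v y, one_mul]

lemma abs_softmax_add_sub_le (v u : Fin k → ℝ) (c : Fin k) {ε : ℝ}
    (hu : ∀ j c, |u j - u c| ≤ ε) :
    |softmax (v + u) c - softmax v c| ≤ (Real.exp ε - 1) * softmax v c := by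
  obtain ⟨h1, h2⟩ := sum_softmax_mul_exp_mem (v := v) (w := fun j => u j - u c) c
    (fun j => hu j c)
  rw [softmax_add]
  set Z := ∑ j, softmax v j * Real.exp (u j - u c)
  have hZ : 0 < Z := (Real.exp_pos _).trans_le h1
  have hS := softmax_pos v c
  have h3 : 1 / Z ≤ Real.exp ε := by
    rw [div_le_iff₀ hZ]
    calc (1 : ℝ) = Real.exp ε * Real.exp (-ε) := by rw [← Real.exp_add]; simp
      _ ≤ _ := by gcongr
  have h4 : Real.exp (-ε) ≤ 1 / Z := by
    rw [Real.exp_neg, ← one_div]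
    exact one_div_le_one_div_of_le hZ h2
  -- The normalizer lies between exp(-ε) and exp ε. This gives 1 - exp(-ε) ≤ exp ε - 1, so both
  -- signs obey the same bound.
  have h5 : 2 ≤ Real.exp ε + Real.exp (-ε) := by
    have := Real.cosh_eq ε
    have := Real.one_le_cosh ε
    linarith
  have h6 : softmax v c / Z - softmax v c = (1 / Z - 1) * softmax v c := by ring
  rw [h6, abs_mul, abs_of_pos hS]
  refine mul_le_mul_of_nonneg_right ?_ hS.le
  rw [abs_le]
  constructor <;> linarith

lemma neg_log_softmax_add (v u : Fin k → ℝ) (y : Fin k) :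
    -Real.log (softmax (v + u) y) = -Real.log (softmax v y) +
      Real.log (∑ j, softmax v j * Real.exp (u j - u y)) := by
  have h : 0 < ∑ j, softmax v j * Real.exp (u j - u y) :=
    Finset.sum_pos (fun j _ => mul_pos (softmax_pos v j) (Real.exp_pos _)) ⟨y, Finset.mem_univ y⟩
  rw [softmax_add, Real.log_div (softmax_pos v y).ne' h.ne']
  ring

lemma exp_sub_one_le_mul_exp (w : ℝ) : Real.exp w - 1 ≤ w * Real.exp w := by
  have h := Real.add_one_le_exp (-w)
  have h1 : Real.exp (-w) * Real.exp w = 1 := by rw [← Real.exp_add]; simp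
  nlinarith [Real.exp_pos w]

lemma exp_sub_one_sub_le {w ε : ℝ} (hw : |w| ≤ ε) :
    Real.exp w - 1 - w ≤ ε ^ 2 * Real.exp ε := by
  have hε : 0 ≤ ε := (abs_nonneg w).trans hw
  have h1 := exp_sub_one_le_mul_exp w
  have hexp : 1 ≤ Real.exp ε := Real.one_le_exp hε
  obtain ⟨ha, hb⟩ := abs_le.mp hw
  rcases le_total 0 w with h | h
  · have h2 : Real.exp w ≤ Real.exp ε := Real.exp_le_exp.mpr hb
    calc Real.exp w - 1 - w ≤ w * (Real.exp w - 1) := by linarith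
      _ ≤ w * (w * Real.exp w) := by gcongr
      _ ≤ ε * (ε * Real.exp ε) := by gcongr
      _ = _ := by ring
  · have h2 := Real.add_one_le_exp w
    have h3 : (-w) * (1 - Real.exp w) ≤ (-w) * (-w) :=
      mul_le_mul_of_nonneg_left (by linarith) (by linarith)
    have h4 : (-w) * (-w) ≤ ε * ε := by
      apply mul_le_mul <;> linarith
    nlinarith [mul_nonneg hε hε]

/-- One-step upper bound for the cross-entropy loss, with the linear term of the Taylor expansion. -/
lemma neg_log_softmax_add_le (v u : Fin k → ℝ) (y : Fin k) {ε : ℝ}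
    (hu : ∀ j c, |u j - u c| ≤ ε) :
    -Real.log (softmax (v + u) y) ≤ -Real.log (softmax v y) +
      ∑ c, softmax v c * (u c - u y) + ε ^ 2 * Real.exp ε * (1 - softmax v y) := by
  rw [neg_log_softmax_add]
  have h : 0 < ∑ j, softmax v j * Real.exp (u j - u y) :=
    Finset.sum_pos (fun j _ => mul_pos (softmax_pos v j) (Real.exp_pos _)) ⟨y, Finset.mem_univ y⟩
  -- After log z ≤ z - 1 the remainder is a softmax average of exp w - 1 - w, which vanishes at the
  -- true class.
  have h1 := Real.log_le_sub_one_of_pos h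
  have h2 := sum_softmax_mul_le v y (f := fun j => Real.exp (u j - u y) - 1 - (u j - u y))
    (K := ε ^ 2 * Real.exp ε) (by simp) (fun c _ => exp_sub_one_sub_le (hu c y))
  simp only [mul_sub, Finset.sum_sub_distrib, mul_one, sum_softmax v y] at h1 h2 ⊢
  linarith

/-- A crude Lipschitz bound, needed to control the loss during the burn-in, when no descent is
available. -/
lemma neg_log_softmax_add_le_add (v u : Fin k → ℝ) (y : Fin k) {ε : ℝ}
    (hu : ∀ j c, |u j - u c| ≤ ε) :
    -Real.log (softmax (v + u) y) ≤ -Real.log (softmax v y) + ε := by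
  rw [neg_log_softmax_add]
  obtain ⟨h1, h2⟩ := sum_softmax_mul_exp_mem (v := v) (w := fun j => u j - u y) y
    (fun j => hu j y)
  have := Real.log_le_log ((Real.exp_pos _).trans_le h1) h2
  rw [Real.log_exp] at this
  linarith

lemma exp_neg_log_softmax (v : Fin k → ℝ) (y : Fin k) :
    Real.exp (-Real.log (softmax v y)) = ∑ j, Real.exp (v j - v y) := by
  rw [Real.exp_neg, Real.exp_log (softmax_pos v y), softmax, inv_div, Finset.sum_div]
  simp [Real.exp_sub]

/-- The exponential of the loss is the sum of exp(v j - v y); only the terms j = y and j = c are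
kept. -/
lemma one_add_exp_le (v : Fin k → ℝ) {y c : Fin k} (hc : c ≠ y) :
    1 + Real.exp (v c - v y) ≤ Real.exp (-Real.log (softmax v y)) := by
  rw [exp_neg_log_softmax, ← Finset.add_sum_erase _ _ (Finset.mem_univ y), sub_self, Real.exp_zero]
  gcongr
  exact Finset.single_le_sum (f := fun j => Real.exp (v j - v y)) (fun _ _ => (Real.exp_pos _).le)
    (Finset.mem_erase.mpr ⟨hc, Finset.mem_univ c⟩)

end SoftmaxVec

/-! ### Sample losses, misclassification probabilities and margins -/

section Sample

variable {n k d : ℕ}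

/-- The probability that the softmax prediction for the `i`-th sample is wrong. -/
noncomputable def missProb (X : Fin n → Fin d → ℝ) (y : Fin n → Fin k) (i : Fin n)
    (W : Matrix (Fin k) (Fin d) ℝ) : ℝ :=
  1 - softmax (W *ᵥ X i) (y i)

/-- The directional derivative of the `i`-th sample loss at `W` in the direction `D`. -/
noncomputable def sampleDirDeriv (X : Fin n → Fin d → ℝ) (y : Fin n → Fin k) (i : Fin n)
    (W D : Matrix (Fin k) (Fin d) ℝ) : ℝ :=
  ∑ c, softmax (W *ᵥ X i) c * ((D *ᵥ X i) c - (D *ᵥ X i) (y i))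

/-- The average of the misclassification probabilities. -/
noncomputable def avgMissProb (X : Fin n → Fin d → ℝ) (y : Fin n → Fin k)
    (W : Matrix (Fin k) (Fin d) ℝ) : ℝ :=
  (1 / (n : ℝ)) * ∑ i, missProb X y i W

variable {X : Fin n → Fin d → ℝ} {y : Fin n → Fin k}

lemma missProb_nonneg (i : Fin n) (W : Matrix (Fin k) (Fin d) ℝ) : 0 ≤ missProb X y i W :=
  sub_nonneg.mpr (softmax_le_one _ _)

lemma sampleDirDeriv_neg (i : Fin n) (W D : Matrix (Fin k) (Fin d) ℝ) :
    sampleDirDeriv X y i W (-D) = -sampleDirDeriv X y i W D := by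
  simp only [sampleDirDeriv, Matrix.neg_mulVec, Pi.neg_apply, ← Finset.sum_neg_distrib]
  exact Finset.sum_congr rfl fun c _ => by ring

lemma sampleDirDeriv_smul (i : Fin n) (W D : Matrix (Fin k) (Fin d) ℝ) (s : ℝ) :
    sampleDirDeriv X y i W (s • D) = s * sampleDirDeriv X y i W D := by
  simp only [sampleDirDeriv, Matrix.smul_mulVec, Pi.smul_apply, smul_eq_mul, Finset.mul_sum]
  exact Finset.sum_congr rfl fun c _ => by ring

lemma hasDerivAt_sampleLoss_single (i : Fin n) (W : Matrix (Fin k) (Fin d) ℝ) (c : Fin k)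
    (j : Fin d) :
    HasDerivAt (fun s : ℝ => sampleLoss X y i (W + s • Matrix.single c j (1 : ℝ)))
      (softmax (W *ᵥ X i) c * X i j - if c = y i then X i j else 0) 0 := by
  set v := W *ᵥ X i with hv
  have hz := sum_exp_pos v (y i)
  have hvec : ∀ s : ℝ, (W + s • Matrix.single c j (1 : ℝ)) *ᵥ X i =
      fun l => v l + s * (if c = l then X i j else 0) := by
    intro s
    funext l
    rw [Matrix.add_mulVec, Matrix.smul_mulVec, Pi.add_apply, Pi.smul_apply, smul_eq_mul]
    congr 2
    by_cases h : c = l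
    · subst h; simp [Matrix.mulVec, dotProduct, Matrix.single_apply]
    · simp [h, Matrix.mulVec, dotProduct]
  have hfun : (fun s : ℝ => sampleLoss X y i (W + s • Matrix.single c j (1 : ℝ))) = fun s : ℝ =>
      Real.log (∑ l, Real.exp (v l + s * (if c = l then X i j else 0))) -
        (v (y i) + s * (if c = y i then X i j else 0)) := by
    funext s
    rw [sampleLoss, hvec, softmax, Real.log_div (Real.exp_pos _).ne'
      (sum_exp_pos (fun l => v l + s * (if c = l then X i j else 0)) (y i)).ne', Real.log_exp]
    ring
  rw [hfun]
  have hlin : ∀ l : Fin k, HasDerivAt (fun s : ℝ => v l + s * (if c = l then X i j else 0))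
      (if c = l then X i j else 0) 0 := by
    intro l
    simpa using ((hasDerivAt_id (0 : ℝ)).mul_const (if c = l then X i j else 0)).const_add (v l)
  have hsum : HasDerivAt (fun s : ℝ => ∑ l, Real.exp (v l + s * (if c = l then X i j else 0)))
      (∑ l, Real.exp (v l + 0 * (if c = l then X i j else 0)) * (if c = l then X i j else 0)) 0 :=
    HasDerivAt.fun_sum fun l _ => (hlin l).exp
  have hpos : ∑ l, Real.exp (v l + 0 * (if c = l then X i j else 0)) ≠ 0 := by
    simpa using hz.ne'
  refine ((hsum.log hpos).sub (hlin (y i))).congr_deriv ?_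
  simp only [softmax, zero_mul, add_zero, mul_ite, mul_zero, Finset.sum_ite_eq, Finset.mem_univ,
    if_true, ite_self, add_zero]
  ring

lemma sampleGrad_apply (i : Fin n) (W : Matrix (Fin k) (Fin d) ℝ) (c : Fin k) (j : Fin d) :
    sampleGrad X y i W c j =
      softmax (W *ᵥ X i) c * X i j - if c = y i then X i j else 0 :=
  (hasDerivAt_sampleLoss_single i W c j).deriv

lemma matInner_eq_sum (A B : Matrix (Fin k) (Fin d) ℝ) :
    matInner A B = ∑ c, ∑ j, A c j * B c j := by
  rw [matInner, Matrix.trace, Finset.sum_comm]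
  rfl

lemma matInner_add (A B D : Matrix (Fin k) (Fin d) ℝ) :
    matInner (A + B) D = matInner A D + matInner B D := by
  simp [matInner, Matrix.transpose_add, Matrix.add_mul]

lemma matInner_smul (s : ℝ) (A D : Matrix (Fin k) (Fin d) ℝ) :
    matInner (s • A) D = s * matInner A D := by
  simp [matInner]

/-- Replaces the gradient, which is defined by entrywise derivatives, with an explicit directional
derivative on which the softmax estimates act. -/
lemma matInner_sampleGrad (i : Fin n) (W D : Matrix (Fin k) (Fin d) ℝ) :
    matInner (sampleGrad X y i W) D = sampleDirDeriv X y i W D := by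
  rw [matInner_eq_sum]
  have h : ∀ c, ∑ j, sampleGrad X y i W c j * D c j =
      softmax (W *ᵥ X i) c * (D *ᵥ X i) c - if c = y i then (D *ᵥ X i) (y i) else 0 := by
    intro c
    by_cases hc : c = y i
    · subst hc
      simp only [sampleGrad_apply, if_true, Matrix.mulVec, dotProduct, Finset.mul_sum,
        ← Finset.sum_sub_distrib]
      exact Finset.sum_congr rfl fun j _ => by ring
    · simp only [sampleGrad_apply, if_neg hc, Matrix.mulVec, dotProduct, Finset.mul_sum, sub_zero]
      exact Finset.sum_congr rfl fun j _ => by ring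
  simp only [h, sampleDirDeriv, Finset.sum_sub_distrib, mul_sub, ← Finset.sum_mul,
    sum_softmax (W *ᵥ X i) (y i), Finset.sum_ite_eq', Finset.mem_univ, if_true, one_mul]

lemma matInner_batchGrad (S : Finset (Fin n)) (W D : Matrix (Fin k) (Fin d) ℝ) :
    matInner (batchGrad X y S W) D =
      (1 / (S.card : ℝ)) * ∑ i ∈ S, sampleDirDeriv X y i W D := by
  rw [batchGrad, matInner_smul]
  congr 1
  simp only [← matInner_sampleGrad]
  induction S using Finset.induction_on with
  | empty => simp [matInner]
  | insert a s ha ih => rw [Finset.sum_insert ha, Finset.sum_insert ha, matInner_add, ih]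

lemma margin_le (W : Matrix (Fin k) (Fin d) ℝ) (i : Fin n) {c : Fin k} (hc : c ≠ y i) :
    margin X y W ≤ (W *ᵥ X i) (y i) - (W *ᵥ X i) c :=
  ciInf_le (f := fun q : {q : Fin n × Fin k // q.2 ≠ y q.1} =>
    ((W *ᵥ X q.1.1) (y q.1.1) - (W *ᵥ X q.1.1) q.1.2)) (Set.finite_range _).bddBelow ⟨(i, c), hc⟩

lemma exists_ne_label (hk : 2 ≤ k) (c₀ : Fin k) : ∃ c, c ≠ c₀ := by
  have : Nontrivial (Fin k) := Fin.nontrivial_iff_two_le.mpr hk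
  exact exists_ne c₀

lemma le_margin (hk : 2 ≤ k) (i₀ : Fin n) {W : Matrix (Fin k) (Fin d) ℝ} {z : ℝ}
    (h : ∀ i, ∀ c, c ≠ y i → z ≤ (W *ᵥ X i) (y i) - (W *ᵥ X i) c) : z ≤ margin X y W := by
  obtain ⟨c, hc⟩ := exists_ne_label hk (y i₀)
  have : Nonempty {q : Fin n × Fin k // q.2 ≠ y q.1} := ⟨⟨(i₀, c), hc⟩⟩
  exact le_ciInf fun q => h q.1.1 q.1.2 q.2

/-- In the direction U every wrong logit falls behind the true one at rate at least mar(U), and the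
wrong classes have total weight `missProb`. -/
lemma margin_mul_missProb_le (i : Fin n) (W U : Matrix (Fin k) (Fin d) ℝ) :
    margin X y U * missProb X y i W ≤ -sampleDirDeriv X y i W U := by
  have h := sum_softmax_mul_le (W *ᵥ X i) (y i)
    (f := fun c => (U *ᵥ X i) c - (U *ᵥ X i) (y i)) (K := -margin X y U) (by simp)
    (fun c hc => by linarith [margin_le (X := X) U i hc])
  rw [sampleDirDeriv, missProb]
  linarith

section WithNorm

variable {N : Matrix (Fin k) (Fin d) ℝ → ℝ} {R : ℝ}

/-- Entry domination is paired with the ℓ¹ bound on x, row by row. This makes the constants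
independent of the dimension and of the number of classes. -/
lemma abs_mulVec_sub_le (hN : IsEntryDominatingNorm N) {x : Fin d → ℝ}
    (hx : ∑ j, |x j| ≤ R) (D : Matrix (Fin k) (Fin d) ℝ) {δ : ℝ} (hδ : 0 ≤ δ)
    (hD : N D ≤ δ)
    (c c' : Fin k) : |(D *ᵥ x) c - (D *ᵥ x) c'| ≤ 2 * R * δ := by
  have h : ∀ c, |(D *ᵥ x) c| ≤ R * δ := by
    intro c
    rw [Matrix.mulVec, dotProduct]
    calc |∑ j, D c j * x j| ≤ ∑ j, |D c j| * |x j| := by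
          refine (Finset.abs_sum_le_sum_abs _ _).trans (le_of_eq ?_)
          simp [abs_mul]
      _ ≤ ∑ j, δ * |x j| := by
          gcongr with j
          exact (hN.entry_le D c j).trans hD
      _ = δ * ∑ j, |x j| := by rw [Finset.mul_sum]
      _ ≤ R * δ := by rw [mul_comm]; gcongr
  have h1 := h c
  have h2 := h c'
  have := abs_sub ((D *ᵥ x) c) ((D *ᵥ x) c')
  linarith

lemma abs_sum_mul_sub_le {p : Fin k → ℝ} {z : Fin k → ℝ} (v : Fin k → ℝ) (y : Fin k) {K L : ℝ}
    (hp : ∀ c, |p c| ≤ K * softmax v c) (hz : ∀ c, |z c - z y| ≤ L) :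
    |∑ c, p c * (z c - z y)| ≤ K * L * (1 - softmax v y) := by
  have hL : 0 ≤ L := (abs_nonneg _).trans (hz y)
  have hK : 0 ≤ K := by
    have := (abs_nonneg _).trans (hp y)
    exact nonneg_of_mul_nonneg_left this (softmax_pos v y)
  have h := sum_softmax_mul_le v y (f := fun c => K * |z c - z y|) (K := K * L) (by simp)
    (fun c _ => mul_le_mul_of_nonneg_left (hz c) hK)
  refine (Finset.abs_sum_le_sum_abs _ _).trans (le_trans (Finset.sum_le_sum fun c _ => ?_) h)
  rw [abs_mul]
  calc |p c| * |z c - z y| ≤ K * softmax v c * |z c - z y| := by gcongr; exact hp c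
    _ = _ := by ring

lemma abs_sampleDirDeriv_le (hN : IsEntryDominatingNorm N) {i : Fin n}
    (hx : ∑ j, |X i j| ≤ R) (W D : Matrix (Fin k) (Fin d) ℝ) (hD : N D ≤ 1) :
    |sampleDirDeriv X y i W D| ≤ 2 * R * missProb X y i W := by
  have h := abs_sum_mul_sub_le (p := softmax (W *ᵥ X i)) (z := D *ᵥ X i) (W *ᵥ X i) (y i)
    (K := 1) (L := 2 * R * 1)
    (fun c => by rw [one_mul, abs_of_pos (softmax_pos _ _)])
    (fun c => abs_mulVec_sub_le hN hx D zero_le_one hD c (y i))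
  simpa [sampleDirDeriv, missProb] using h

/-- The softmax error is relative, so the change is measured by `missProb` at W alone. With W the
current iterate, stale gradients are charged to the present misclassification probability. -/
lemma abs_sampleDirDeriv_sub_le (hN : IsEntryDominatingNorm N) {i : Fin n}
    (hx : ∑ j, |X i j| ≤ R) (W W' D : Matrix (Fin k) (Fin d) ℝ) (hD : N D ≤ 1) {δ : ℝ}
    (hδ : 0 ≤ δ) (hW : N (W' - W) ≤ δ) :
    |sampleDirDeriv X y i W' D - sampleDirDeriv X y i W D| ≤
      2 * R * (Real.exp (2 * R * δ) - 1) * missProb X y i W := by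
  have hW' : W' *ᵥ X i = W *ᵥ X i + (W' - W) *ᵥ X i := by
    rw [← Matrix.add_mulVec]; simp
  have h := abs_sum_mul_sub_le
    (p := fun c => softmax (W' *ᵥ X i) c - softmax (W *ᵥ X i) c) (z := D *ᵥ X i)
    (W *ᵥ X i) (y i) (K := Real.exp (2 * R * δ) - 1) (L := 2 * R * 1)
    (fun c => by
      rw [hW']
      exact abs_softmax_add_sub_le _ _ c (abs_mulVec_sub_le hN hx (W' - W) hδ hW))
    (fun c => abs_mulVec_sub_le hN hx D zero_le_one hD c (y i))
  simp only [sub_mul, Finset.sum_sub_distrib] at h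
  rw [sampleDirDeriv, sampleDirDeriv, missProb]
  refine h.trans (le_of_eq ?_)
  ring

lemma sampleLoss_add_le (hN : IsEntryDominatingNorm N) {i : Fin n}
    (hx : ∑ j, |X i j| ≤ R) (W V : Matrix (Fin k) (Fin d) ℝ) {δ : ℝ}
    (hδ : 0 ≤ δ) (hV : N V ≤ δ) :
    sampleLoss X y i (W + V) ≤ sampleLoss X y i W + sampleDirDeriv X y i W V +
      (2 * R * δ) ^ 2 * Real.exp (2 * R * δ) * missProb X y i W := by
  rw [sampleLoss, Matrix.add_mulVec]
  exact neg_log_softmax_add_le _ _ _ (abs_mulVec_sub_le hN hx V hδ hV)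

lemma sampleLoss_add_le_add (hN : IsEntryDominatingNorm N) {i : Fin n}
    (hx : ∑ j, |X i j| ≤ R) (W V : Matrix (Fin k) (Fin d) ℝ) {δ : ℝ}
    (hδ : 0 ≤ δ) (hV : N V ≤ δ) :
    sampleLoss X y i (W + V) ≤ sampleLoss X y i W + 2 * R * δ := by
  rw [sampleLoss, Matrix.add_mulVec]
  exact neg_log_softmax_add_le_add _ _ _ (abs_mulVec_sub_le hN hx V hδ hV)

lemma IsEntryDominatingNorm.neg_le (hN : IsEntryDominatingNorm N)
    (A : Matrix (Fin k) (Fin d) ℝ) : N (-A) ≤ N A := by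
  simpa using hN.smul_le (-1) A

end WithNorm

lemma sampleLoss_pos (hk : 2 ≤ k) (i : Fin n) (W : Matrix (Fin k) (Fin d) ℝ) :
    0 < sampleLoss X y i W :=
  neg_pos.mpr (Real.log_neg (softmax_pos _ _) (softmax_lt_one _ hk _))

lemma missProb_eq (i : Fin n) (W : Matrix (Fin k) (Fin d) ℝ) :
    missProb X y i W = 1 - Real.exp (-sampleLoss X y i W) := by
  rw [missProb, sampleLoss, neg_neg, Real.exp_log (softmax_pos _ _)]

lemma missProb_pos (hk : 2 ≤ k) (i : Fin n) (W : Matrix (Fin k) (Fin d) ℝ) :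
    0 < missProb X y i W :=
  sub_pos.mpr (softmax_lt_one _ hk _)

lemma sampleLoss_sub_le_missProb (hk : 2 ≤ k) (i : Fin n) (W : Matrix (Fin k) (Fin d) ℝ) :
    sampleLoss X y i W - sampleLoss X y i W ^ 2 / 2 ≤ missProb X y i W := by
  have hl := (sampleLoss_pos (X := X) (y := y) hk i W).le
  set l := sampleLoss X y i W
  rw [missProb_eq]
  have h := Real.quadratic_le_exp_of_nonneg hl
  have h1 : Real.exp (-l) * Real.exp l = 1 := by rw [← Real.exp_add]; simp
  -- The product exceeds 1, hence exp(-l) ≤ 1 - l + l²/2 follows from the quadratic lower bound for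
  -- exp l.
  have h2 : (1 - l + l ^ 2 / 2) * (1 + l + l ^ 2 / 2) = 1 + l ^ 4 / 4 := by ring
  have h3 : 0 ≤ 1 - l + l ^ 2 / 2 := by nlinarith [sq_nonneg (l - 1)]
  have h4 : 1 ≤ (1 - l + l ^ 2 / 2) * Real.exp l := by
    nlinarith [mul_le_mul_of_nonneg_left h h3, sq_nonneg (l ^ 2)]
  have h5 : Real.exp (-l) ≤ 1 - l + l ^ 2 / 2 := by
    have : 0 < Real.exp l := Real.exp_pos l
    nlinarith
  linarith

lemma sampleLoss_le_two_mul (i : Fin n) {W : Matrix (Fin k) (Fin d) ℝ}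
    (h : missProb X y i W ≤ 1 / 2) : sampleLoss X y i W ≤ 2 * missProb X y i W := by
  have hs := softmax_pos (W *ᵥ X i) (y i)
  rw [missProb] at h ⊢
  rw [sampleLoss]
  set s := softmax (W *ᵥ X i) (y i)
  have h1 := Real.one_sub_inv_le_log_of_pos hs
  have h2 : s⁻¹ - 1 ≤ 2 * (1 - s) := by
    rw [inv_eq_one_div, sub_le_iff_le_add, div_le_iff₀ hs]
    nlinarith [softmax_le_one (W *ᵥ X i) (y i)]
  linarith

/-- For z ≤ 1 one has exp z ≤ 1 + 2z, so 1 + exp(-gap) ≤ exp(loss) forces exp(-gap) ≤ 2z. -/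
lemma neg_log_le_margin_term (hk : 2 ≤ k) (i : Fin n) {c : Fin k} (hc : c ≠ y i)
    {W : Matrix (Fin k) (Fin d) ℝ} {z : ℝ} (hz : sampleLoss X y i W ≤ z) (hz1 : z ≤ 1) :
    -Real.log (2 * z) ≤ (W *ᵥ X i) (y i) - (W *ᵥ X i) c := by
  have hz0 : 0 < z := (sampleLoss_pos hk i W).trans_le hz
  have h1 : 1 + Real.exp ((W *ᵥ X i) c - (W *ᵥ X i) (y i)) ≤ Real.exp (sampleLoss X y i W) :=
    one_add_exp_le (W *ᵥ X i) hc
  have h2 : Real.exp (sampleLoss X y i W) ≤ Real.exp z := Real.exp_le_exp.mpr hz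
  have h3 := Real.abs_exp_sub_one_le (x := z) (by rw [abs_of_pos hz0]; exact hz1)
  rw [abs_of_pos hz0] at h3
  have h4 := le_of_abs_le h3
  have h5 : Real.exp ((W *ᵥ X i) c - (W *ᵥ X i) (y i)) ≤ 2 * z := by linarith
  have h6 := Real.log_le_log (Real.exp_pos _) h5
  rw [Real.log_exp] at h6
  linarith

section Averages

variable {W : Matrix (Fin k) (Fin d) ℝ}

lemma natCast_mul_loss (hn : 0 < n) : (n : ℝ) * loss X y W = ∑ i, sampleLoss X y i W := by
  rw [loss]; field_simp

lemma natCast_mul_avgMissProb (hn : 0 < n) :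
    (n : ℝ) * avgMissProb X y W = ∑ i, missProb X y i W := by
  rw [avgMissProb]; field_simp

lemma avgMissProb_pos (hk : 2 ≤ k) (hn : 0 < n) : 0 < avgMissProb X y W := by
  have : 0 < ∑ i, missProb X y i W :=
    Finset.sum_pos (fun i _ => missProb_pos hk i W) ⟨⟨0, hn⟩, Finset.mem_univ _⟩
  rw [avgMissProb]; positivity

lemma loss_pos (hk : 2 ≤ k) (hn : 0 < n) : 0 < loss X y W := by
  have : 0 < ∑ i, sampleLoss X y i W :=
    Finset.sum_pos (fun i _ => sampleLoss_pos hk i W) ⟨⟨0, hn⟩, Finset.mem_univ _⟩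
  rw [loss]; positivity

lemma loss_le_two_mul_avgMissProb (hn : 0 < n) (h : n * avgMissProb X y W ≤ 1 / 2) :
    loss X y W ≤ 2 * avgMissProb X y W := by
  rw [natCast_mul_avgMissProb hn] at h
  have : ∑ i, sampleLoss X y i W ≤ 2 * ∑ i, missProb X y i W := by
    rw [Finset.mul_sum]
    refine Finset.sum_le_sum fun i _ => sampleLoss_le_two_mul i (le_trans ?_ h)
    exact Finset.single_le_sum (f := fun i => missProb X y i W) (fun j _ => missProb_nonneg j W)
      (Finset.mem_univ i)
  rw [loss, avgMissProb]
  calc _ ≤ 1 / (n : ℝ) * (2 * ∑ i, missProb X y i W) := by gcongr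
    _ = _ := by ring

/-- Samplewise 1 - exp(-l) ≥ l - l²/2. The factor n comes from bounding the sum of the squared
losses by the square of their sum, which is (n L)². -/
lemma loss_sub_le_avgMissProb (hk : 2 ≤ k) (hn : 0 < n) :
    loss X y W - n * loss X y W ^ 2 / 2 ≤ avgMissProb X y W := by
  have hn' : (0 : ℝ) < n := by exact_mod_cast hn
  have h1 : ∑ i, (sampleLoss X y i W - sampleLoss X y i W ^ 2 / 2) ≤ ∑ i, missProb X y i W :=
    Finset.sum_le_sum fun i _ => sampleLoss_sub_le_missProb hk i W
  have h2 : ∑ i, sampleLoss X y i W ^ 2 ≤ (∑ i, sampleLoss X y i W) ^ 2 :=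
    Finset.sum_sq_le_sq_sum_of_nonneg fun i _ => (sampleLoss_pos hk i W).le
  rw [Finset.sum_sub_distrib, ← Finset.sum_div, ← natCast_mul_avgMissProb hn,
    ← natCast_mul_loss hn] at h1
  rw [← natCast_mul_loss hn] at h2
  have h3 : (n : ℝ) * (loss X y W - n * loss X y W ^ 2 / 2) ≤ n * avgMissProb X y W := by
    nlinarith
  exact le_of_mul_le_mul_left h3 hn'

lemma neg_log_le_margin (hk : 2 ≤ k) (hn : 0 < n) (h : n * loss X y W ≤ 1) :
    -Real.log (2 * (n * loss X y W)) ≤ margin X y W := by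
  refine le_margin hk ⟨0, hn⟩ fun i c hc => neg_log_le_margin_term hk i hc ?_ h
  rw [natCast_mul_loss hn]
  exact Finset.single_le_sum (f := fun i => sampleLoss X y i W)
    (fun j _ => (sampleLoss_pos hk j W).le) (Finset.mem_univ i)

end Averages

section OptimalMargin

variable {κ : NormKind} {p : ℝ≥0∞} {R : ℝ}

lemma margin_le_of_norm_le (hp : 1 ≤ p) (hk : 2 ≤ k) (i₀ : Fin n)
    (hx : ∀ i, ∑ j, |X i j| ≤ R) {U : Matrix (Fin k) (Fin d) ℝ} {δ : ℝ} (hδ : 0 ≤ δ)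
    (hU : matNorm κ p U ≤ δ) : margin X y U ≤ 2 * R * δ := by
  obtain ⟨c, hc⟩ := exists_ne_label hk (y i₀)
  exact (margin_le U i₀ hc).trans ((le_abs_self _).trans
    (abs_mulVec_sub_le (matNorm_isEntryDominatingNorm κ hp) (hx i₀) U hδ hU _ _))

lemma margin_zero (hk : 2 ≤ k) (i₀ : Fin n) :
    margin X y (0 : Matrix (Fin k) (Fin d) ℝ) = 0 := by
  obtain ⟨c, hc⟩ := exists_ne_label hk (y i₀)
  refine le_antisymm ((margin_le 0 i₀ hc).trans (by simp)) (le_margin hk i₀ fun i c _ => by simp)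

lemma matNorm_zero_le (hp : 1 ≤ p) : matNorm κ p (0 : Matrix (Fin k) (Fin d) ℝ) ≤ 0 := by
  simpa using (matNorm_isEntryDominatingNorm κ hp).smul_le 0 (0 : Matrix (Fin k) (Fin d) ℝ)

lemma maxMargin_le (hp : 1 ≤ p) (hk : 2 ≤ k) (i₀ : Fin n) (hx : ∀ i, ∑ j, |X i j| ≤ R) :
    maxMargin κ p X y ≤ 2 * R := by
  refine csSup_le (Set.Nonempty.image _ ⟨0, (matNorm_zero_le hp).trans zero_le_one⟩) ?_
  rintro _ ⟨U, hU, rfl⟩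
  simpa using margin_le_of_norm_le hp hk i₀ hx zero_le_one hU

/-- A bound that is linear in the margin of a competitor from the unit ball extends to the
maximum margin. -/
lemma maxMargin_mul_le (hp : 1 ≤ p) {g z : ℝ} (hg : 0 < g)
    (h : ∀ U : Matrix (Fin k) (Fin d) ℝ, matNorm κ p U ≤ 1 → margin X y U * g ≤ z) :
    maxMargin κ p X y * g ≤ z := by
  rw [← le_div_iff₀ hg]
  refine csSup_le (Set.Nonempty.image _ ⟨0, (matNorm_zero_le hp).trans zero_le_one⟩) ?_
  rintro _ ⟨U, hU, rfl⟩
  exact (le_div_iff₀ hg).mpr (h U hU)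

end OptimalMargin

end Sample

/-! ### Visit counts under reshuffling and discounted averages -/

section Reshuffling

variable {n m b : ℕ} {S : ℕ → Finset (Fin n)}

/-- The index j₀ is the only slot of epoch e whose batch contains the sample. -/
lemma IsReshuffling.sum_epoch (hS : IsReshuffling m b S) (i : Fin n) (e : ℕ) :
    ∃ j₀ < m, ∀ r ≤ m, ∑ j ∈ Finset.range r, (if i ∈ S (e * m + j) then (1 : ℝ) else 0) =
      if j₀ < r then 1 else 0 := by
  obtain ⟨j₀, hj₀, hi⟩ := hS.cover e i
  refine ⟨j₀, hj₀, fun r hr => ?_⟩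
  have h : ∀ j ∈ Finset.range r, (if i ∈ S (e * m + j) then (1 : ℝ) else 0) =
      if j₀ = j then 1 else 0 := by
    intro j hj
    rw [Finset.mem_range] at hj
    by_cases hjj : j₀ = j
    · subst hjj; simp [hi]
    · have := Finset.disjoint_left.mp (hS.disjoint e j₀ hj₀ j (by omega) hjj) hi
      simp [this, hjj]
  rw [Finset.sum_congr rfl h, Finset.sum_ite_eq]
  simp

lemma IsReshuffling.sum_full_epochs (hS : IsReshuffling m b S) (i : Fin n) (e : ℕ) :
    ∑ s ∈ Finset.range (e * m), (if i ∈ S s then (1 : ℝ) else 0) = e := by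
  induction e with
  | zero => simp
  | succ e ih =>
    obtain ⟨j₀, hj₀, h⟩ := hS.sum_epoch i e
    rw [Nat.succ_mul, Finset.sum_range_add, ih, h m le_rfl, if_pos hj₀]
    push_cast; ring

/-- At any time, the number of visits to a sample deviates little from its average. -/
lemma IsReshuffling.abs_sum_visits_le (hS : IsReshuffling m b S) (hm : 0 < m) (i : Fin n)
    (t : ℕ) : |∑ s ∈ Finset.range t, ((m : ℝ) * (if i ∈ S s then 1 else 0) - 1)| ≤ m - 1 := by
  obtain ⟨j₀, hj₀, h⟩ := hS.sum_epoch i (t / m)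
  have hr := Nat.mod_lt t hm
  have ht : t / m * m + t % m = t := Nat.div_add_mod' t m
  -- Complete epochs cancel exactly, so only the t % m steps of the current epoch remain.
  have h1 : ∑ s ∈ Finset.range t, ((m : ℝ) * (if i ∈ S s then 1 else 0) - 1) =
      m * (if j₀ < t % m then 1 else 0) - (t % m : ℕ) := by
    rw [Finset.sum_sub_distrib, ← Finset.mul_sum]
    conv_lhs => rw [← ht]
    rw [Finset.sum_range_add, hS.sum_full_epochs, h _ hr.le]
    simp only [Finset.sum_const, Finset.card_range, nsmul_eq_mul, Nat.cast_add, Nat.cast_mul]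
    ring
  rw [h1]
  have hr' : ((t % m : ℕ) : ℝ) + 1 ≤ m := by exact_mod_cast hr
  have hm' : (1 : ℝ) ≤ m := by exact_mod_cast hm
  have hr0 : (0 : ℝ) ≤ (t % m : ℕ) := Nat.cast_nonneg _
  split_ifs with hlt
  · have : (1 : ℝ) ≤ (t % m : ℕ) := by exact_mod_cast (by omega : 1 ≤ t % m)
    rw [abs_le]; constructor <;> linarith
  · rw [abs_le]; constructor <;> linarith

end Reshuffling

/-- Discounted sums of a sequence with bounded partial sums are bounded. -/
lemma abs_discounted_sum_le {β K : ℝ} (hβ0 : 0 ≤ β) (hβ1 : β ≤ 1) (z : ℕ → ℝ)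
    (hz : ∀ t, |∑ s ∈ Finset.range t, z s| ≤ K) (t : ℕ) :
    |∑ s ∈ Finset.range (t + 1), β ^ (t - s) * z s| ≤ 2 * K := by
  have hK : 0 ≤ K := (abs_nonneg _).trans (hz 0)
  -- The difference of plain and discounted sums obeys d_{t+1} = (1-β) P + β d_t, with P the sum of
  -- z up to time t. As a convex combination it stays within K; the factor 2 then comes from the
  -- plain sum.
  have key : |∑ s ∈ Finset.range (t + 1), z s -
      ∑ s ∈ Finset.range (t + 1), β ^ (t - s) * z s| ≤ K := by
    induction t with
    | zero => simpa using hK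
    | succ t ih =>
      have h1 : ∑ s ∈ Finset.range (t + 1), β ^ (t + 1 - s) * z s =
          β * ∑ s ∈ Finset.range (t + 1), β ^ (t - s) * z s := by
        rw [Finset.mul_sum]
        refine Finset.sum_congr rfl fun s hs => ?_
        rw [Nat.succ_sub (Nat.lt_succ_iff.mp (Finset.mem_range.mp hs)), pow_succ]
        ring
      rw [Finset.sum_range_succ, Finset.sum_range_succ (fun s => β ^ (t + 1 - s) * z s), h1,
        Nat.sub_self, pow_zero, one_mul]
      set P := ∑ s ∈ Finset.range (t + 1), z s with hP
      set A := ∑ s ∈ Finset.range (t + 1), β ^ (t - s) * z s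
      have h2 : P + z (t + 1) - (β * A + z (t + 1)) = (1 - β) * P + β * (P - A) := by ring
      rw [h2]
      calc |(1 - β) * P + β * (P - A)| ≤ |(1 - β) * P| + |β * (P - A)| := abs_add_le _ _
        _ = (1 - β) * |P| + β * |P - A| := by
          rw [abs_mul, abs_mul, abs_of_nonneg hβ0, abs_of_nonneg (sub_nonneg.mpr hβ1)]
        _ ≤ (1 - β) * K + β * K := by
          have : 0 ≤ 1 - β := by linarith
          gcongr
          exact hz (t + 1)
        _ = K := by ring
  have h3 := hz (t + 1)
  rw [abs_le] at key h3 ⊢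
  constructor <;> linarith

lemma one_sub_mul_geom_sum (β : ℝ) (t : ℕ) :
    (1 - β) * ∑ s ∈ Finset.range (t + 1), β ^ (t - s) = 1 - β ^ (t + 1) := by
  have h := Finset.sum_range_reflect (fun s => β ^ s) (t + 1)
  simp only [Nat.add_sub_cancel] at h
  rw [h]
  have := mul_neg_geom_sum β (t + 1)
  linarith

/-- The momentum average of the deviations of the gradients caused by the movement of the
iterates. -/
noncomputable def momLag (β α : ℝ) (η : ℕ → ℝ) (t : ℕ) : ℝ :=
  (1 - β) * ∑ s ∈ Finset.range (t + 1),
    β ^ (t - s) * (Real.exp (α * ∑ r ∈ Finset.Ico s t, η r) - 1)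

/-! ### Buffer error and the descent inequality -/

section Run

variable {n k d m b : ℕ} {κ : NormKind} {p : ℝ≥0∞} {X : Fin n → Fin d → ℝ}
  {y : Fin n → Fin k} {β R : ℝ} {η : ℕ → ℝ} {S : ℕ → Finset (Fin n)}
  {W M Δ : ℕ → Matrix (Fin k) (Fin d) ℝ}

/-- The directional derivative of the loss at `W` in the direction `D`. -/
noncomputable def lossDirDeriv (X : Fin n → Fin d → ℝ) (y : Fin n → Fin k)
    (W D : Matrix (Fin k) (Fin d) ℝ) : ℝ :=
  (1 / (n : ℝ)) * ∑ i, sampleDirDeriv X y i W D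

lemma margin_mul_avgMissProb_le (W U : Matrix (Fin k) (Fin d) ℝ) :
    margin X y U * avgMissProb X y W ≤ -lossDirDeriv X y W U := by
  have : margin X y U * ∑ i, missProb X y i W ≤ -∑ i, sampleDirDeriv X y i W U := by
    rw [Finset.mul_sum, ← Finset.sum_neg_distrib]
    exact Finset.sum_le_sum fun i _ => margin_mul_missProb_le i W U
  rw [avgMissProb, lossDirDeriv]
  have h : (0 : ℝ) ≤ 1 / n := by positivity
  nlinarith

lemma IsMomentumRun.matInner_buffer (h : IsMomentumRun κ p X y β η S W M Δ) (t : ℕ)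
    (D : Matrix (Fin k) (Fin d) ℝ) :
    matInner (M t) D = (1 - β) * ∑ s ∈ Finset.range (t + 1),
      β ^ (t - s) * matInner (batchGrad X y (S s) (W s)) D := by
  induction t with
  | zero => simp [h.buffer_zero, matInner_smul]
  | succ t ih =>
    rw [h.buffer_succ, matInner_add, matInner_smul, matInner_smul, ih,
      Finset.sum_range_succ _ (t + 1), Nat.sub_self, pow_zero, one_mul, mul_add]
    congr 1
    rw [← mul_assoc, mul_comm β, mul_assoc, Finset.mul_sum]
    congr 1
    refine Finset.sum_congr rfl fun s hs => ?_
    rw [Nat.succ_sub (Nat.lt_succ_iff.mp (Finset.mem_range.mp hs)), pow_succ]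
    ring

lemma IsMomentumRun.norm_step_le (h : IsMomentumRun κ p X y β η S W M Δ) (hp : 1 ≤ p)
    (hη : ∀ t, 0 ≤ η t) (t : ℕ) : matNorm κ p (η t • Δ t) ≤ η t := by
  refine ((matNorm_isEntryDominatingNorm κ hp).smul_le _ _).trans ?_
  rw [abs_of_nonneg (hη t)]
  exact mul_le_of_le_one_right (hη t) (h.dir_mem t)

lemma IsMomentumRun.norm_sub_le (h : IsMomentumRun κ p X y β η S W M Δ) (hp : 1 ≤ p)
    (hη : ∀ t, 0 ≤ η t) {s t : ℕ} (hst : s ≤ t) :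
    matNorm κ p (W s - W t) ≤ ∑ r ∈ Finset.Ico s t, η r := by
  induction t, hst using Nat.le_induction with
  | base => simpa using matNorm_zero_le hp
  | succ t hst ih =>
    rw [Finset.sum_Ico_succ_top hst, h.step,
      show W s - (W t - η t • Δ t) = (W s - W t) + η t • Δ t by abel]
    exact ((matNorm_isEntryDominatingNorm κ hp).add_le _ _).trans
      (add_le_add ih (h.norm_step_le hp hη t))

lemma IsMomentumRun.norm_le (h : IsMomentumRun κ p X y β η S W M Δ) (hp : 1 ≤ p)
    (hη : ∀ t, 0 ≤ η t) (t : ℕ) :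
    matNorm κ p (W t) ≤ matNorm κ p (W 0) + ∑ r ∈ Finset.range t, η r := by
  have hN := matNorm_isEntryDominatingNorm (k := k) (d := d) κ hp
  have h1 := hN.add_le (W 0) (-(W 0 - W t))
  have h2 := (hN.neg_le (W 0 - W t)).trans (h.norm_sub_le hp hη (Nat.zero_le t))
  rw [Nat.Ico_zero_eq_range] at h2
  rw [show W 0 + -(W 0 - W t) = W t by abel] at h1
  linarith

/-- The momentum buffer is close to the full gradient in the dual norm. -/
lemma IsMomentumRun.abs_buffer_sub_le (h : IsMomentumRun κ p X y β η S W M Δ) (hp : 1 ≤ p)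
    (hη : ∀ t, 0 ≤ η t) (hn : 0 < n) (hnm : n = m * b) (hβ0 : 0 < β) (hβ1 : β < 1)
    (hS : IsReshuffling m b S) (hx : ∀ i, ∑ j, |X i j| ≤ R) (t : ℕ)
    {D : Matrix (Fin k) (Fin d) ℝ} (hD : matNorm κ p D ≤ 1) :
    |matInner (M t) D - lossDirDeriv X y (W t) D| ≤
      2 * R * (2 * (1 - β) * (m - 1) + β ^ (t + 1) + m * momLag β (2 * R) η t) *
        avgMissProb X y (W t) := by
  have hN := matNorm_isEntryDominatingNorm (k := k) (d := d) κ hp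
  have hR : 0 ≤ R := (Finset.sum_nonneg fun j _ => abs_nonneg _).trans (hx ⟨0, hn⟩)
  have hm : 0 < m := Nat.pos_of_ne_zero fun h0 => by simp [h0] at hnm; omega
  have hb : 0 < b := Nat.pos_of_ne_zero fun h0 => by simp [h0] at hnm; omega
  have hm' : (0 : ℝ) < m := by exact_mod_cast hm
  have hb' : (0 : ℝ) < b := by exact_mod_cast hb
  have hn' : (n : ℝ) = m * b := by exact_mod_cast hnm
  have hn0 : (0 : ℝ) < n := by exact_mod_cast hn
  set g : Fin n → ℝ := fun i => sampleDirDeriv X y i (W t) D with hg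
  set χ : ℕ → Fin n → ℝ := fun s i => if i ∈ S s then 1 else 0 with hχ
  -- Each old batch gradient is split into its value with the weights frozen at time t and the
  -- deviation caused by the movement since time s.
  have hbatch : ∀ s, matInner (batchGrad X y (S s) (W s)) D = (1 / (b : ℝ)) *
      ∑ i, χ s i * (sampleDirDeriv X y i (W s) D - g i) + (1 / (b : ℝ)) * ∑ i, χ s i * g i := by
    intro s
    rw [matInner_batchGrad, hS.card_eq, ← mul_add, ← Finset.sum_add_distrib]
    congr 1
    simp only [← mul_add, sub_add_cancel]
    simp [hχ]
  have hmain : (1 - β) * ∑ s ∈ Finset.range (t + 1), β ^ (t - s) *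
      ((1 / (b : ℝ)) * ∑ i, χ s i * g i) - lossDirDeriv X y (W t) D =
      (1 / (n : ℝ)) * ∑ i, ((1 - β) * ∑ s ∈ Finset.range (t + 1),
        β ^ (t - s) * (m * χ s i - 1) - β ^ (t + 1)) * g i := by
    -- The discount weights add up to 1 - β^(t+1) only, because the buffer starts from 0; the
    -- missing mass appears as a separate error.
    have h1 : ∀ i, (1 - β) * ∑ s ∈ Finset.range (t + 1), β ^ (t - s) * (m * χ s i - 1) -
        β ^ (t + 1) = (1 - β) * m * ∑ s ∈ Finset.range (t + 1), β ^ (t - s) * χ s i - 1 := by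
      intro i
      have h2 := one_sub_mul_geom_sum β t
      have h3 : ∑ s ∈ Finset.range (t + 1), β ^ (t - s) * (m * χ s i - 1) =
          m * ∑ s ∈ Finset.range (t + 1), β ^ (t - s) * χ s i -
            ∑ s ∈ Finset.range (t + 1), β ^ (t - s) := by
        rw [Finset.mul_sum, ← Finset.sum_sub_distrib]
        exact Finset.sum_congr rfl fun s _ => by ring
      rw [h3]
      linarith
    have h4 : ∑ s ∈ Finset.range (t + 1), β ^ (t - s) * ((1 / (b : ℝ)) * ∑ i, χ s i * g i) =
        (1 / (b : ℝ)) * ∑ i, (∑ s ∈ Finset.range (t + 1), β ^ (t - s) * χ s i) * g i := by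
      simp only [Finset.mul_sum, Finset.sum_mul]
      rw [Finset.sum_comm]
      exact Finset.sum_congr rfl fun i _ => Finset.sum_congr rfl fun s _ => by ring
    have h5 : ∑ i, ((1 - β) * ∑ s ∈ Finset.range (t + 1), β ^ (t - s) * (m * χ s i - 1) -
        β ^ (t + 1)) * g i =
        ∑ i, ((1 - β) * m * ∑ s ∈ Finset.range (t + 1), β ^ (t - s) * χ s i - 1) * g i :=
      Finset.sum_congr rfl fun i _ => by rw [h1 i]
    rw [h4, h5, lossDirDeriv, hn', Finset.mul_sum, Finset.mul_sum, Finset.mul_sum, Finset.mul_sum, ← Finset.sum_sub_distrib]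
    refine Finset.sum_congr rfl fun i _ => ?_
    simp only [hg]
    field_simp
  have hsplit : matInner (M t) D - lossDirDeriv X y (W t) D =
      (1 - β) * ∑ s ∈ Finset.range (t + 1), β ^ (t - s) *
        ((1 / (b : ℝ)) * ∑ i, χ s i * (sampleDirDeriv X y i (W s) D - g i)) +
      (1 / (n : ℝ)) * ∑ i, ((1 - β) * ∑ s ∈ Finset.range (t + 1),
        β ^ (t - s) * (m * χ s i - 1) - β ^ (t + 1)) * g i := by
    rw [← hmain, h.matInner_buffer]
    simp only [hbatch, mul_add, Finset.sum_add_distrib]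
    ring
  have hq := natCast_mul_avgMissProb (X := X) (y := y) (W := W t) hn
  have hlag : |(1 - β) * ∑ s ∈ Finset.range (t + 1), β ^ (t - s) *
      ((1 / (b : ℝ)) * ∑ i, χ s i * (sampleDirDeriv X y i (W s) D - g i))| ≤
      2 * R * (m * momLag β (2 * R) η t) * avgMissProb X y (W t) := by
    have h1 : ∀ s ∈ Finset.range (t + 1), |β ^ (t - s) *
        ((1 / (b : ℝ)) * ∑ i, χ s i * (sampleDirDeriv X y i (W s) D - g i))| ≤
        β ^ (t - s) * (Real.exp (2 * R * ∑ r ∈ Finset.Ico s t, η r) - 1) *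
          (2 * R * m * avgMissProb X y (W t)) := by
      intro s hs
      have hst : s ≤ t := Nat.lt_succ_iff.mp (Finset.mem_range.mp hs)
      have hδ : 0 ≤ ∑ r ∈ Finset.Ico s t, η r := Finset.sum_nonneg fun r _ => hη r
      set E := Real.exp (2 * R * ∑ r ∈ Finset.Ico s t, η r) - 1 with hE
      have hE0 : 0 ≤ E := sub_nonneg.mpr (Real.one_le_exp (by positivity))
      -- The sum over the batch is enlarged to all samples. The prefactor is 1/b and not 1/n, which
      -- costs the factor m = n/b in front of `momLag`.
      have h2 : |∑ i, χ s i * (sampleDirDeriv X y i (W s) D - g i)| ≤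
          2 * R * E * ∑ i, missProb X y i (W t) := by
        rw [Finset.mul_sum]
        refine (Finset.abs_sum_le_sum_abs _ _).trans (Finset.sum_le_sum fun i _ => ?_)
        rw [abs_mul]
        have h3 := abs_sampleDirDeriv_sub_le (y := y) hN (hx i) (W t) (W s) D hD hδ
          (h.norm_sub_le hp hη hst)
        have h4 : |χ s i| ≤ 1 := by
          simp only [hχ]; split_ifs <;> simp
        calc _ ≤ 1 * |sampleDirDeriv X y i (W s) D - g i| := by gcongr
          _ ≤ _ := by rw [one_mul]; exact h3
      rw [abs_mul, abs_mul, abs_of_nonneg (pow_nonneg hβ0.le _),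
        abs_of_nonneg (by positivity : (0 : ℝ) ≤ 1 / b)]
      calc _ ≤ β ^ (t - s) * ((1 / (b : ℝ)) * (2 * R * E * ∑ i, missProb X y i (W t))) := by
            gcongr
        _ = _ := by
            rw [← hq, hn']
            field_simp
    rw [abs_mul, abs_of_nonneg (sub_nonneg.mpr hβ1.le)]
    calc _ ≤ (1 - β) * ∑ s ∈ Finset.range (t + 1), β ^ (t - s) *
          (Real.exp (2 * R * ∑ r ∈ Finset.Ico s t, η r) - 1) *
          (2 * R * m * avgMissProb X y (W t)) := by
          refine mul_le_mul_of_nonneg_left ?_ (sub_nonneg.mpr hβ1.le)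
          exact (Finset.abs_sum_le_sum_abs _ _).trans (Finset.sum_le_sum h1)
      _ = _ := by
          rw [← Finset.sum_mul, momLag]
          ring
  have hshuf : |(1 / (n : ℝ)) * ∑ i, ((1 - β) * ∑ s ∈ Finset.range (t + 1),
      β ^ (t - s) * (m * χ s i - 1) - β ^ (t + 1)) * g i| ≤
      2 * R * (2 * (1 - β) * (m - 1) + β ^ (t + 1)) * avgMissProb X y (W t) := by
    have h1 : |∑ i, ((1 - β) * ∑ s ∈ Finset.range (t + 1),
        β ^ (t - s) * (m * χ s i - 1) - β ^ (t + 1)) * g i| ≤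
        (2 * (1 - β) * (m - 1) + β ^ (t + 1)) * (2 * R) * ∑ i, missProb X y i (W t) := by
      rw [Finset.mul_sum]
      refine (Finset.abs_sum_le_sum_abs _ _).trans (Finset.sum_le_sum fun i _ => ?_)
      rw [abs_mul, mul_assoc]
      have h2 := abs_discounted_sum_le hβ0.le hβ1.le (fun s => (m : ℝ) * χ s i - 1)
        (hS.abs_sum_visits_le hm i) t
      have h3 : |g i| ≤ 2 * R * missProb X y i (W t) := abs_sampleDirDeriv_le hN (hx i) _ _ hD
      refine mul_le_mul ?_ h3 (abs_nonneg _) ?_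
      · refine (abs_sub _ _).trans ?_
        rw [abs_mul, abs_of_nonneg (sub_nonneg.mpr hβ1.le), abs_of_nonneg (pow_nonneg hβ0.le _)]
        have := mul_le_mul_of_nonneg_left h2 (sub_nonneg.mpr hβ1.le)
        linarith
      · have : (1 : ℝ) ≤ m := by exact_mod_cast hm
        have h5 : 0 ≤ (1 - β) * (m - 1) := mul_nonneg (by linarith) (by linarith)
        have := pow_nonneg hβ0.le (t + 1)
        linarith
    rw [abs_mul, abs_of_nonneg (by positivity : (0 : ℝ) ≤ 1 / n)]
    calc _ ≤ 1 / (n : ℝ) * ((2 * (1 - β) * (m - 1) + β ^ (t + 1)) * (2 * R) *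
          ∑ i, missProb X y i (W t)) := by gcongr
      _ = _ := by rw [← hq]; field_simp
  rw [hsplit]
  refine (abs_add_le _ _).trans ((add_le_add hlag hshuf).trans (le_of_eq ?_))
  ring

/-- Progress along the update direction in terms of the effective margin. -/
lemma IsMomentumRun.effMargin_mul_le (h : IsMomentumRun κ p X y β η S W M Δ) (hp : 1 ≤ p)
    (hk : 2 ≤ k) (hη : ∀ t, 0 ≤ η t) (hn : 0 < n) (hnm : n = m * b) (hβ0 : 0 < β) (hβ1 : β < 1)
    (hS : IsReshuffling m b S) (hx : ∀ i, ∑ j, |X i j| ≤ R) (t : ℕ) :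
    (effMargin κ p X y m β R - 4 * R * β ^ (t + 1) - 4 * R * m * momLag β (2 * R) η t) *
      avgMissProb X y (W t) ≤ lossDirDeriv X y (W t) (Δ t) := by
  have hN := matNorm_isEntryDominatingNorm (k := k) (d := d) κ hp
  have hR : 0 ≤ R := (Finset.sum_nonneg fun j _ => abs_nonneg _).trans (hx ⟨0, hn⟩)
  have hm : 0 < m := Nat.pos_of_ne_zero fun h0 => by simp [h0] at hnm; omega
  have hG := avgMissProb_pos (X := X) (y := y) (W := W t) hk hn
  set G := avgMissProb X y (W t)
  set err := 2 * R * (2 * (1 - β) * (m - 1) + β ^ (t + 1) + m * momLag β (2 * R) η t) with herr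
  -- The direction beats -U for the buffer, and passing between buffer and gradient costs one error
  -- for each of the two directions, hence 2 * err.
  have key : maxMargin κ p X y * G ≤ lossDirDeriv X y (W t) (Δ t) + 2 * err * G := by
    refine maxMargin_mul_le hp hG fun U hU => ?_
    have hU' : matNorm κ p (-U) ≤ 1 := (hN.neg_le U).trans hU
    have h1 := abs_le.mp
      (h.abs_buffer_sub_le hp hη hn hnm hβ0 hβ1 hS hx t (h.dir_mem t))
    have h2 := abs_le.mp (h.abs_buffer_sub_le hp hη hn hnm hβ0 hβ1 hS hx t hU')
    have h3 := h.dir_max t (-U) hU'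
    have h4 := margin_mul_avgMissProb_le (X := X) (y := y) (W t) U
    have h5 : lossDirDeriv X y (W t) (-U) = -lossDirDeriv X y (W t) U := by
      simp [lossDirDeriv, sampleDirDeriv_neg]
    rw [h5] at h2
    linarith [h1.1, h1.2, h2.1, h2.2]
  -- Twice the reshuffling error is linear in m - 1; it fits into the cubic penalty of ρ because 4(m
  -- - 1) ≤ m(m² - 1).
  have hcmp : 2 * (4 * R * (1 - β) * (m - 1)) ≤ 2 * (1 - β) * m * ((m : ℝ) ^ 2 - 1) * R := by
    have h6 : 4 * ((m : ℝ) - 1) ≤ m * ((m : ℝ) ^ 2 - 1) := by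
      rcases Nat.lt_or_ge m 2 with h2 | h2
      · have : m = 1 := by omega
        subst this; norm_num
      · have : (2 : ℝ) ≤ m := by exact_mod_cast h2
        nlinarith [mul_nonneg (by linarith : (0 : ℝ) ≤ m - 1)
          (by nlinarith : (0 : ℝ) ≤ m * (m + 1) - 4)]
    have := mul_le_mul_of_nonneg_left h6 (mul_nonneg (by linarith : 0 ≤ 2 * (1 - β)) hR)
    linarith
  have h7 := mul_le_mul_of_nonneg_right hcmp hG.le
  rw [effMargin]
  rw [herr] at key
  linarith

lemma loss_add_le (hp : 1 ≤ p) (hx : ∀ i, ∑ j, |X i j| ≤ R)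
    (W V : Matrix (Fin k) (Fin d) ℝ) {δ : ℝ} (hδ : 0 ≤ δ) (hV : matNorm κ p V ≤ δ) :
    loss X y (W + V) ≤ loss X y W + lossDirDeriv X y W V +
      (2 * R * δ) ^ 2 * Real.exp (2 * R * δ) * avgMissProb X y W := by
  have hN := matNorm_isEntryDominatingNorm (k := k) (d := d) κ hp
  have h1 := Finset.sum_le_sum fun (i : Fin n) (_ : i ∈ Finset.univ) =>
    sampleLoss_add_le (y := y) hN (hx i) W V hδ hV
  rw [Finset.sum_add_distrib, Finset.sum_add_distrib, ← Finset.mul_sum] at h1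
  have h2 := mul_le_mul_of_nonneg_left h1 (by positivity : (0 : ℝ) ≤ 1 / n)
  rw [loss, loss, lossDirDeriv, avgMissProb]
  linarith

lemma loss_add_le_add (hp : 1 ≤ p) (hn : 0 < n) (hx : ∀ i, ∑ j, |X i j| ≤ R)
    (W V : Matrix (Fin k) (Fin d) ℝ) {δ : ℝ} (hδ : 0 ≤ δ) (hV : matNorm κ p V ≤ δ) :
    loss X y (W + V) ≤ loss X y W + 2 * R * δ := by
  have hN := matNorm_isEntryDominatingNorm (k := k) (d := d) κ hp
  have h1 := Finset.sum_le_sum fun (i : Fin n) (_ : i ∈ Finset.univ) =>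
    sampleLoss_add_le_add (y := y) hN (hx i) W V hδ hV
  rw [Finset.sum_add_distrib] at h1
  simp only [Finset.sum_const, Finset.card_univ, Fintype.card_fin, nsmul_eq_mul] at h1
  have h2 := mul_le_mul_of_nonneg_left h1 (by positivity : (0 : ℝ) ≤ 1 / n)
  have hn0 : (n : ℝ) ≠ 0 := by exact_mod_cast hn.ne'
  rw [mul_add, ← mul_assoc _ (n : ℝ), one_div_mul_cancel hn0, one_mul] at h2
  exact h2

lemma IsMomentumRun.loss_succ_le_add (h : IsMomentumRun κ p X y β η S W M Δ) (hp : 1 ≤ p)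
    (hη : ∀ t, 0 ≤ η t) (hn : 0 < n) (hx : ∀ i, ∑ j, |X i j| ≤ R) (t : ℕ) :
    loss X y (W (t + 1)) ≤ loss X y (W t) + 2 * R * η t := by
  rw [h.step, sub_eq_add_neg]
  exact loss_add_le_add hp hn hx _ _ (hη t)
    (((matNorm_isEntryDominatingNorm κ hp).neg_le _).trans (h.norm_step_le hp hη t))

/-- The descent inequality for one step of the algorithm. -/
lemma IsMomentumRun.loss_succ_le (h : IsMomentumRun κ p X y β η S W M Δ) (hp : 1 ≤ p)
    (hk : 2 ≤ k) (hη : ∀ t, 0 ≤ η t) (hn : 0 < n) (hnm : n = m * b) (hβ0 : 0 < β) (hβ1 : β < 1)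
    (hS : IsReshuffling m b S) (hx : ∀ i, ∑ j, |X i j| ≤ R) (t : ℕ) :
    loss X y (W (t + 1)) ≤ loss X y (W t) - η t * (effMargin κ p X y m β R -
      (4 * R * β ^ (t + 1) + 4 * R * m * momLag β (2 * R) η t +
        4 * R ^ 2 * Real.exp (2 * R * η t) * η t)) * avgMissProb X y (W t) := by
  have h1 := loss_add_le (y := y) hp hx (W t) (-(η t • Δ t)) (hη t)
    (((matNorm_isEntryDominatingNorm κ hp).neg_le _).trans (h.norm_step_le hp hη t))
  have h2 : lossDirDeriv X y (W t) (-(η t • Δ t)) = -(η t * lossDirDeriv X y (W t) (Δ t)) := by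
    simp only [lossDirDeriv, sampleDirDeriv_neg, sampleDirDeriv_smul, Finset.sum_neg_distrib,
      ← Finset.mul_sum]
    ring
  have h3 := mul_le_mul_of_nonneg_left
    (h.effMargin_mul_le hp hk hη hn hnm hβ0 hβ1 hS hx t) (hη t)
  rw [h2, ← sub_eq_add_neg, ← h.step] at h1
  linarith

end Run

/-! ### Polynomial step sizes and the momentum lag -/

section PowerSums

/-- Telescoping: Bernoulli's inequality with exponent 1 - p shows that t^(1-p) grows by at least
(1-p)(t+1)^(-p) in one step. -/
lemma sum_rpow_neg_le {p : ℝ} (hp0 : 0 ≤ p) (hp1 : p < 1) (t : ℕ) :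
    ∑ s ∈ Finset.range t, ((s : ℝ) + 1) ^ (-p) ≤ (t : ℝ) ^ (1 - p) / (1 - p) := by
  have hp : 0 < 1 - p := by linarith
  induction t with
  | zero => simp [Real.zero_rpow hp.ne']
  | succ t ih =>
    rw [Finset.sum_range_succ]
    have ht : (0 : ℝ) < t + 1 := by positivity
    have h1 := rpow_one_add_le_one_add_mul_self (s := -1 / ((t : ℝ) + 1))
      (by rw [le_div_iff₀ ht]; nlinarith [(Nat.cast_nonneg t : (0 : ℝ) ≤ t)]) hp.le
      (by linarith : 1 - p ≤ 1)
    have h2 : (1 : ℝ) + -1 / ((t : ℝ) + 1) = t / (t + 1) := by field_simp; ring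
    rw [h2, Real.div_rpow (Nat.cast_nonneg t) ht.le, div_le_iff₀ (by positivity)] at h1
    have h3 : ((t : ℝ) + 1) ^ (1 - p) = ((t : ℝ) + 1) * ((t : ℝ) + 1) ^ (-p) := by
      rw [sub_eq_add_neg, Real.rpow_add ht, Real.rpow_one]
    have h4 : (1 + (1 - p) * (-1 / ((t : ℝ) + 1))) * ((t : ℝ) + 1) ^ (1 - p) =
        ((t : ℝ) + 1) ^ (1 - p) - (1 - p) * ((t : ℝ) + 1) ^ (-p) := by
      rw [h3]; field_simp; ring
    rw [h4] at h1
    rw [le_div_iff₀ hp] at ih ⊢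
    push_cast
    nlinarith

end PowerSums

section Schedule

variable {a a' c : ℝ} {η : ℕ → ℝ}

lemma IsPolySchedule.nonneg (h : IsPolySchedule c a η) (hc : 0 < c) (t : ℕ) : 0 ≤ η t := by
  rcases Nat.eq_zero_or_pos t with rfl | ht
  · exact h.zero_nonneg
  · rw [h.eq_rpow t ht]; positivity

/-- Passing to a smaller exponent a' lets the case a = 1 use bounds containing 1/(1 - a'). -/
lemma IsPolySchedule.le_mul_rpow (h : IsPolySchedule c a η) (hc : 0 < c) (ha : a' ≤ a) {t : ℕ}
    (ht : 1 ≤ t) : η t ≤ c * (t : ℝ) ^ (-a') := by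
  rw [h.eq_rpow t ht]
  have : (1 : ℝ) ≤ t := by exact_mod_cast ht
  gcongr

lemma IsPolySchedule.le (h : IsPolySchedule c a η) (hc : 0 < c) (ha : 0 ≤ a) (t : ℕ) :
    η t ≤ c := by
  rcases Nat.eq_zero_or_pos t with rfl | ht
  · exact h.zero_le
  · simpa using h.le_mul_rpow hc ha ht

lemma IsPolySchedule.sum_le (h : IsPolySchedule c a η) (hc : 0 < c) (ha0 : 0 ≤ a')
    (ha1 : a' < 1) (ha : a' ≤ a) (t : ℕ) :
    ∑ s ∈ Finset.range t, η s ≤ c + c * ((t : ℝ) ^ (1 - a') / (1 - a')) := by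
  have hp : 0 < 1 - a' := by linarith
  cases t with
  | zero => simp; positivity
  | succ t =>
    rw [Finset.sum_range_succ', add_comm]
    refine add_le_add h.zero_le ?_
    calc ∑ s ∈ Finset.range t, η (s + 1)
        ≤ ∑ s ∈ Finset.range t, c * ((s : ℝ) + 1) ^ (-a') :=
          Finset.sum_le_sum fun s _ => by
            simpa using h.le_mul_rpow hc ha (Nat.le_add_left 1 s)
      _ ≤ c * ((t : ℝ) ^ (1 - a') / (1 - a')) := by
          rw [← Finset.mul_sum]
          gcongr
          exact sum_rpow_neg_le ha0 ha1 t
      _ ≤ _ := by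
          gcongr
          simp

end Schedule

section Lag

lemma mul_exp_neg_le_one (x : ℝ) : x * Real.exp (-x) ≤ 1 := by
  have h := Real.add_one_le_exp x
  have h1 : Real.exp x * Real.exp (-x) = 1 := by rw [← Real.exp_add]; simp
  nlinarith [Real.exp_pos (-x)]

lemma exp_neg_le_one_div {x : ℝ} (hx : 0 < x) : Real.exp (-x) ≤ 1 / x := by
  rw [le_div_iff₀ hx, mul_comm]
  exact mul_exp_neg_le_one x

lemma pow_le_exp_neg {β : ℝ} (hβ : 0 ≤ β) (j : ℕ) : β ^ j ≤ Real.exp (-((1 - β) * j)) := by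
  have h := Real.add_one_le_exp (-(1 - β))
  calc β ^ j ≤ Real.exp (-(1 - β)) ^ j := by gcongr; linarith
    _ = _ := by rw [← Real.exp_nat_mul]; congr 1; ring

lemma sum_exp_neg_le {q : ℝ} (hq0 : 0 < q) (hq1 : q ≤ 1) (t : ℕ) :
    ∑ s ∈ Finset.range (t + 1), Real.exp (-(q * (t - s : ℕ) / 4)) ≤ 8 / q := by
  have h := Finset.sum_range_reflect (fun s : ℕ => Real.exp (-(q * s / 4))) (t + 1)
  simp only [Nat.add_sub_cancel] at h
  rw [h]
  set r := Real.exp (-(q / 4)) with hr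
  have h1 : ∀ s : ℕ, Real.exp (-(q * s / 4)) = r ^ s := fun s => by
    rw [hr, ← Real.exp_nat_mul]; congr 1; ring
  simp only [h1]
  have hr0 : 0 < r := Real.exp_pos _
  have h2 : q / 8 ≤ 1 - r := by
    have h3 := Real.add_one_le_exp (q / 4)
    have h4 : Real.exp (q / 4) * r = 1 := by rw [hr, ← Real.exp_add]; simp
    nlinarith
  have h5 := mul_neg_geom_sum r (t + 1)
  have h6 : 0 ≤ ∑ s ∈ Finset.range (t + 1), r ^ s := Finset.sum_nonneg fun s _ => by positivity
  have h7 : 0 < r ^ (t + 1) := by positivity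
  rw [le_div_iff₀ hq0]
  nlinarith

variable {a a' c α β : ℝ} {η : ℕ → ℝ}

lemma IsPolySchedule.le_two_mul (h : IsPolySchedule c a η) (hc : 0 < c) (ha0 : 0 ≤ a)
    (ha1 : a ≤ 1) {r t : ℕ} (ht : 1 ≤ t) (hr : t ≤ 2 * r) : η r ≤ 2 * η t := by
  rw [h.eq_rpow t ht, h.eq_rpow r (by omega)]
  have ht' : (0 : ℝ) < t := by exact_mod_cast ht
  have hr' : (t : ℝ) / 2 ≤ r := by
    have : (t : ℝ) ≤ 2 * r := by exact_mod_cast hr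
    linarith
  have h1 : (r : ℝ) ^ (-a) ≤ ((t : ℝ) / 2) ^ (-a) :=
    Real.rpow_le_rpow_of_nonpos (by positivity) hr' (by linarith)
  have h2 : ((t : ℝ) / 2) ^ (-a) = (t : ℝ) ^ (-a) * 2 ^ a := by
    rw [Real.div_rpow ht'.le zero_le_two, Real.rpow_neg zero_le_two, div_inv_eq_mul]
  have h3 : (2 : ℝ) ^ a ≤ 2 := by
    simpa using Real.rpow_le_rpow_of_exponent_le (one_le_two : (1 : ℝ) ≤ 2) ha1
  have h4 : (0 : ℝ) ≤ (t : ℝ) ^ (-a) := by positivity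
  rw [h2] at h1
  calc c * (r : ℝ) ^ (-a) ≤ c * ((t : ℝ) ^ (-a) * 2) := by
        gcongr
        exact h1.trans (by gcongr)
    _ = _ := by ring

/-- Let q = 1 - β and j = t - s. For j > t/2 the largeness of t keeps the total movement small
compared with q j, so β^j absorbs the exponential and leaves exp(-q t/4) = O(η_t/q). For j ≤ t/2 the
steps in between are at most 2 η_t, and j exp(-q j/4) ≤ 4/q. A factor exp(-q j/4) survives in both
cases and makes the sum over s at most 8/q. -/
lemma IsPolySchedule.lag_term_le (h : IsPolySchedule c a η) (hc : 0 < c) (hα : 0 ≤ α)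
    (ha0 : 0 < a') (ha'1 : a' < 1) (ha : a' ≤ a) (ha1 : a ≤ 1) (hβ0 : 0 < β) (hβ1 : β < 1)
    {t : ℕ} (ht : 1 ≤ t) (hlarge : 8 * α * c / (1 - a') ≤ (1 - β) * (t : ℝ) ^ a') {s : ℕ}
    (hs : s ≤ t) :
    β ^ (t - s) * (Real.exp (α * ∑ r ∈ Finset.Ico s t, η r) - 1) ≤
      (8 * α + 4 * Real.exp (α * c) / c) * (η t / (1 - β)) *
        Real.exp (-((1 - β) * (t - s : ℕ) / 4)) := by
  set q := 1 - β with hq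
  have hq0 : 0 < q := by linarith
  have hη := h.nonneg hc
  have ht' : (0 : ℝ) < t := by exact_mod_cast ht
  have h1a : 0 < 1 - a' := by linarith
  have hpow : (t : ℝ) ^ (-a') * (t : ℝ) ^ a' = 1 := by rw [← Real.rpow_add ht']; simp
  have hneg : (0 : ℝ) < (t : ℝ) ^ (-a') := by positivity
  have hlarge' : 8 * α * c / (1 - a') * (t : ℝ) ^ (-a') ≤ q := by
    have := mul_le_mul_of_nonneg_right hlarge hneg.le
    calc _ ≤ _ := this
      _ = q * ((t : ℝ) ^ (-a') * (t : ℝ) ^ a') := by ring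
      _ = q := by rw [hpow, mul_one]
  obtain ⟨j, hj⟩ : ∃ j, t - s = j := ⟨_, rfl⟩
  rw [hj]
  have hβj : β ^ j ≤ Real.exp (-(q * j)) := pow_le_exp_neg hβ0.le j
  have hj0 : (0 : ℝ) ≤ j := Nat.cast_nonneg j
  have hC1 : 0 ≤ 8 * α * (η t / q) := mul_nonneg (by positivity) (div_nonneg (hη t) hq0.le)
  have hC2 : 0 ≤ 4 * Real.exp (α * c) / c * (η t / q) :=
    mul_nonneg (by positivity) (div_nonneg (hη t) hq0.le)
  rw [add_mul]
  rcases Nat.lt_or_ge t (2 * j) with hlt | hge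
  · have hT : α * ∑ r ∈ Finset.Ico s t, η r ≤ α * c + q * j / 4 := by
      have h1 : ∑ r ∈ Finset.Ico s t, η r ≤ ∑ r ∈ Finset.range t, η r :=
        Finset.sum_le_sum_of_subset_of_nonneg
          (fun r hr => Finset.mem_range.mpr (Finset.mem_Ico.mp hr).2) fun r _ _ => hη r
      have h2 := h1.trans (h.sum_le hc ha0.le ha'1 ha t)
      have h3 : (t : ℝ) ^ (1 - a') = t * (t : ℝ) ^ (-a') := by
        rw [sub_eq_add_neg, Real.rpow_add ht', Real.rpow_one]
      have h4 : α * (c * ((t : ℝ) ^ (1 - a') / (1 - a'))) ≤ q * t / 8 := by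
        rw [h3]
        have := mul_le_mul_of_nonneg_left hlarge' ht'.le
        calc _ = t * (8 * α * c / (1 - a') * (t : ℝ) ^ (-a')) / 8 := by field_simp
          _ ≤ _ := by linarith
      have h5 : (t : ℝ) ≤ 2 * j := by exact_mod_cast hlt.le
      have h6 := mul_le_mul_of_nonneg_left h2 hα
      nlinarith
    have h7 : Real.exp (-(q * t / 4)) ≤ 4 / (q * c) * η t := by
      refine (exp_neg_le_one_div (by positivity)).trans ?_
      rw [h.eq_rpow t ht]
      have : (t : ℝ)⁻¹ ≤ (t : ℝ) ^ (-a) := by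
        rw [← Real.rpow_neg_one]
        exact Real.rpow_le_rpow_of_exponent_le (by exact_mod_cast ht) (by linarith)
      calc 1 / (q * t / 4) = 4 / q * (t : ℝ)⁻¹ := by field_simp
        _ ≤ 4 / q * (t : ℝ) ^ (-a) := by gcongr
        _ = _ := by field_simp
    -- After the movement has taken q j/4 from the exponent, q t/4 ≤ q j/2 is set aside for the
    -- power of t and q j/4 remains for the summation.
    have h8 : β ^ j * (Real.exp (α * ∑ r ∈ Finset.Ico s t, η r) - 1) ≤
        Real.exp (α * c) * Real.exp (-(q * t / 4)) * Real.exp (-(q * j / 4)) := by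
      have h5 : (t : ℝ) ≤ 2 * j := by exact_mod_cast hlt.le
      calc _ ≤ β ^ j * Real.exp (α * ∑ r ∈ Finset.Ico s t, η r) := by
            gcongr; linarith
        _ ≤ Real.exp (-(q * j)) * Real.exp (α * c + q * j / 4) := by gcongr
        _ ≤ _ := by
            rw [← Real.exp_add, ← Real.exp_add, ← Real.exp_add]
            apply Real.exp_le_exp.mpr
            nlinarith
    have h9 : Real.exp (α * c) * Real.exp (-(q * t / 4)) * Real.exp (-(q * j / 4)) ≤
        4 * Real.exp (α * c) / c * (η t / q) * Real.exp (-(q * j / 4)) := by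
      refine mul_le_mul_of_nonneg_right ?_ (Real.exp_pos _).le
      calc _ ≤ Real.exp (α * c) * (4 / (q * c) * η t) := by gcongr
        _ = _ := by field_simp
    have h10 := mul_nonneg hC1 (Real.exp_pos (-(q * j / 4))).le
    rw [add_mul]
    linarith
  · have hsum : ∑ r ∈ Finset.Ico s t, η r ≤ j * (2 * η t) := by
      have := Finset.sum_le_card_nsmul (Finset.Ico s t) η (2 * η t) fun r hr => by
        have := (Finset.mem_Ico.mp hr).1
        exact h.le_two_mul hc (ha0.le.trans ha) ha1 ht (by omega)
      rwa [Nat.card_Ico, hj, nsmul_eq_mul] at this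
    set x := 2 * α * η t with hx
    have hx0 : 0 ≤ x := mul_nonneg (by positivity) (hη t)
    have hxq : x ≤ q / 2 := by
      have h1 := mul_le_mul_of_nonneg_left (h.le_mul_rpow hc ha ht) (by positivity : 0 ≤ 2 * α)
      have h2 : 8 * α * c * (t : ℝ) ^ (-a') ≤ 8 * α * c / (1 - a') * (t : ℝ) ^ (-a') := by
        gcongr
        rw [le_div_iff₀ h1a]
        nlinarith [mul_nonneg hα hc.le]
      have h3 : 0 ≤ α * c * (t : ℝ) ^ (-a') := by positivity
      linarith
    have hexp : Real.exp (α * ∑ r ∈ Finset.Ico s t, η r) - 1 ≤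
        (x * j) * Real.exp (q * j / 2) := by
      have h1 : α * ∑ r ∈ Finset.Ico s t, η r ≤ x * j := by
        have := mul_le_mul_of_nonneg_left hsum hα
        linarith
      calc _ ≤ Real.exp (x * j) - 1 := by gcongr
        _ ≤ (x * j) * Real.exp (x * j) := exp_sub_one_le_mul_exp _
        _ ≤ _ := by
            gcongr
            nlinarith
    have h8 : β ^ j * (Real.exp (α * ∑ r ∈ Finset.Ico s t, η r) - 1) ≤
        8 * α * (η t / q) * Real.exp (-(q * j / 4)) := by
      have h0 : 0 ≤ x * j * Real.exp (q * j / 2) := by positivity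
      calc _ ≤ β ^ j * (x * j * Real.exp (q * j / 2)) := by gcongr
        _ ≤ Real.exp (-(q * j)) * (x * j * Real.exp (q * j / 2)) := by gcongr
        _ = x * j * (Real.exp (-(q * j)) * Real.exp (q * j / 2)) := by ring
        _ = x * j * (Real.exp (-(q * j / 4)) * Real.exp (-(q * j / 4))) := by
            rw [← Real.exp_add, ← Real.exp_add]
            congr 2
            ring
        _ = 8 * α * (η t / q) * ((q * j / 4) * Real.exp (-(q * j / 4))) *
            Real.exp (-(q * j / 4)) := by rw [hx]; field_simp; ring
        _ ≤ 8 * α * (η t / q) * 1 * Real.exp (-(q * j / 4)) := by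
            gcongr
            exact mul_exp_neg_le_one _
        _ = _ := by ring
    have h10 := mul_nonneg hC2 (Real.exp_pos (-(q * j / 4))).le
    rw [add_mul]
    linarith

lemma IsPolySchedule.momLag_le (h : IsPolySchedule c a η) (hc : 0 < c) (hα : 0 ≤ α)
    (ha0 : 0 < a') (ha'1 : a' < 1) (ha : a' ≤ a) (ha1 : a ≤ 1) (hβ0 : 0 < β) (hβ1 : β < 1)
    {t : ℕ} (ht : 1 ≤ t) (hlarge : 8 * α * c / (1 - a') ≤ (1 - β) * (t : ℝ) ^ a') :
    momLag β α η t ≤ 8 * (8 * α + 4 * Real.exp (α * c) / c) * (η t / (1 - β)) := by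
  have hq0 : 0 < 1 - β := by linarith
  have hC : 0 ≤ (8 * α + 4 * Real.exp (α * c) / c) * (η t / (1 - β)) :=
    mul_nonneg (by positivity) (div_nonneg (h.nonneg hc t) hq0.le)
  have h1 := Finset.sum_le_sum fun s (hs : s ∈ Finset.range (t + 1)) =>
    h.lag_term_le hc hα ha0 ha'1 ha ha1 hβ0 hβ1 ht hlarge
      (Nat.lt_succ_iff.mp (Finset.mem_range.mp hs))
  rw [← Finset.mul_sum] at h1
  have h2 := mul_le_mul_of_nonneg_left (sum_exp_neg_le hq0 (by linarith) t) hC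
  rw [momLag]
  calc _ ≤ (1 - β) * ((8 * α + 4 * Real.exp (α * c) / c) * (η t / (1 - β)) * (8 / (1 - β))) :=
        mul_le_mul_of_nonneg_left (h1.trans h2) hq0.le
    _ = _ := by field_simp

/-- The constant in front of `ξ η_t` in the descent inequality. -/
noncomputable def descentConst (c R : ℝ) : ℝ :=
  4 * R / c + 4 * R * (8 * (8 * (2 * R) + 4 * Real.exp (2 * R * c) / c)) +
    4 * R ^ 2 * Real.exp (2 * R * c)

lemma descentConst_pos {c R : ℝ} (hc : 0 < c) (hR : 0 < R) : 0 < descentConst c R := by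
  rw [descentConst]; positivity

/-- The start-up term uses β^t ≤ 1/((1-β)t) and 1/t ≤ η_t/c, the latter because a ≤ 1; the lag
carries m/(1-β) = ξ; the second-order term needs only ξ ≥ 1. -/
lemma IsPolySchedule.perturbation_le (h : IsPolySchedule c a η) (hc : 0 < c) {R : ℝ}
    (hR : 0 < R) (ha0 : 0 < a') (ha'1 : a' < 1) (ha : a' ≤ a) (ha1 : a ≤ 1) (hβ0 : 0 < β)
    (hβ1 : β < 1) {m : ℕ} (hm : 1 ≤ m) {t : ℕ} (ht : 1 ≤ t)
    (hlarge : 8 * (2 * R) * c / (1 - a') ≤ (1 - β) * (t : ℝ) ^ a') :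
    4 * R * β ^ (t + 1) + 4 * R * m * momLag β (2 * R) η t +
      4 * R ^ 2 * Real.exp (2 * R * η t) * η t ≤ descentConst c R * momScale m β * η t := by
  have hq0 : 0 < 1 - β := by linarith
  have hm' : (1 : ℝ) ≤ m := by exact_mod_cast hm
  have ht' : (0 : ℝ) < t := by exact_mod_cast ht
  have hη := h.nonneg hc t
  have hq1 : 1 / (1 - β) ≤ momScale m β := by rw [momScale]; gcongr
  have hξ1 : 1 ≤ momScale m β := by
    refine le_trans ?_ hq1
    rw [le_div_iff₀ hq0]; linarith
  have h1 : β ^ (t + 1) ≤ momScale m β * η t / c := by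
    have h2 : β ^ (t + 1) ≤ 1 / ((1 - β) * t) := by
      calc β ^ (t + 1) ≤ β ^ t := pow_le_pow_of_le_one hβ0.le hβ1.le (Nat.le_succ t)
        _ ≤ _ := (pow_le_exp_neg hβ0.le t).trans (exp_neg_le_one_div (by positivity))
    have h3 : (t : ℝ)⁻¹ ≤ (t : ℝ) ^ (-a) := by
      rw [← Real.rpow_neg_one]
      exact Real.rpow_le_rpow_of_exponent_le (by exact_mod_cast ht) (by linarith)
    calc _ ≤ _ := h2
      _ = 1 / (1 - β) * (t : ℝ)⁻¹ := by field_simp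
      _ ≤ momScale m β * (t : ℝ) ^ (-a) := by gcongr
      _ = _ := by rw [h.eq_rpow t ht]; field_simp
  have h4 := h.momLag_le hc (by positivity : 0 ≤ 2 * R) ha0 ha'1 ha ha1 hβ0 hβ1 ht hlarge
  have h5 : Real.exp (2 * R * η t) ≤ Real.exp (2 * R * c) := by
    gcongr
    exact h.le hc (ha0.le.trans ha) t
  have h6 : 4 * R * β ^ (t + 1) ≤ 4 * R * (momScale m β * η t / c) := by gcongr
  have h7 : 4 * R * m * momLag β (2 * R) η t ≤
      4 * R * (8 * (8 * (2 * R) + 4 * Real.exp (2 * R * c) / c)) * (momScale m β * η t) := by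
    calc _ ≤ 4 * R * m * (8 * (8 * (2 * R) + 4 * Real.exp (2 * R * c) / c) * (η t / (1 - β))) := by
          gcongr
      _ = _ := by rw [momScale]; field_simp
  have h8 : 4 * R ^ 2 * Real.exp (2 * R * η t) * η t ≤
      4 * R ^ 2 * Real.exp (2 * R * c) * (momScale m β * η t) := by
    have : η t ≤ momScale m β * η t := by nlinarith
    gcongr
  rw [descentConst]
  refine (add_le_add (add_le_add h6 h7) h8).trans (le_of_eq ?_)
  ring

end Lag

/-! ### The scalar recursion for the loss -/

section Descent

variable {L G η : ℕ → ℝ} {ν ρ ρ₀ K : ℝ} {t₀ : ℕ}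

/-- As long as `G` stays above a threshold, the accumulated step size is controlled by the loss. -/
lemma sum_step_le_of_lt (hη : ∀ t, 0 ≤ η t) (hν : 0 < ν) (hρ₀ : 0 < ρ₀) (hρ : ρ₀ ≤ ρ)
    (hsmall : ∀ t, t₀ ≤ t → K * η t ≤ ρ₀ / 4)
    (hdesc : ∀ t, t₀ ≤ t → L (t + 1) ≤ L t - η t * (ρ - K * η t) * G t) {t : ℕ}
    (ht : t₀ ≤ t) (hG : ∀ s, t₀ ≤ s → s < t → 1 / (4 * ν) < G s) :
    ρ₀ / (8 * ν) * ∑ s ∈ Finset.Ico t₀ t, η s ≤ L t₀ - L t := by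
  induction t, ht using Nat.le_induction with
  | base => simp
  | succ t ht ih =>
    have h1 := ih fun s hs hst => hG s hs (by omega)
    have h2 := hdesc t ht
    have h3 := hG t ht (Nat.lt_succ_self t)
    have h4 : ρ₀ / 2 ≤ ρ - K * η t := by linarith [hsmall t ht]
    have h5 : ρ₀ / (8 * ν) * η t ≤ η t * (ρ - K * η t) * G t := by
      calc ρ₀ / (8 * ν) * η t = η t * (ρ₀ / 2) * (1 / (4 * ν)) := by field_simp; ring
        _ ≤ _ := by
            have := hη t
            have : 0 ≤ ρ - K * η t := by linarith
            gcongr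
    rw [Finset.sum_Ico_succ_top ht, mul_add]
    linarith

/-- If G stayed above 1/(4ν), the loss would fall by ρ₀/(8ν) per unit of step size and become
nonpositive within the given budget. Choosing the first small time keeps the steps spent before it
within the same budget. -/
lemma exists_small (hη : ∀ t, 0 ≤ η t) (hL : ∀ t, 0 < L t) (hν : 0 < ν) (hρ₀ : 0 < ρ₀)
    (hρ : ρ₀ ≤ ρ) (hsmall : ∀ t, t₀ ≤ t → K * η t ≤ ρ₀ / 4)
    (hdesc : ∀ t, t₀ ≤ t → L (t + 1) ≤ L t - η t * (ρ - K * η t) * G t) {B : ℝ}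
    (hB : L t₀ ≤ B) {t₂ : ℕ} (ht₂ : t₀ ≤ t₂) (hsum : 8 * ν * B / ρ₀ ≤ ∑ s ∈ Finset.Ico t₀ t₂, η s) :
    ∃ t₁, t₀ ≤ t₁ ∧ t₁ ≤ t₂ ∧ G t₁ ≤ 1 / (4 * ν) ∧
      ∑ s ∈ Finset.Ico t₀ t₁, η s ≤ 8 * ν * B / ρ₀ := by
  classical
  have hbound : ∀ t, t₀ ≤ t → (∀ s, t₀ ≤ s → s < t → 1 / (4 * ν) < G s) →
      ∑ s ∈ Finset.Ico t₀ t, η s < 8 * ν * B / ρ₀ := by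
    intro t ht hG
    have h1 := sum_step_le_of_lt hη hν hρ₀ hρ hsmall hdesc ht hG
    have h2 := hL t
    rw [lt_div_iff₀ hρ₀]
    have h3 : ρ₀ / (8 * ν) * ∑ s ∈ Finset.Ico t₀ t, η s < B := by linarith
    rw [div_mul_eq_mul_div, div_lt_iff₀ (by positivity)] at h3
    linarith
  have hex : ∃ t, t₀ ≤ t ∧ t < t₂ ∧ G t ≤ 1 / (4 * ν) := by
    by_contra! hcon
    exact absurd hsum (not_le.mpr (hbound t₂ ht₂ fun s hs hst => hcon s hs hst))
  obtain ⟨h1, h2, h3⟩ := Nat.find_spec hex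
  refine ⟨Nat.find hex, h1, h2.le, h3, (hbound _ h1 fun s hs hst => ?_).le⟩
  by_contra! hcon
  exact Nat.find_min hex hst ⟨hs, hst.trans h2, hcon⟩

/-- Once the loss is small, it decays exponentially in the accumulated step size. -/
lemma loss_exp_decay (hη : ∀ t, 0 ≤ η t) (hL : ∀ t, 0 < L t) (hν : 0 < ν)
    (hρ₀ : 0 < ρ₀) (hρ : ρ₀ ≤ ρ) (hK : 0 ≤ K) {t₁ : ℕ}
    (hsmall : ∀ t, t₁ ≤ t → K * η t ≤ ρ₀ / 4)
    (hdesc : ∀ t, t₁ ≤ t → L (t + 1) ≤ L t - η t * (ρ - K * η t) * G t)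
    (hGL : ∀ t, G t ≤ L t) (hLG : ∀ t, L t - ν * L t ^ 2 / 2 ≤ G t)
    (h₁ : ν * L t₁ ≤ 1 / 2) {t : ℕ} (ht : t₁ ≤ t) :
    L t ≤ L t₁ ∧ ρ / 4 * ∑ s ∈ Finset.Ico t₁ t, η s * L s ≤ L t₁ - L t ∧
      L t ≤ L t₁ * Real.exp (-(ρ * ∑ s ∈ Finset.Ico t₁ t, η s) +
        ρ * ν / 2 * ∑ s ∈ Finset.Ico t₁ t, η s * L s +
        K * ∑ s ∈ Finset.Ico t₁ t, η s ^ 2) := by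
  induction t, ht using Nat.le_induction with
  | base => simp
  | succ t ht ih =>
    obtain ⟨ih1, ih2, ih3⟩ := ih
    have hLt := hL t
    have hηt := hη t
    have hd := hdesc t ht
    have hs := hsmall t ht
    have hg := hLG t
    -- This makes G ≥ 3L/4, and the step condition makes ρ - K η_t ≥ 3ρ/4; their product leaves more
    -- than the rate ρ/4 used for the crude decrease.
    have hνL : ν * L t ≤ 1 / 2 := (mul_le_mul_of_nonneg_left ih1 hν.le).trans h₁
    have hG : 3 / 4 * L t ≤ G t := by nlinarith
    have hstep : ρ / 4 * (η t * L t) ≤ η t * (ρ - K * η t) * G t := by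
      calc ρ / 4 * (η t * L t) = η t * (3 / 4 * ρ) * (1 / 3 * L t) := by ring
        _ ≤ η t * (ρ - K * η t) * G t := by
            have : 0 < ρ := by linarith
            gcongr
            · exact mul_nonneg hηt (by linarith)
            · linarith
            · linarith
    have hprod : 0 ≤ ρ / 4 * (η t * L t) := by
      have : 0 < ρ := by linarith
      positivity
    refine ⟨by linarith, ?_, ?_⟩
    · rw [Finset.sum_Ico_succ_top ht, mul_add]
      linarith
    -- Here G ≥ L - νL²/2 is used in the main term and G ≤ L in the K term, so the leading
    -- coefficient remains ρ; then 1 + w ≤ exp w.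
    · set w := -(ρ * η t) + ρ * ν / 2 * (η t * L t) + K * η t ^ 2 with hw
      have h2 : L (t + 1) ≤ L t * Real.exp w := by
        have h3 : L (t + 1) ≤ L t * (1 + w) := by
          have h4 : ρ * η t * (L t - ν * L t ^ 2 / 2) ≤ ρ * η t * G t := by
            have : 0 < ρ := by linarith
            gcongr
          have h5 : K * η t ^ 2 * G t ≤ K * η t ^ 2 * L t := by
            gcongr
            exact hGL t
          rw [hw]
          linarith
        refine h3.trans (mul_le_mul_of_nonneg_left ?_ hLt.le)
        linarith [Real.add_one_le_exp w]
      refine h2.trans ((mul_le_mul_of_nonneg_right ih3 (Real.exp_pos w).le).trans (le_of_eq ?_))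
      rw [mul_assoc, ← Real.exp_add, Finset.sum_Ico_succ_top ht, Finset.sum_Ico_succ_top ht,
        Finset.sum_Ico_succ_top ht, hw]
      congr 2
      ring

/-- The crude decrease makes the correction (ρν/2) ∑ η L at most 2ν L(t₁) ≤ 1. The same bound 2ν
L(t₁) ≤ 1 removes the prefactor of the exponential. -/
lemma le_neg_log_of_decay (hη : ∀ t, 0 ≤ η t) (hL : ∀ t, 0 < L t) (hν : 0 < ν)
    (hρ₀ : 0 < ρ₀) (hρ : ρ₀ ≤ ρ) (hK : 0 ≤ K) {t₁ : ℕ}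
    (hsmall : ∀ t, t₁ ≤ t → K * η t ≤ ρ₀ / 4)
    (hdesc : ∀ t, t₁ ≤ t → L (t + 1) ≤ L t - η t * (ρ - K * η t) * G t)
    (hGL : ∀ t, G t ≤ L t) (hLG : ∀ t, L t - ν * L t ^ 2 / 2 ≤ G t)
    (h₁ : ν * L t₁ ≤ 1 / 2) {t : ℕ} (ht : t₁ ≤ t) :
    ν * L t ≤ 1 ∧ ρ * ∑ s ∈ Finset.Ico t₁ t, η s - 1 - K * ∑ s ∈ Finset.range t, η s ^ 2 ≤
      -Real.log (2 * (ν * L t)) := by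
  obtain ⟨h2, h3, h4⟩ := loss_exp_decay hη hL hν hρ₀ hρ hK hsmall hdesc hGL hLG h₁ ht
  have hρ' : 0 < ρ := by linarith
  have hLt := hL t
  refine ⟨by nlinarith, ?_⟩
  have h5 : ρ * ν / 2 * ∑ s ∈ Finset.Ico t₁ t, η s * L s ≤ 1 := by
    have h6 : ρ / 4 * ∑ s ∈ Finset.Ico t₁ t, η s * L s ≤ L t₁ := by linarith
    have := mul_le_mul_of_nonneg_left h6 (by positivity : 0 ≤ 2 * ν)
    linarith
  have h7 : ∑ s ∈ Finset.Ico t₁ t, η s ^ 2 ≤ ∑ s ∈ Finset.range t, η s ^ 2 :=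
    Finset.sum_le_sum_of_subset_of_nonneg
      (fun r hr => Finset.mem_range.mpr (Finset.mem_Ico.mp hr).2) fun r _ _ => sq_nonneg _
  have h8 := mul_le_mul_of_nonneg_left h7 hK
  have h9 : 2 * (ν * L t) ≤ Real.exp (-(ρ * ∑ s ∈ Finset.Ico t₁ t, η s - 1 -
      K * ∑ s ∈ Finset.range t, η s ^ 2)) := by
    calc 2 * (ν * L t) ≤ 2 * (ν * (L t₁ * Real.exp (-(ρ * ∑ s ∈ Finset.Ico t₁ t, η s) +
        ρ * ν / 2 * ∑ s ∈ Finset.Ico t₁ t, η s * L s +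
        K * ∑ s ∈ Finset.Ico t₁ t, η s ^ 2))) := by gcongr
      _ = (2 * (ν * L t₁)) * Real.exp (-(ρ * ∑ s ∈ Finset.Ico t₁ t, η s) +
        ρ * ν / 2 * ∑ s ∈ Finset.Ico t₁ t, η s * L s +
        K * ∑ s ∈ Finset.Ico t₁ t, η s ^ 2) := by ring
      _ ≤ 1 * Real.exp (-(ρ * ∑ s ∈ Finset.Ico t₁ t, η s) +
        ρ * ν / 2 * ∑ s ∈ Finset.Ico t₁ t, η s * L s +
        K * ∑ s ∈ Finset.Ico t₁ t, η s ^ 2) := by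
          gcongr
          linarith
      _ ≤ _ := by
          rw [one_mul]
          apply Real.exp_le_exp.mpr
          linarith
  have h10 := Real.log_le_log (by positivity) h9
  rw [Real.log_exp] at h10
  linarith

end Descent

lemma avgMissProb_le_loss {n k d : ℕ} {X : Fin n → Fin d → ℝ} {y : Fin n → Fin k}
    (W : Matrix (Fin k) (Fin d) ℝ) : avgMissProb X y W ≤ loss X y W := by
  rw [avgMissProb, loss]
  gcongr with i
  rw [missProb_eq]
  linarith [Real.add_one_le_exp (-sampleLoss X y i W)]

/-! ### Growth of the step-size sums -/

section ScheduleSums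

variable {a c : ℝ} {η : ℕ → ℝ}

/-- Squared steps form a schedule of the same kind with exponent 2a, so bounds on step sums also
give the bounds on sums of squares. -/
lemma IsPolySchedule.sq (h : IsPolySchedule c a η) :
    IsPolySchedule (c ^ 2) (2 * a) (fun t => η t ^ 2) := by
  refine ⟨sq_nonneg _, pow_le_pow_left₀ h.zero_nonneg h.zero_le 2, fun t ht => ?_⟩
  have ht' : (0 : ℝ) < t := by exact_mod_cast ht
  rw [h.eq_rpow t ht, mul_pow, ← Real.rpow_natCast ((t : ℝ) ^ (-a)), ← Real.rpow_mul ht'.le]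
  congr 2
  push_cast; ring

lemma harmonic_cast_eq_sum (t : ℕ) :
    ((harmonic t : ℚ) : ℝ) = ∑ s ∈ Finset.range t, ((s : ℝ) + 1)⁻¹ := by
  simp [harmonic]

lemma IsPolySchedule.sum_le_log (h : IsPolySchedule c 1 η) (hc : 0 < c) {t : ℕ} (ht : 1 ≤ t) :
    ∑ s ∈ Finset.range t, η s ≤ c * (2 + Real.log t) := by
  obtain ⟨t, rfl⟩ := Nat.exists_eq_add_of_le' ht
  have h1 := harmonic_le_one_add_log t
  rw [harmonic_cast_eq_sum] at h1
  have h2 : Real.log t ≤ Real.log ((t + 1 : ℕ) : ℝ) := by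
    rcases Nat.eq_zero_or_pos t with rfl | ht0
    · simp
    · exact Real.log_le_log (by exact_mod_cast ht0) (by push_cast; linarith)
  have h3 : ∑ s ∈ Finset.range t, η (s + 1) = c * ∑ s ∈ Finset.range t, ((s : ℝ) + 1)⁻¹ := by
    rw [Finset.mul_sum]
    refine Finset.sum_congr rfl fun s _ => ?_
    rw [h.eq_rpow _ (Nat.le_add_left 1 s), Real.rpow_neg_one]
    push_cast; rfl
  rw [Finset.sum_range_succ', h3]
  have h4 := h.zero_le
  nlinarith

lemma IsPolySchedule.log_le_sum (h : IsPolySchedule c a η) (hc : 0 < c) (ha : a ≤ 1) {t : ℕ}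
    (ht : 1 ≤ t) : c * Real.log t ≤ ∑ s ∈ Finset.range t, η s := by
  obtain ⟨t, rfl⟩ := Nat.exists_eq_add_of_le' ht
  have h1 := log_add_one_le_harmonic t
  rw [harmonic_cast_eq_sum] at h1
  rw [Finset.sum_range_succ']
  have h2 : c * ∑ s ∈ Finset.range t, ((s : ℝ) + 1)⁻¹ ≤ ∑ s ∈ Finset.range t, η (s + 1) := by
    rw [Finset.mul_sum]
    refine Finset.sum_le_sum fun s _ => ?_
    rw [h.eq_rpow _ (Nat.le_add_left 1 s), ← Real.rpow_neg_one]
    push_cast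
    gcongr
    linarith [(Nat.cast_nonneg s : (0 : ℝ) ≤ s)]
  have h3 := h.zero_nonneg
  nlinarith

/-- All steps of index 1, …, t - 1 are at least c t^(-a), and t - 1 ≥ t/2 from t = 2 on. -/
lemma IsPolySchedule.rpow_le_sum (h : IsPolySchedule c a η) (hc : 0 < c) (ha : 0 ≤ a) {t : ℕ}
    (ht : 2 ≤ t) : c / 2 * (t : ℝ) ^ (1 - a) ≤ ∑ s ∈ Finset.range t, η s := by
  obtain ⟨t, rfl⟩ := Nat.exists_eq_add_of_le' (by omega : 1 ≤ t)
  have ht' : (0 : ℝ) < ((t + 1 : ℕ) : ℝ) := by positivity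
  have h1 : (1 : ℝ) ≤ t := by exact_mod_cast (by omega : 1 ≤ t)
  rw [Finset.sum_range_succ', sub_eq_add_neg, Real.rpow_add ht', Real.rpow_one]
  have h2 : ∑ s ∈ Finset.range t, c * ((t + 1 : ℕ) : ℝ) ^ (-a) ≤
      ∑ s ∈ Finset.range t, η (s + 1) := by
    refine Finset.sum_le_sum fun s hs => ?_
    rw [h.eq_rpow _ (Nat.le_add_left 1 s)]
    refine mul_le_mul_of_nonneg_left (Real.rpow_le_rpow_of_nonpos (by positivity) ?_
      (by linarith)) hc.le
    exact_mod_cast Nat.succ_le_succ (Finset.mem_range.mp hs).le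
  rw [Finset.sum_const, Finset.card_range, nsmul_eq_mul] at h2
  have h3 := h.zero_nonneg
  have h4 : 0 ≤ c * ((t + 1 : ℕ) : ℝ) ^ (-a) := by positivity
  have h5 : ((t + 1 : ℕ) : ℝ) / 2 ≤ t := by push_cast; linarith
  have h6 := mul_le_mul_of_nonneg_right h5 h4
  linarith

lemma IsPolySchedule.sum_le_const (h : IsPolySchedule c a η) (hc : 0 < c) (ha : 1 < a) (t : ℕ) :
    ∑ s ∈ Finset.range t, η s ≤ c * (1 + ∑' s : ℕ, ((s : ℝ) + 1) ^ (-a)) := by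
  have hsum : Summable fun s : ℕ => ((s : ℝ) + 1) ^ (-a) := by
    have := (summable_nat_add_iff 1).mpr (Real.summable_nat_rpow.mpr (by linarith : -a < -1))
    simpa using this
  have hnn : ∀ s : ℕ, 0 ≤ ((s : ℝ) + 1) ^ (-a) := fun s => by positivity
  cases t with
  | zero =>
    have : 0 ≤ ∑' s : ℕ, ((s : ℝ) + 1) ^ (-a) := tsum_nonneg hnn
    simp; positivity
  | succ t =>
    have h1 := hsum.sum_le_tsum (Finset.range t) fun s _ => hnn s
    have h3 : ∑ s ∈ Finset.range t, η (s + 1) = c * ∑ s ∈ Finset.range t, ((s : ℝ) + 1) ^ (-a) := by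
      rw [Finset.mul_sum]
      refine Finset.sum_congr rfl fun s _ => ?_
      rw [h.eq_rpow _ (Nat.le_add_left 1 s)]
      push_cast; rfl
    rw [Finset.sum_range_succ', h3]
    have h4 := h.zero_le
    nlinarith

end ScheduleSums

/-! ### Margin growth after the burn-in -/

/-- The standing assumptions on data, step sizes, batches and initialization. -/
structure IsAdmissibleRun (a c R ρ₀ B₀ Λ₀ : ℝ) {n k d : ℕ} (m b : ℕ) (β : ℝ) (κ : NormKind)
    (p : ℝ≥0∞) (X : Fin n → Fin d → ℝ) (y : Fin n → Fin k) (η : ℕ → ℝ) (S : ℕ → Finset (Fin n))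
    (W M Δ : ℕ → Matrix (Fin k) (Fin d) ℝ) : Prop where
  one_le_p : 1 ≤ p
  two_le_classes : 2 ≤ k
  norm_le : ∀ i, ∑ j, |X i j| ≤ R
  le_effMargin : ρ₀ ≤ effMargin κ p X y m β R
  schedule : IsPolySchedule c a η
  reshuffling : IsReshuffling m b S
  run : IsMomentumRun κ p X y β η S W M Δ
  init_norm_le : matNorm κ p (W 0) ≤ B₀
  init_loss_le : loss X y (W 0) ≤ Λ₀

/-- A threshold for `t ^ a' / ξ` beyond which the descent inequality is effective. -/
noncomputable def burnInConst (a' c R ρ₀ : ℝ) : ℝ :=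
  8 * (2 * R) * c / (1 - a') + 4 * descentConst c R * c / ρ₀

/-- The part of the margin deficit accumulated before the loss is small. -/
noncomputable def burnInDeficit (R ρ₀ Λ ν T : ℝ) : ℝ :=
  2 * R * (T + 8 * ν * (Λ + 2 * R * T) / ρ₀) + 1

section Main

variable {a a' c R ρ₀ B₀ Λ₀ β : ℝ} {n k d m b : ℕ} {κ : NormKind} {p : ℝ≥0∞}
  {X : Fin n → Fin d → ℝ} {y : Fin n → Fin k} {η : ℕ → ℝ} {S : ℕ → Finset (Fin n)}
  {W M Δ : ℕ → Matrix (Fin k) (Fin d) ℝ}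

lemma burnInConst_pos (hc : 0 < c) (hR : 0 < R) (hρ₀ : 0 < ρ₀) (ha'1 : a' < 1) :
    0 < burnInConst a' c R ρ₀ := by
  have := descentConst_pos hc hR
  have : 0 < 1 - a' := by linarith
  rw [burnInConst]; positivity

lemma one_le_momScale (hβ0 : 0 < β) (hβ1 : β < 1) (hm : 1 ≤ m) : 1 ≤ momScale m β := by
  have hm' : (1 : ℝ) ≤ m := by exact_mod_cast hm
  rw [momScale, le_div_iff₀ (by linarith)]
  linarith

/-- The two summands of `burnInConst` serve the two conclusions: the first makes the lag estimate
applicable, the second makes the perturbation at most a quarter of ρ₀. -/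
lemma burnIn_spec (hc : 0 < c) (hR : 0 < R) (hρ₀ : 0 < ρ₀) (ha0 : 0 < a') (ha'1 : a' < 1)
    (ha : a' ≤ a) (hβ1 : β < 1) (hm : 1 ≤ m) (hη : IsPolySchedule c a η)
    {t₀ : ℕ} (ht₀ : 1 ≤ t₀) (hlarge : burnInConst a' c R ρ₀ * momScale m β ≤ (t₀ : ℝ) ^ a')
    {t : ℕ} (ht : t₀ ≤ t) :
    8 * (2 * R) * c / (1 - a') ≤ (1 - β) * (t : ℝ) ^ a' ∧
      descentConst c R * momScale m β * η t ≤ ρ₀ / 4 := by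
  have hD := descentConst_pos hc hR
  have h1a : 0 < 1 - a' := by linarith
  have hq : 0 < 1 - β := by linarith
  have hm' : (1 : ℝ) ≤ m := by exact_mod_cast hm
  have ht1 : 1 ≤ t := ht₀.trans ht
  have htpos : (0 : ℝ) < t := by exact_mod_cast ht1
  have hξ : 0 < momScale m β := by rw [momScale]; positivity
  have hmono : (t₀ : ℝ) ^ a' ≤ (t : ℝ) ^ a' := by gcongr
  have hl := hlarge.trans hmono
  have hA : 0 ≤ 8 * (2 * R) * c / (1 - a') := by positivity
  have hB : 0 ≤ 4 * descentConst c R * c / ρ₀ := by positivity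
  rw [burnInConst, add_mul] at hl
  constructor
  · have h1 : 8 * (2 * R) * c / (1 - a') * momScale m β ≤ (t : ℝ) ^ a' := by
      have := mul_nonneg hB hξ.le
      linarith
    have h2 : 1 ≤ (1 - β) * momScale m β := by
      rw [momScale, mul_div_cancel₀ _ hq.ne']; exact hm'
    calc _ ≤ 8 * (2 * R) * c / (1 - a') * ((1 - β) * momScale m β) := le_mul_of_one_le_right hA h2
      _ = (1 - β) * (8 * (2 * R) * c / (1 - a') * momScale m β) := by ring
      _ ≤ _ := by gcongr
  · have h1 : 4 * descentConst c R * c / ρ₀ * momScale m β ≤ (t : ℝ) ^ a' := by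
      have := mul_nonneg hA hξ.le
      linarith
    have h2 : (t : ℝ) ^ (-a') * (t : ℝ) ^ a' = 1 := by rw [← Real.rpow_add htpos]; simp
    have h3 := mul_le_mul_of_nonneg_left h1 (by positivity : (0 : ℝ) ≤ (t : ℝ) ^ (-a'))
    rw [h2] at h3
    have h4 := hη.le_mul_rpow hc ha ht1
    calc descentConst c R * momScale m β * η t
        ≤ descentConst c R * momScale m β * (c * (t : ℝ) ^ (-a')) := by gcongr
      _ = ρ₀ / 4 * ((t : ℝ) ^ (-a') * (4 * descentConst c R * c / ρ₀ * momScale m β)) := by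
          field_simp
      _ ≤ ρ₀ / 4 * 1 := by gcongr
      _ = _ := mul_one _

lemma IsAdmissibleRun.loss_le_sum (h : IsAdmissibleRun a c R ρ₀ B₀ Λ₀ m b β κ p X y η S W M Δ)
    (hc : 0 < c) (hn : 0 < n) (t : ℕ) :
    loss X y (W t) ≤ Λ₀ + 2 * R * ∑ s ∈ Finset.range t, η s := by
  induction t with
  | zero => simpa using h.init_loss_le
  | succ t ih =>
    have := h.run.loss_succ_le_add h.one_le_p (h.schedule.nonneg hc) hn h.norm_le t
    rw [Finset.sum_range_succ]
    linarith

lemma IsAdmissibleRun.effMargin_le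
    (h : IsAdmissibleRun a c R ρ₀ B₀ Λ₀ m b β κ p X y η S W M Δ) (hn : 0 < n) (hm : 1 ≤ m)
    (hβ1 : β < 1) (hR : 0 ≤ R) : effMargin κ p X y m β R ≤ 2 * R := by
  have h1 := maxMargin_le (κ := κ) (y := y) h.one_le_p h.two_le_classes ⟨0, hn⟩ h.norm_le
  have hm' : (1 : ℝ) ≤ m := by exact_mod_cast hm
  have h2 : 0 ≤ 2 * (1 - β) * m * ((m : ℝ) ^ 2 - 1) * R := by
    have : 0 ≤ (m : ℝ) ^ 2 - 1 := by nlinarith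
    have : 0 ≤ 1 - β := by linarith
    positivity
  rw [effMargin]
  linarith

/-- The margin grows at least like `ρ` times the accumulated step size. -/
lemma IsAdmissibleRun.le_margin (h : IsAdmissibleRun a c R ρ₀ B₀ Λ₀ m b β κ p X y η S W M Δ)
    (hc : 0 < c) (hR : 0 < R) (hρ₀ : 0 < ρ₀) (ha0 : 0 < a') (ha'1 : a' < 1) (ha : a' ≤ a)
    (ha1 : a ≤ 1) (hn : 0 < n) (hnm : n = m * b) (hβ0 : 0 < β) (hβ1 : β < 1)
    {t₀ : ℕ} (ht₀ : 1 ≤ t₀) (hlarge : burnInConst a' c R ρ₀ * momScale m β ≤ (t₀ : ℝ) ^ a')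
    {T : ℝ} (hT : ∑ s ∈ Finset.range t₀, η s ≤ T) {t : ℕ} (ht : t₀ ≤ t)
    (hsum : T + 8 * n * (Λ₀ + 2 * R * T) / ρ₀ ≤ ∑ s ∈ Finset.range t, η s) :
    effMargin κ p X y m β R * ∑ s ∈ Finset.range t, η s - burnInDeficit R ρ₀ Λ₀ n T -
      descentConst c R * momScale m β * ∑ s ∈ Finset.range t, η s ^ 2 ≤ margin X y (W t) := by
  have hm : 1 ≤ m := Nat.pos_of_ne_zero fun h0 => by simp [h0] at hnm; omega
  have hn' : (0 : ℝ) < n := by exact_mod_cast hn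
  have hη := h.schedule.nonneg hc
  have hk := h.two_le_classes
  have hspec := fun t (ht : t₀ ≤ t) =>
    burnIn_spec hc hR hρ₀ ha0 ha'1 ha hβ1 hm h.schedule ht₀ hlarge ht
  set ρ := effMargin κ p X y m β R with hρ
  set K := descentConst c R * momScale m β with hK
  have hK0 : 0 ≤ K :=
    mul_nonneg (descentConst_pos hc hR).le (zero_le_one.trans (one_le_momScale hβ0 hβ1 hm))
  set L : ℕ → ℝ := fun t => loss X y (W t) with hLdef
  set G : ℕ → ℝ := fun t => avgMissProb X y (W t) with hGdef
  have hL : ∀ t, 0 < L t := fun t => loss_pos hk hn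
  have hdesc : ∀ t, t₀ ≤ t → L (t + 1) ≤ L t - η t * (ρ - K * η t) * G t := by
    intro t ht
    have h1 := h.run.loss_succ_le h.one_le_p hk hη hn hnm hβ0 hβ1 h.reshuffling h.norm_le t
    have h2 := h.schedule.perturbation_le hc hR ha0 ha'1 ha ha1 hβ0 hβ1 hm (ht₀.trans ht)
      (hspec t ht).1
    have h3 : 0 < G t := avgMissProb_pos hk hn
    have h4 := mul_le_mul_of_nonneg_right (mul_le_mul_of_nonneg_left h2 (hη t)) h3.le
    linarith
  have hρρ : ρ₀ ≤ ρ := h.le_effMargin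
  have hLt₀ : L t₀ ≤ Λ₀ + 2 * R * T := by
    have h1 := h.loss_le_sum hc hn t₀
    have h2 := mul_le_mul_of_nonneg_left hT (by positivity : 0 ≤ 2 * R)
    linarith
  have hsplit : ∀ t, t₀ ≤ t → ∑ s ∈ Finset.range t₀, η s + ∑ s ∈ Finset.Ico t₀ t, η s =
      ∑ s ∈ Finset.range t, η s := fun t ht => Finset.sum_range_add_sum_Ico _ ht
  obtain ⟨t₁, h01, h1t, hG1, hT1⟩ := exists_small hη hL hn' hρ₀ hρρ (fun t ht => (hspec t ht).2)
    hdesc hLt₀ ht (by linarith [hsplit t ht])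
  have hnG : n * G t₁ ≤ 1 / 4 := by
    have := mul_le_mul_of_nonneg_left hG1 hn'.le
    have h5 : (n : ℝ) * (1 / (4 * n)) = 1 / 4 := by field_simp
    linarith
  have hnL : n * L t₁ ≤ 1 / 2 := by
    have h5 : L t₁ ≤ 2 * G t₁ := loss_le_two_mul_avgMissProb hn (hnG.trans (by norm_num))
    have := mul_le_mul_of_nonneg_left h5 hn'.le
    linarith
  obtain ⟨h6, h7⟩ := le_neg_log_of_decay (G := G) hη hL hn' hρ₀ hρρ hK0
    (fun t ht => (hspec t (h01.trans ht)).2) (fun t ht => hdesc t (h01.trans ht))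
    (fun t => avgMissProb_le_loss (W t)) (fun t => loss_sub_le_avgMissProb hk hn) hnL h1t
  have h8 := neg_log_le_margin (X := X) (y := y) (W := W t) hk hn h6
  have h9 : ∑ s ∈ Finset.range t₁, η s + ∑ s ∈ Finset.Ico t₁ t, η s =
      ∑ s ∈ Finset.range t, η s := Finset.sum_range_add_sum_Ico _ h1t
  have h10 := hsplit t₁ h01
  -- Steps taken before t₁ earn no guaranteed margin; this bound turns them into the deficit.
  have h11 : ρ ≤ 2 * R := h.effMargin_le hn hm hβ1 hR.le
  have h12 : ρ * ∑ s ∈ Finset.range t₁, η s ≤ 2 * R * (T + 8 * n * (Λ₀ + 2 * R * T) / ρ₀) := by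
    have h13 : 0 ≤ ∑ s ∈ Finset.range t₁, η s := Finset.sum_nonneg fun s _ => hη s
    calc _ ≤ 2 * R * ∑ s ∈ Finset.range t₁, η s := by gcongr
      _ ≤ _ := by gcongr; linarith
  rw [burnInDeficit, ← h9]
  linarith

/-- The upper bound on the norm controls ρ‖W‖ - mar(W). The denominator is bounded below through
mar(W) ≤ 2R‖W‖, so a large margin itself forces a large norm. -/
lemma marginGap_le_of_le_margin (hp : 1 ≤ p) (hk : 2 ≤ k) (i₀ : Fin n) (hR : 0 < R)
    (hx : ∀ i, ∑ j, |X i j| ≤ R) {W : Matrix (Fin k) (Fin d) ℝ} {T E : ℝ} (hρ₀ : 0 < ρ₀)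
    (hρ : ρ₀ ≤ effMargin κ p X y m β R) (hρR : effMargin κ p X y m β R ≤ 2 * R) (hT : 0 < T)
    (hW : matNorm κ p W ≤ B₀ + T) (hE : 0 ≤ E)
    (h1 : effMargin κ p X y m β R * T - E ≤ margin X y W) (h2 : ρ₀ / 2 * T ≤ margin X y W) :
    W ≠ 0 ∧ marginGap κ p X y m β R W ≤ (2 * R * |B₀| + E) / (ρ₀ * T / (4 * R)) := by
  have hmar : 0 < margin X y W := lt_of_lt_of_le (by positivity) h2
  have hW0 : W ≠ 0 := by
    rintro rfl
    rw [margin_zero hk i₀] at hmar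
    exact lt_irrefl _ hmar
  refine ⟨hW0, ?_⟩
  have hNnn : 0 ≤ matNorm κ p W := by
    by_contra! hneg
    have h3 := (matNorm_isEntryDominatingNorm (k := k) (d := d) κ hp).entry_le W
    refine hW0 (Matrix.ext fun i j => ?_)
    exact absurd ((abs_nonneg _).trans (h3 i j)) (not_le.mpr hneg)
  have h3 := margin_le_of_norm_le (y := y) hp hk i₀ hx hNnn le_rfl
  have hN : ρ₀ * T / (4 * R) ≤ matNorm κ p W := by
    rw [div_le_iff₀ (by positivity)]
    linarith
  have hNpos : 0 < matNorm κ p W := lt_of_lt_of_le (by positivity) hN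
  set ρ := effMargin κ p X y m β R with hρdef
  have h4 : ρ * matNorm κ p W ≤ 2 * R * |B₀| + ρ * T := by
    have h5 : ρ * B₀ ≤ 2 * R * |B₀| :=
      (mul_le_mul_of_nonneg_left (le_abs_self B₀) (by linarith)).trans
        (mul_le_mul_of_nonneg_right hρR (abs_nonneg _))
    have := mul_le_mul_of_nonneg_left hW (by linarith : 0 ≤ ρ)
    linarith
  rw [marginGap]
  calc ρ - margin X y W / matNorm κ p W = (ρ * matNorm κ p W - margin X y W) / matNorm κ p W := by
        field_simp
    _ ≤ (2 * R * |B₀| + E) / matNorm κ p W := by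
        gcongr
        linarith
    _ ≤ _ := by gcongr

/-- The margin gap bound in terms of the accumulated step sizes, uniformly over all runs. -/
lemma exists_forall_marginGap_le (hc : 0 < c) (hR : 0 < R) (hρ₀ : 0 < ρ₀) (ha0 : 0 < a')
    (ha'1 : a' < 1) (ha : a' ≤ a) (ha1 : a ≤ 1) (hn : 0 < n) (hnm : n = m * b) (hβ0 : 0 < β)
    (hβ1 : β < 1) {t₀ : ℕ} (ht₀ : 1 ≤ t₀)
    (hlarge : burnInConst a' c R ρ₀ * momScale m β ≤ (t₀ : ℝ) ^ a') {T : ℝ} (hT0 : 0 ≤ T)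
    (hT : ∀ η, IsPolySchedule c a η → ∑ s ∈ Finset.range t₀, η s ≤ T) :
    ∃ N : ℕ, ∀ (k d : ℕ) (κ : NormKind) (p : ℝ≥0∞) (X : Fin n → Fin d → ℝ) (y : Fin n → Fin k)
      (η : ℕ → ℝ) (S : ℕ → Finset (Fin n)) (W M Δ : ℕ → Matrix (Fin k) (Fin d) ℝ),
      IsAdmissibleRun a c R ρ₀ B₀ Λ₀ m b β κ p X y η S W M Δ → ∀ t : ℕ, N ≤ t →
        W t ≠ 0 ∧ marginGap κ p X y m β R (W t) ≤
          (2 * R * |B₀| + (burnInDeficit R ρ₀ |Λ₀| n T +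
            descentConst c R * momScale m β * ∑ s ∈ Finset.range t, η s ^ 2)) /
            (ρ₀ * (∑ s ∈ Finset.range t, η s) / (4 * R)) := by
  have hm : 1 ≤ m := Nat.pos_of_ne_zero fun h0 => by simp [h0] at hnm; omega
  have hn' : (0 : ℝ) < n := by exact_mod_cast hn
  set K := descentConst c R * momScale m β with hK
  have hK0 : 0 ≤ K :=
    mul_nonneg (descentConst_pos hc hR).le (zero_le_one.trans (one_le_momScale hβ0 hβ1 hm))
  set E := burnInDeficit R ρ₀ |Λ₀| n T with hE
  have hE0 : 0 < E := by rw [hE, burnInDeficit]; positivity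
  set A := T + 8 * n * (|Λ₀| + 2 * R * T) / ρ₀ with hA
  have hA0 : 0 ≤ A := by positivity
  -- A is the step budget required by `IsAdmissibleRun.le_margin`; B makes the fixed part of the
  -- deficit at most ρ₀/4 times the accumulated steps.
  set B := 4 / ρ₀ * (E + K * (c * T)) with hB
  have hB0 : 0 < B := by positivity
  -- The step sums are at least c log t for every a ≤ 1, so this threshold depends on no data.
  refine ⟨⌈Real.exp ((A + B) / c)⌉₊ + t₀, fun k d κ p X y η S W M Δ h t ht => ?_⟩
  have ht0 : t₀ ≤ t := (Nat.le_add_left _ _).trans ht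
  have ht1 : 1 ≤ t := ht₀.trans ht0
  have hη := h.schedule.nonneg hc
  have hsum : A + B ≤ ∑ s ∈ Finset.range t, η s := by
    refine le_trans ?_ (h.schedule.log_le_sum hc ha1 ht1)
    rw [← div_le_iff₀' hc, Real.le_log_iff_exp_le (by exact_mod_cast ht1)]
    refine (Nat.le_ceil _).trans ?_
    exact_mod_cast (Nat.le_add_right _ _).trans ht
  have hΛ : Λ₀ ≤ |Λ₀| := le_abs_self _
  have hTsum := hT η h.schedule
  have h1 : effMargin κ p X y m β R * ∑ s ∈ Finset.range t, η s - (E +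
      K * ∑ s ∈ Finset.range t, η s ^ 2) ≤ margin X y (W t) := by
    have h2 := h.le_margin hc hR hρ₀ ha0 ha'1 ha ha1 hn hnm hβ0 hβ1 ht₀ hlarge hTsum ht0
      (by
        have : 8 * (n : ℝ) * (Λ₀ + 2 * R * T) / ρ₀ ≤ 8 * n * (|Λ₀| + 2 * R * T) / ρ₀ := by gcongr
        linarith)
    have h3 : burnInDeficit R ρ₀ Λ₀ n T ≤ E := by
      rw [hE, burnInDeficit, burnInDeficit]
      gcongr
    linarith
  set T' := ∑ s ∈ Finset.range t, η s with hT'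
  set Q := ∑ s ∈ Finset.range t, η s ^ 2 with hQ
  have hQ0 : 0 ≤ Q := Finset.sum_nonneg fun s _ => sq_nonneg _
  -- Before t₀ each square is at most c η_s; after t₀ the burn-in gives K η_s ≤ ρ₀/4. Together with
  -- B, at least half of ρ₀ times the steps survives in the margin.
  have hKQ : K * Q ≤ K * (c * T) + ρ₀ / 4 * T' := by
    have hQsplit : Q = ∑ s ∈ Finset.range t₀, η s ^ 2 + ∑ s ∈ Finset.Ico t₀ t, η s ^ 2 :=
      (Finset.sum_range_add_sum_Ico _ ht0).symm
    have hTsplit : ∑ s ∈ Finset.range t₀, η s + ∑ s ∈ Finset.Ico t₀ t, η s = T' :=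
      Finset.sum_range_add_sum_Ico _ ht0
    have h3 : ∑ s ∈ Finset.range t₀, η s ^ 2 ≤ c * T := by
      calc _ ≤ ∑ s ∈ Finset.range t₀, c * η s := by
            refine Finset.sum_le_sum fun s _ => ?_
            rw [sq]
            exact mul_le_mul_of_nonneg_right (h.schedule.le hc (ha0.le.trans ha) s) (hη s)
        _ = c * ∑ s ∈ Finset.range t₀, η s := by rw [Finset.mul_sum]
        _ ≤ _ := by gcongr
    have h4 : K * ∑ s ∈ Finset.Ico t₀ t, η s ^ 2 ≤ ρ₀ / 4 * ∑ s ∈ Finset.Ico t₀ t, η s := by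
      rw [Finset.mul_sum, Finset.mul_sum]
      refine Finset.sum_le_sum fun s hs => ?_
      have h5 := (burnIn_spec hc hR hρ₀ ha0 ha'1 ha hβ1 hm h.schedule ht₀ hlarge
        (Finset.mem_Ico.mp hs).1).2
      rw [sq, ← mul_assoc]
      exact mul_le_mul_of_nonneg_right h5 (hη s)
    have h6 : 0 ≤ ∑ s ∈ Finset.range t₀, η s := Finset.sum_nonneg fun s _ => hη s
    rw [hQsplit, mul_add]
    have h7 := mul_le_mul_of_nonneg_left h3 hK0
    have h8 : ρ₀ / 4 * ∑ s ∈ Finset.Ico t₀ t, η s ≤ ρ₀ / 4 * T' := by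
      gcongr; linarith
    linarith
  have hBT : E + K * (c * T) ≤ ρ₀ / 4 * T' := by
    have h3 : B ≤ T' := by linarith
    have h4 := mul_le_mul_of_nonneg_left h3 (by positivity : 0 ≤ ρ₀ / 4)
    have h5 : ρ₀ / 4 * B = E + K * (c * T) := by rw [hB]; field_simp
    linarith
  have hT'0 : 0 < T' := by linarith
  have hρT := mul_le_mul_of_nonneg_right h.le_effMargin hT'0.le
  have hnorm := h.run.norm_le h.one_le_p hη t
  exact marginGap_le_of_le_margin h.one_le_p h.two_le_classes ⟨0, hn⟩ hR h.norm_le hρ₀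
    h.le_effMargin (h.effMargin_le hn hm hβ1 hR.le) hT'0 (by linarith [h.init_norm_le])
    (add_nonneg hE0.le (mul_nonneg hK0 hQ0)) h1 (by linarith)

end Main

/-! ### Rates with constants independent of n, m, b and β -/

section Rates

variable {a a' c R ρ₀ B₀ Λ₀ : ℝ}

/-- Bounds on the sums of the step sizes and of their squares translate into a rate for the margin
gap whose constant is independent of `n`, `m`, `b` and `β`. -/
lemma exists_rate (hc : 0 < c) (hR : 0 < R) (hρ₀ : 0 < ρ₀) (ha0 : 0 < a')
    (ha'1 : a' < 1) (ha : a' ≤ a) (ha1 : a ≤ 1) {P : ℝ → Prop} {Φ : ℝ → ℝ} {q D : ℕ → ℝ}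
    {A B C₂ c₁ : ℝ} (hA : 0 ≤ A) (hB : 0 ≤ B) (hC₂ : 0 ≤ C₂) (hc₁ : 0 < c₁)
    (hburn : ∀ ξ, 1 ≤ ξ → P ξ → ∃ t₀ : ℕ, 1 ≤ t₀ ∧ burnInConst a' c R ρ₀ * ξ ≤ (t₀ : ℝ) ^ a' ∧
      ∀ η, IsPolySchedule c a η → ∑ s ∈ Finset.range t₀, η s ≤ A * Φ ξ)
    (hΦ : ∀ ξ, 1 ≤ ξ → P ξ → 0 ≤ Φ ξ ∧ 1 ≤ B * Φ ξ)
    (hq : ∀ η, IsPolySchedule c a η → ∀ t : ℕ, 2 ≤ t → ∑ s ∈ Finset.range t, η s ^ 2 ≤ C₂ * q t)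
    (hq0 : ∀ t : ℕ, 2 ≤ t → 0 ≤ q t)
    (hD : ∀ η, IsPolySchedule c a η → ∀ t : ℕ, 2 ≤ t → c₁ * D t ≤ ∑ s ∈ Finset.range t, η s)
    (hD0 : ∀ t : ℕ, 2 ≤ t → 0 < D t) :
    ∃ C : ℝ, 0 < C ∧ ∀ (n m b : ℕ) (β : ℝ), 0 < n → n = m * b → 0 < β → β < 1 →
      P (momScale m β) →
      ∃ N : ℕ, ∀ (k d : ℕ) (κ : NormKind) (p : ℝ≥0∞) (X : Fin n → Fin d → ℝ)
        (y : Fin n → Fin k) (η : ℕ → ℝ) (S : ℕ → Finset (Fin n))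
        (W M Δ : ℕ → Matrix (Fin k) (Fin d) ℝ),
        IsAdmissibleRun a c R ρ₀ B₀ Λ₀ m b β κ p X y η S W M Δ → ∀ t : ℕ, N ≤ t →
          marginGap κ p X y m β R (W t) ≤
            C * ((n * Φ (momScale m β) + momScale m β * q t) / D t) := by
  have hK := descentConst_pos hc hR
  -- Collects the coefficients of nΦ and ξ q; the hypothesis 1 ≤ B Φ absorbs the terms in B₀ and Λ₀
  -- and the additive 1 into multiples of nΦ.
  set C₁ := (2 * R * |B₀| + 1) * B + 2 * R * A + 16 * R * (|Λ₀| * B + 2 * R * A) / ρ₀ +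
    descentConst c R * C₂ + 1 with hC₁
  have hC₁pos : 0 < C₁ := by positivity
  refine ⟨C₁ / (ρ₀ * c₁ / (4 * R)), by positivity, fun n m b β hn hnm hβ0 hβ1 hP => ?_⟩
  have hm : 1 ≤ m := Nat.pos_of_ne_zero fun h0 => by simp [h0] at hnm; omega
  have hn' : (1 : ℝ) ≤ n := by exact_mod_cast hn
  have hξ := one_le_momScale hβ0 hβ1 hm
  set ξ := momScale m β with hξdef
  obtain ⟨t₀, ht₀, hlarge, hT⟩ := hburn ξ hξ hP
  obtain ⟨hΦ0, hΦ1⟩ := hΦ ξ hξ hP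
  obtain ⟨N, hN⟩ := exists_forall_marginGap_le (B₀ := B₀) (Λ₀ := Λ₀) hc hR hρ₀ ha0 ha'1 ha ha1 hn
    hnm hβ0 hβ1 ht₀ hlarge (mul_nonneg hA hΦ0) hT
  refine ⟨N + 2, fun k d κ p X y η S W M Δ h t ht => ?_⟩
  have ht2 : 2 ≤ t := (Nat.le_add_left _ _).trans ht
  refine (hN k d κ p X y η S W M Δ h t ((Nat.le_add_right _ _).trans ht)).2.trans ?_
  have hDt := hD0 t ht2
  have h1 := hD η h.schedule t ht2
  have h2 := hq η h.schedule t ht2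
  have h3 := hq0 t ht2
  set F := n * Φ ξ + ξ * q t with hF
  have hF0 : 0 ≤ F := by positivity
  have hnΦ : Φ ξ ≤ n * Φ ξ := le_mul_of_one_le_left hΦ0 hn'
  have hnum : 2 * R * |B₀| + (burnInDeficit R ρ₀ |Λ₀| n (A * Φ ξ) +
      descentConst c R * ξ * ∑ s ∈ Finset.range t, η s ^ 2) ≤ C₁ * F := by
    have e1 : (2 * R * |B₀| + 1) * 1 ≤ (2 * R * |B₀| + 1) * (B * (n * Φ ξ)) := by
      gcongr
      exact hΦ1.trans (by gcongr)
    have e2 : 2 * R * (A * Φ ξ) ≤ 2 * R * (A * (n * Φ ξ)) := by gcongr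
    have e3 : 2 * R * (8 * n * (|Λ₀| * 1 + 2 * R * (A * Φ ξ)) / ρ₀) ≤
        2 * R * (8 * n * (|Λ₀| * (B * Φ ξ) + 2 * R * (A * Φ ξ)) / ρ₀) := by gcongr
    have e4 : descentConst c R * ξ * ∑ s ∈ Finset.range t, η s ^ 2 ≤
        descentConst c R * ξ * (C₂ * q t) := by gcongr
    have e5 : 2 * R * (8 * n * (|Λ₀| * (B * Φ ξ) + 2 * R * (A * Φ ξ)) / ρ₀) =
        16 * R * (|Λ₀| * B + 2 * R * A) / ρ₀ * (n * Φ ξ) := by ring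
    have e6 : 0 ≤ ((2 * R * |B₀| + 1) * B + 2 * R * A +
        16 * R * (|Λ₀| * B + 2 * R * A) / ρ₀ + 1) * (ξ * q t) := by positivity
    have e7 : 0 ≤ (descentConst c R * C₂ + 1) * (n * Φ ξ) := by positivity
    calc _ = (2 * R * |B₀| + 1) * 1 + 2 * R * (A * Φ ξ) +
          2 * R * (8 * n * (|Λ₀| * 1 + 2 * R * (A * Φ ξ)) / ρ₀) +
          descentConst c R * ξ * ∑ s ∈ Finset.range t, η s ^ 2 := by rw [burnInDeficit]; ring
      _ ≤ _ := add_le_add (add_le_add (add_le_add e1 e2) (e3.trans_eq e5)) e4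
      _ ≤ C₁ * F := by
          rw [hC₁, hF]
          generalize 16 * R * (|Λ₀| * B + 2 * R * A) / ρ₀ = V at e6 ⊢
          linarith
  have hnum0 : 0 ≤ C₁ * F := by positivity
  calc _ ≤ C₁ * F / (ρ₀ * (c₁ * D t) / (4 * R)) := by gcongr
    _ = _ := by field_simp

lemma one_le_ceil_rpow {z : ℝ} (hz : 0 < z) (r : ℝ) : 1 ≤ ⌈z ^ r⌉₊ :=
  Nat.one_le_iff_ne_zero.mpr (Nat.ceil_pos.mpr (Real.rpow_pos_of_pos hz r)).ne'

lemma le_ceil_rpow {z : ℝ} (hz : 0 < z) (ha : 0 < a) : z ≤ (⌈z ^ (1 / a)⌉₊ : ℝ) ^ a := by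
  calc z = (z ^ (1 / a)) ^ a := by
        rw [← Real.rpow_mul hz.le, one_div_mul_cancel ha.ne', Real.rpow_one]
    _ ≤ _ := by
        gcongr
        exact Nat.le_ceil _

lemma ceil_mul_rpow_le {K ξ r : ℝ} (hK : 0 < K) (hξ : 1 ≤ ξ) (hr : 0 ≤ r) :
    (⌈(K * ξ) ^ r⌉₊ : ℝ) ≤ (K ^ r + 1) * ξ ^ r := by
  have h1 := (Nat.ceil_lt_add_one (Real.rpow_nonneg (by positivity : 0 ≤ K * ξ) r)).le
  have h2 : 1 ≤ ξ ^ r := Real.one_le_rpow hξ hr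
  rw [Real.mul_rpow hK.le (by linarith)] at h1
  rw [Real.mul_rpow hK.le (by linarith)]
  linarith

/-- The iterates are eventually nonzero. -/
lemma exists_forall_ne_zero (hc : 0 < c) (hR : 0 < R) (hρ₀ : 0 < ρ₀) (ha0 : 0 < a)
    (ha1 : a ≤ 1) {n m b : ℕ} {β : ℝ} (hn : 0 < n) (hnm : n = m * b) (hβ0 : 0 < β)
    (hβ1 : β < 1) :
    ∃ N : ℕ, ∀ (k d : ℕ) (κ : NormKind) (p : ℝ≥0∞) (X : Fin n → Fin d → ℝ)
      (y : Fin n → Fin k) (η : ℕ → ℝ) (S : ℕ → Finset (Fin n))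
      (W M Δ : ℕ → Matrix (Fin k) (Fin d) ℝ),
      IsAdmissibleRun a c R ρ₀ B₀ Λ₀ m b β κ p X y η S W M Δ → ∀ t : ℕ, N ≤ t → W t ≠ 0 := by
  have hm : 1 ≤ m := Nat.pos_of_ne_zero fun h0 => by simp [h0] at hnm; omega
  have hξ := one_le_momScale hβ0 hβ1 hm
  -- The auxiliary exponent a/2 is below 1 for all a ≤ 1; its effect on the size of N is irrelevant
  -- here.
  have ha2 : a / 2 < 1 := by linarith
  have hz : 0 < burnInConst (a / 2) c R ρ₀ * momScale m β :=
    mul_pos (burnInConst_pos hc hR hρ₀ ha2) (by linarith)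
  have h1 : 0 < 1 - a / 2 := by linarith
  obtain ⟨N, hN⟩ := exists_forall_marginGap_le (B₀ := B₀) (Λ₀ := Λ₀) hc hR hρ₀ (half_pos ha0) ha2
    (by linarith : a / 2 ≤ a) ha1 hn hnm hβ0 hβ1 (one_le_ceil_rpow hz (1 / (a / 2)))
    (le_ceil_rpow hz (half_pos ha0)) (by positivity)
    (fun η hη => hη.sum_le hc (half_pos ha0).le ha2 (by linarith) _)
  exact ⟨N, fun k d κ p X y η S W M Δ h t ht => (hN k d κ p X y η S W M Δ h t ht).1⟩

/-- With a' = a the time t₀ is of order ξ^(1/a), and its steps add up to order t₀^(1-a) = ξ^(1/a-1).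
-/
lemma exists_burnIn_of_lt_one (hc : 0 < c) (hR : 0 < R) (hρ₀ : 0 < ρ₀) (ha0 : 0 < a)
    (ha1 : a < 1) : ∃ A : ℝ, 0 ≤ A ∧ ∀ ξ : ℝ, 1 ≤ ξ →
      ∃ t₀ : ℕ, 1 ≤ t₀ ∧ burnInConst a c R ρ₀ * ξ ≤ (t₀ : ℝ) ^ a ∧
        ∀ η, IsPolySchedule c a η → ∑ s ∈ Finset.range t₀, η s ≤ A * ξ ^ (1 / a - 1) := by
  have hK := burnInConst_pos hc hR hρ₀ ha1
  set K := burnInConst a c R ρ₀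
  have h1a : 0 < 1 - a := by linarith
  refine ⟨c + c * ((K ^ (1 / a) + 1) ^ (1 - a) / (1 - a)), by positivity, fun ξ hξ => ?_⟩
  have hz : 0 < K * ξ := by positivity
  refine ⟨⌈(K * ξ) ^ (1 / a)⌉₊, one_le_ceil_rpow hz _, le_ceil_rpow hz ha0, fun η hη => ?_⟩
  refine (hη.sum_le hc ha0.le ha1 le_rfl _).trans ?_
  have hexp : 0 ≤ 1 / a - 1 := by
    rw [sub_nonneg, le_div_iff₀ ha0]; linarith
  have h2 : 1 ≤ ξ ^ (1 / a - 1) := Real.one_le_rpow hξ hexp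
  have h3 : (⌈(K * ξ) ^ (1 / a)⌉₊ : ℝ) ^ (1 - a) ≤
      (K ^ (1 / a) + 1) ^ (1 - a) * ξ ^ (1 / a - 1) := by
    calc _ ≤ ((K ^ (1 / a) + 1) * ξ ^ (1 / a)) ^ (1 - a) := by
          gcongr
          exact ceil_mul_rpow_le hK hξ (by positivity)
      _ = _ := by
          rw [Real.mul_rpow (by positivity) (by positivity), ← Real.rpow_mul (by linarith)]
          congr 2
          field_simp
  calc _ ≤ c * ξ ^ (1 / a - 1) +
        c * ((K ^ (1 / a) + 1) ^ (1 - a) * ξ ^ (1 / a - 1) / (1 - a)) := by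
        gcongr
        exact le_mul_of_one_le_right hc.le h2
    _ = _ := by ring

/-- With a' = 1/2 the time t₀ is of order ξ², which only doubles the logarithm. The additive
constants are absorbed through log ξ ≥ log ξ₀ > 0. -/
lemma exists_burnIn_of_eq_one (hc : 0 < c) (hR : 0 < R) (hρ₀ : 0 < ρ₀) {ξ₀ : ℝ}
    (hξ₀ : 1 < ξ₀) : ∃ A : ℝ, 0 ≤ A ∧ ∀ ξ : ℝ, 1 ≤ ξ → ξ₀ ≤ ξ →
      ∃ t₀ : ℕ, 1 ≤ t₀ ∧ burnInConst (1 / 2) c R ρ₀ * ξ ≤ (t₀ : ℝ) ^ (1 / 2 : ℝ) ∧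
        ∀ η, IsPolySchedule c 1 η → ∑ s ∈ Finset.range t₀, η s ≤ A * Real.log ξ := by
  have hK := burnInConst_pos (a' := 1 / 2) hc hR hρ₀ (by norm_num)
  set K := burnInConst (1 / 2) c R ρ₀
  have hl0 : 0 < Real.log ξ₀ := Real.log_pos hξ₀
  set r : ℝ := 1 / (1 / 2) with hr
  have hr2 : r = 2 := by norm_num [hr]
  have hKr : 0 ≤ Real.log (K ^ r + 1) := Real.log_nonneg (by
    have : 0 < K ^ r := by positivity
    linarith)
  refine ⟨c * (2 + Real.log (K ^ r + 1)) / Real.log ξ₀ + c * 2, by positivity,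
    fun ξ hξ hξξ => ?_⟩
  have hz : 0 < K * ξ := by positivity
  refine ⟨⌈(K * ξ) ^ r⌉₊, one_le_ceil_rpow hz _, le_ceil_rpow hz (by norm_num), fun η hη => ?_⟩
  refine (hη.sum_le_log hc (one_le_ceil_rpow hz _)).trans ?_
  have h1 : Real.log (⌈(K * ξ) ^ r⌉₊ : ℝ) ≤ Real.log (K ^ r + 1) + 2 * Real.log ξ := by
    have h2 := Real.log_le_log (by exact_mod_cast one_le_ceil_rpow hz r)
      (ceil_mul_rpow_le hK hξ (by rw [hr2]; norm_num : 0 ≤ r))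
    rw [Real.log_mul (by positivity) (by positivity),
      Real.log_rpow (by linarith : 0 < ξ), hr2] at h2
    rw [hr2]
    exact h2
  have h3 : Real.log ξ₀ ≤ Real.log ξ := Real.log_le_log (by linarith) hξξ
  have h4 : c * (2 + Real.log (K ^ r + 1)) ≤
      c * (2 + Real.log (K ^ r + 1)) / Real.log ξ₀ * Real.log ξ := by
    rw [div_mul_eq_mul_div, le_div_iff₀ hl0]
    gcongr
  calc _ ≤ c * (2 + (Real.log (K ^ r + 1) + 2 * Real.log ξ)) := by gcongr
    _ = c * (2 + Real.log (K ^ r + 1)) + c * 2 * Real.log ξ := by ring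
    _ ≤ _ := by
        rw [add_mul]
        gcongr

end Rates

/-- The margin gap rate for `a < 1`, given a bound on the sum of the squared step sizes. -/
lemma exists_rate_of_lt_one {a c R ρ₀ : ℝ} (B₀ Λ₀ : ℝ) (hc : 0 < c) (hR : 0 < R) (hρ₀ : 0 < ρ₀)
    (ha0 : 0 < a) (ha1 : a < 1) {q : ℕ → ℝ} {C₂ : ℝ} (hC₂ : 0 ≤ C₂)
    (hq : ∀ η, IsPolySchedule c a η → ∀ t : ℕ, 2 ≤ t → ∑ s ∈ Finset.range t, η s ^ 2 ≤ C₂ * q t)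
    (hq0 : ∀ t : ℕ, 2 ≤ t → 0 ≤ q t) :
    ∃ C : ℝ, 0 < C ∧ ∀ (n m b : ℕ) (β : ℝ), 0 < n → n = m * b → 0 < β → β < 1 →
      ∃ N : ℕ, ∀ (k d : ℕ) (κ : NormKind) (p : ℝ≥0∞) (X : Fin n → Fin d → ℝ)
        (y : Fin n → Fin k) (η : ℕ → ℝ) (S : ℕ → Finset (Fin n))
        (W M Δ : ℕ → Matrix (Fin k) (Fin d) ℝ),
        IsAdmissibleRun a c R ρ₀ B₀ Λ₀ m b β κ p X y η S W M Δ → ∀ t : ℕ, N ≤ t →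
          marginGap κ p X y m β R (W t) ≤
            C * ((n * momScale m β ^ (1 / a - 1) + momScale m β * q t) / (t : ℝ) ^ (1 - a)) := by
  obtain ⟨A, hA, hburn⟩ := exists_burnIn_of_lt_one hc hR hρ₀ ha0 ha1
  have hexp : 0 ≤ 1 / a - 1 := by
    rw [sub_nonneg, le_div_iff₀ ha0]; linarith
  obtain ⟨C, hC, h⟩ := exists_rate (B₀ := B₀) (Λ₀ := Λ₀) (P := fun _ => True)
    (Φ := fun ξ => ξ ^ (1 / a - 1)) (q := q) (D := fun t => (t : ℝ) ^ (1 - a)) hc hR hρ₀ ha0 ha1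
    le_rfl ha1.le hA zero_le_one hC₂ (half_pos hc) (fun ξ hξ _ => hburn ξ hξ)
    (fun ξ hξ _ => ⟨by positivity, by rw [one_mul]; exact Real.one_le_rpow hξ hexp⟩) hq hq0
    (fun η hη t ht => hη.rpow_le_sum hc ha0.le ht)
    (fun t ht => Real.rpow_pos_of_pos (by exact_mod_cast (by omega : 0 < t)) _)
  exact ⟨C, hC, fun n m b β hn hnm hβ0 hβ1 => h n m b β hn hnm hβ0 hβ1 trivial⟩

/-- The squares ∑ t^(-2) converge, so q = 1. The condition ξ₀ ≤ ξ supplies 1 ≤ B log ξ, which has no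
uniform B as ξ tends to 1. -/
lemma exists_rate_of_eq_one {c R ρ₀ ξ₀ : ℝ} (B₀ Λ₀ : ℝ) (hc : 0 < c) (hR : 0 < R) (hρ₀ : 0 < ρ₀)
    (hξ₀ : 1 < ξ₀) :
    ∃ C : ℝ, 0 < C ∧ ∀ (n m b : ℕ) (β : ℝ), 0 < n → n = m * b → 0 < β → β < 1 →
      ξ₀ ≤ momScale m β →
      ∃ N : ℕ, ∀ (k d : ℕ) (κ : NormKind) (p : ℝ≥0∞) (X : Fin n → Fin d → ℝ)
        (y : Fin n → Fin k) (η : ℕ → ℝ) (S : ℕ → Finset (Fin n))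
        (W M Δ : ℕ → Matrix (Fin k) (Fin d) ℝ),
        IsAdmissibleRun 1 c R ρ₀ B₀ Λ₀ m b β κ p X y η S W M Δ → ∀ t : ℕ, N ≤ t →
          marginGap κ p X y m β R (W t) ≤
            C * ((n * Real.log (momScale m β) + momScale m β) / Real.log t) := by
  obtain ⟨A, hA, hburn⟩ := exists_burnIn_of_eq_one hc hR hρ₀ hξ₀
  have hl0 : 0 < Real.log ξ₀ := Real.log_pos hξ₀
  obtain ⟨C, hC, h⟩ := exists_rate (B₀ := B₀) (Λ₀ := Λ₀) (P := fun ξ => ξ₀ ≤ ξ)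
    (Φ := fun ξ => Real.log ξ) (q := fun _ => 1) (D := fun t => Real.log t)
    (B := 1 / Real.log ξ₀) (C₂ := c ^ 2 * (1 + ∑' s : ℕ, ((s : ℝ) + 1) ^ (-(2 * 1 : ℝ)))) hc hR hρ₀
    (by norm_num : (0 : ℝ) < 1 / 2) (by norm_num) (by norm_num) le_rfl hA (by positivity)
    (mul_nonneg (by positivity)
      (add_nonneg zero_le_one (tsum_nonneg fun s => by positivity))) hc
    hburn
    (fun ξ hξ hξξ => ⟨Real.log_nonneg hξ, by
      rw [one_div, ← div_eq_inv_mul, le_div_iff₀ hl0, one_mul]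
      exact Real.log_le_log (by linarith) hξξ⟩)
    (fun η hη t _ => by
      rw [mul_one]
      exact hη.sq.sum_le_const (by positivity) (by norm_num) t)
    (fun t _ => zero_le_one) (fun η hη t ht => hη.log_le_sum hc le_rfl (by omega))
    (fun t ht => Real.log_pos (by exact_mod_cast (by omega : 1 < t)))
  refine ⟨C, hC, fun n m b β hn hnm hβ0 hβ1 hξ => ?_⟩
  simpa using h n m b β hn hnm hβ0 hβ1 hξ

/-- A conditional rate for admissible runs, restated with all assumptions spelled out and together
with the fact that the iterates are eventually nonzero. -/
lemma exists_forall_ne_zero_and_le {a c R ρ₀ B₀ Λ₀ : ℝ} (hc : 0 < c) (hR : 0 < R) (hρ₀ : 0 < ρ₀)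
    (ha0 : 0 < a) (ha1 : a ≤ 1) {P : ℝ → Prop} {bound : ℕ → ℝ → ℕ → ℝ}
    (h : ∀ (n m b : ℕ) (β : ℝ), 0 < n → n = m * b → 0 < β → β < 1 → P (momScale m β) →
      ∃ N : ℕ, ∀ (k d : ℕ) (κ : NormKind) (p : ℝ≥0∞) (X : Fin n → Fin d → ℝ)
        (y : Fin n → Fin k) (η : ℕ → ℝ) (S : ℕ → Finset (Fin n))
        (W M Δ : ℕ → Matrix (Fin k) (Fin d) ℝ),
        IsAdmissibleRun a c R ρ₀ B₀ Λ₀ m b β κ p X y η S W M Δ → ∀ t : ℕ, N ≤ t →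
          marginGap κ p X y m β R (W t) ≤ bound n (momScale m β) t)
    (n m b : ℕ) (β : ℝ) (hnm : n = m * b) (hβ0 : 0 < β) (hβ1 : β < 1) :
    ∃ N : ℕ, ∀ (k d : ℕ) (κ : NormKind) (p : ℝ≥0∞) (X : Fin n → Fin d → ℝ) (y : Fin n → Fin k)
      (η : ℕ → ℝ) (S : ℕ → Finset (Fin n)) (W M Δ : ℕ → Matrix (Fin k) (Fin d) ℝ),
      1 ≤ p → 2 ≤ k → Function.Surjective y → Separable X y →
      (∀ i, ∑ j, |X i j| ≤ R) →
      ρ₀ ≤ effMargin κ p X y m β R →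
      IsPolySchedule c a η → IsReshuffling m b S → IsMomentumRun κ p X y β η S W M Δ →
      matNorm κ p (W 0) ≤ B₀ → loss X y (W 0) ≤ Λ₀ →
      ∀ t : ℕ, N ≤ t → 2 ≤ t ∧ 0 < n ∧ 1 ≤ momScale m β ∧ W t ≠ 0 ∧
        (P (momScale m β) → marginGap κ p X y m β R (W t) ≤ bound n (momScale m β) t) := by
  rcases Nat.eq_zero_or_pos n with hn | hn
  · subst hn
    -- Without samples no labelling is onto at least two classes, so any N serves.
    refine ⟨0, fun k d κ p X y η S W M Δ _ hk hy => ?_⟩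
    obtain ⟨i, -⟩ := hy ⟨0, by omega⟩
    exact i.elim0
  have hm : 1 ≤ m := Nat.pos_of_ne_zero fun h0 => by simp [h0] at hnm; omega
  obtain ⟨N₁, hN₁⟩ := exists_forall_ne_zero (B₀ := B₀) (Λ₀ := Λ₀) hc hR hρ₀ ha0 ha1 hn hnm hβ0 hβ1
  by_cases hP : P (momScale m β)
  · obtain ⟨N₂, hN₂⟩ := h n m b β hn hnm hβ0 hβ1 hP
    refine ⟨N₁ + N₂ + 2, fun k d κ p X y η S W M Δ hp hk _ _ hx hρ hη hS hrun hB hΛ t ht => ?_⟩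
    have hadm : IsAdmissibleRun a c R ρ₀ B₀ Λ₀ m b β κ p X y η S W M Δ :=
      ⟨hp, hk, hx, hρ, hη, hS, hrun, hB, hΛ⟩
    exact ⟨by omega, hn, one_le_momScale hβ0 hβ1 hm,
      hN₁ k d κ p X y η S W M Δ hadm t (by omega),
      fun _ => hN₂ k d κ p X y η S W M Δ hadm t (by omega)⟩
  · refine ⟨N₁ + 2, fun k d κ p X y η S W M Δ hp hk _ _ hx hρ hη hS hrun hB hΛ t ht => ?_⟩
    exact ⟨by omega, hn, one_le_momScale hβ0 hβ1 hm,
      hN₁ k d κ p X y η S W M Δ ⟨hp, hk, hx, hρ, hη, hS, hrun, hB, hΛ⟩ t (by omega),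
      fun hP' => absurd hP' hP⟩

end MaxMargin

/-! ### Assembly of the four regimes -/

theorem corollary4p4 (a c R ρ₀ B₀ Λ₀ ξ₀ : ℝ) (ha : 0 < a) (ha1 : a ≤ 1) (hc : 0 < c) (hR : 0 < R)
    (hρ₀ : 0 < ρ₀) (hξ₀ : 1 < ξ₀) :
    ∃ C : ℝ, 0 < C ∧
      ∀ (n m b : ℕ) (β₁ : ℝ), n = m * b → 0 < β₁ → β₁ < 1 →
      ∃ N : ℕ, ∀ (k d : ℕ) (κ : NormKind) (p : ℝ≥0∞) (X : Fin n → Fin d → ℝ) (y : Fin n → Fin k)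
        (η : ℕ → ℝ) (S : ℕ → Finset (Fin n)) (W M Δ : ℕ → Matrix (Fin k) (Fin d) ℝ),
        1 ≤ p → 2 ≤ k → Function.Surjective y → Separable X y →
        (∀ i, ∑ j, |X i j| ≤ R) →
        ρ₀ ≤ effMargin κ p X y m β₁ R →
        IsPolySchedule c a η → IsReshuffling m b S → IsMomentumRun κ p X y β₁ η S W M Δ →
        matNorm κ p (W 0) ≤ B₀ → loss X y (W 0) ≤ Λ₀ →
        ∀ t : ℕ, N ≤ t →
          W t ≠ 0 ∧
          (a < 1 / 2 → marginGap κ p X y m β₁ R (W t) ≤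
            C * (((n : ℝ) * momScale m β₁ ^ (1 / a - 1) + momScale m β₁ * (t : ℝ) ^ (1 - 2 * a))
              / (t : ℝ) ^ (1 - a))) ∧
          (a = 1 / 2 → marginGap κ p X y m β₁ R (W t) ≤
            C * (momScale m β₁ * ((n : ℝ) + Real.log t) / (t : ℝ) ^ (1 / 2 : ℝ))) ∧
          (1 / 2 < a → a < 1 → marginGap κ p X y m β₁ R (W t) ≤
            C * (((n : ℝ) * momScale m β₁ ^ (1 / a - 1) + momScale m β₁) / (t : ℝ) ^ (1 - a))) ∧
          (a = 1 → ξ₀ ≤ momScale m β₁ → marginGap κ p X y m β₁ R (W t) ≤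
            C * (((n : ℝ) * Real.log (momScale m β₁) + momScale m β₁) / Real.log t)) := by
  rcases lt_trichotomy a (1 / 2) with h | h | h
  · have h2a : 0 < 1 - 2 * a := by linarith
    obtain ⟨C, hC, hrate⟩ := exists_rate_of_lt_one (q := fun t => (t : ℝ) ^ (1 - 2 * a))
      (C₂ := c ^ 2 + c ^ 2 / (1 - 2 * a)) B₀ Λ₀ hc hR hρ₀ ha (by linarith) (by positivity)
      (fun η hη t ht => by
        refine (hη.sq.sum_le (by positivity) (by linarith) (by linarith) le_rfl t).trans ?_
        have ht1 : (1 : ℝ) ≤ (t : ℝ) ^ (1 - 2 * a) :=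
          Real.one_le_rpow (by exact_mod_cast (by omega : 1 ≤ t)) h2a.le
        have := mul_le_mul_of_nonneg_left ht1 (sq_nonneg c)
        calc _ ≤ c ^ 2 * (t : ℝ) ^ (1 - 2 * a) +
              c ^ 2 * ((t : ℝ) ^ (1 - 2 * a) / (1 - 2 * a)) := by linarith
          _ = _ := by ring)
      (fun t _ => by positivity)
    refine ⟨C, hC, fun n m b β₁ hnm hβ0 hβ1 => ?_⟩
    obtain ⟨N, hN⟩ := exists_forall_ne_zero_and_le (B₀ := B₀) (Λ₀ := Λ₀)
      (P := fun _ => True) (bound := fun n ξ t =>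
        C * ((n * ξ ^ (1 / a - 1) + ξ * (t : ℝ) ^ (1 - 2 * a)) / (t : ℝ) ^ (1 - a))) hc hR hρ₀ ha ha1
      (fun n m b β hn hnm hβ0 hβ1 _ => hrate n m b β hn hnm hβ0 hβ1) n m b β₁ hnm hβ0 hβ1
    refine ⟨N, fun k d κ p X y η S W M Δ hp hk hy hsep hx hρ hη hS hrun hB hΛ t ht => ?_⟩
    obtain ⟨-, -, -, h0, hgap⟩ := hN k d κ p X y η S W M Δ hp hk hy hsep hx hρ hη hS hrun hB hΛ t ht
    exact ⟨h0, fun _ => hgap trivial, fun h' => by linarith, fun h' => by linarith,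
      fun h' => by linarith⟩
  · subst h
    obtain ⟨C, hC, hrate⟩ := exists_rate_of_lt_one (q := fun t => 1 + Real.log t)
      (C₂ := 2 * c ^ 2) B₀ Λ₀ hc hR hρ₀ ha (by norm_num) (by positivity)
      (fun η hη t ht => by
        have hsq := hη.sq
        rw [show (2 : ℝ) * (1 / 2) = 1 by norm_num] at hsq
        refine (hsq.sum_le_log (by positivity) (by omega)).trans ?_
        have := mul_nonneg (sq_nonneg c) (Real.log_natCast_nonneg t)
        linarith)
      (fun t _ => add_nonneg zero_le_one (Real.log_natCast_nonneg t))
    -- The doubling merges nξ + ξ(1 + log t) into ξ(n + log t), using n ≥ 1.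
    refine ⟨2 * C, by positivity, fun n m b β₁ hnm hβ0 hβ1 => ?_⟩
    obtain ⟨N, hN⟩ := exists_forall_ne_zero_and_le (B₀ := B₀) (Λ₀ := Λ₀)
      (P := fun _ => True) (bound := fun n ξ t =>
        C * ((n * ξ ^ ((1 : ℝ) / (1 / 2) - 1) + ξ * (1 + Real.log t)) / (t : ℝ) ^ ((1 : ℝ) - 1 / 2))) hc hR hρ₀ ha ha1
      (fun n m b β hn hnm hβ0 hβ1 _ => hrate n m b β hn hnm hβ0 hβ1) n m b β₁ hnm hβ0 hβ1
    refine ⟨N, fun k d κ p X y η S W M Δ hp hk hy hsep hx hρ hη hS hrun hB hΛ t ht => ?_⟩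
    obtain ⟨ht2, hn, hξ, h0, hgap⟩ :=
      hN k d κ p X y η S W M Δ hp hk hy hsep hx hρ hη hS hrun hB hΛ t ht
    refine ⟨h0, fun h' => by linarith, fun _ => ?_, fun h' => by linarith, fun h' => by linarith⟩
    refine (hgap trivial).trans ?_
    have hn1 : (1 : ℝ) ≤ n := by exact_mod_cast hn
    have hlog := Real.log_natCast_nonneg t
    rw [show (1 : ℝ) / (1 / 2) - 1 = 1 by norm_num, show (1 : ℝ) - 1 / 2 = 1 / 2 by norm_num,
      Real.rpow_one]
    calc _ ≤ C * ((2 * (momScale m β₁ * ((n : ℝ) + Real.log t))) / (t : ℝ) ^ (1 / 2 : ℝ)) := by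
          gcongr
          nlinarith
      _ = _ := by ring
  · rcases ha1.lt_or_eq with h1 | rfl
    -- For a > 1/2 the squared step sizes are summable, so q is constant.
    · obtain ⟨C, hC, hrate⟩ := exists_rate_of_lt_one (q := fun _ => 1)
        (C₂ := c ^ 2 * (1 + ∑' s : ℕ, ((s : ℝ) + 1) ^ (-(2 * a)))) B₀ Λ₀ hc hR hρ₀ ha h1
        (mul_nonneg (sq_nonneg c) (add_nonneg zero_le_one (tsum_nonneg fun s => by positivity)))
        (fun η hη t _ => by
          rw [mul_one]
          exact hη.sq.sum_le_const (by positivity) (by linarith) t)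
        (fun t _ => zero_le_one)
      refine ⟨C, hC, fun n m b β₁ hnm hβ0 hβ1 => ?_⟩
      obtain ⟨N, hN⟩ := exists_forall_ne_zero_and_le (B₀ := B₀) (Λ₀ := Λ₀)
        (P := fun _ => True) (bound := fun n ξ t =>
          C * ((n * ξ ^ (1 / a - 1) + ξ * 1) / (t : ℝ) ^ (1 - a))) hc hR hρ₀ ha ha1
        (fun n m b β hn hnm hβ0 hβ1 _ => hrate n m b β hn hnm hβ0 hβ1) n m b β₁ hnm hβ0 hβ1
      refine ⟨N, fun k d κ p X y η S W M Δ hp hk hy hsep hx hρ hη hS hrun hB hΛ t ht => ?_⟩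
      obtain ⟨-, -, -, h0, hgap⟩ :=
        hN k d κ p X y η S W M Δ hp hk hy hsep hx hρ hη hS hrun hB hΛ t ht
      exact ⟨h0, fun h' => by linarith, fun h' => by linarith,
        fun _ _ => by simpa using hgap trivial, fun h' => by linarith⟩
    · obtain ⟨C, hC, hrate⟩ := exists_rate_of_eq_one B₀ Λ₀ hc hR hρ₀ hξ₀
      refine ⟨C, hC, fun n m b β₁ hnm hβ0 hβ1 => ?_⟩
      obtain ⟨N, hN⟩ := exists_forall_ne_zero_and_le (B₀ := B₀) (Λ₀ := Λ₀)
        (P := fun ξ => ξ₀ ≤ ξ)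
        (bound := fun n ξ t => C * ((n * Real.log ξ + ξ) / Real.log t)) hc hR hρ₀ ha ha1
        hrate n m b β₁ hnm hβ0 hβ1
      refine ⟨N, fun k d κ p X y η S W M Δ hp hk hy hsep hx hρ hη hS hrun hB hΛ t ht => ?_⟩
      obtain ⟨-, -, -, h0, hgap⟩ :=
        hN k d κ p X y η S W M Δ hp hk hy hsep hx hρ hη hS hrun hB hΛ t ht
      exact ⟨h0, fun h' => by linarith, fun h' => by linarith, fun _ h' => by linarith,
        fun _ hξ => hgap hξ⟩
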